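/- Work in hyperbolic space $\mathbb H^3=\{x\in\mathbb R^{3,1}: \langle x,x\rangle=-1,\ x_0>0\}$ and its Klein model, the open unit ball of $\mathbb R^3$. For $a,b>0$ with $\frac{a^2}{3}+\frac{b^2}{4}<1$ let $P(a,b)\subset\mathbb H^3$ be the symmetric twisted octahedron that is represented in the Klein model by the following Euclidean polyhedron centered at the origin: $ABC$ is an equilateral triangle with edge length $a$, $A'B'C'$ is its image under a screw motion with rotation angle $\frac\pi2$ and translation length $b$ along the line $l$ through the center of $ABC$ orthogonal to its plane ($A,B,C$ following each other in the sense of this rotation), and the faces are $ABC$, $A'B'C'$, $ABC'$, $A'BC$, $AB'C$, $A'B'C$, $AB'C'$, $A'BC'$. Its symmetry group is generated by the rotation through $\frac{2\pi}3$ about $l$ and the half-turn about a line orthogonal to $l$ exchanging $A\leftrightarrow A'$, $B\leftrightarrow C'$, $C\leftrightarrow B'$. An infinitesimal isometric deformation of a polyhedron with vertices $p_i\in\mathbb H^3$ is a family of vectors $q_i\in T_{p_i}\mathbb H^3$ such that $\frac{d}{dt}\big|_{t=0}\operatorname{dist}(\exp_{p_i}(tq_i),\exp_{p_j}(tq_j))=0$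 for all edges $p_ip_j$; it is trivial if it is the restriction of a Killing field. Let $P_t$ be the polyhedron with the same combinatorics and with vertices $\exp_{p_i}(tq_i)$. Put $$M^1_t=P_t\cup_\partial P_t,\qquad M^2_t=P_t\cup_\partial P_{-t},\qquad M^3_t=P_{-t}\cup_\partial P_{-t},$$ where $\cup_\partial$ means gluing along the boundaries by the isometries of corresponding faces. Such a gluing is defined, and is a hyperbolic cone-manifold, if both pieces are compact polyhedra without self-intersections and their corresponding edges have equal lengths; the cone angle at the segment arising from a pair of corresponding edges is the sum of the interior dihedral angles of the two pieces at these edges. **Proposition.** Let $A,B\subset\mathbb R$ be intervals with more than one point such that $a,b>0$ and $\frac{a^2}3+\frac{b^2}4<1$ for all $a\in A$, $b\in B$. For each $(a,b)\in A\times B$ let $q(a,b)$ be a non-trivial infinitesimal isometric deformation of $P(a,b)$ that is invariant under the symmetry group of $P(a,b)$ and depends continuously on $(a,b)$, and let $M^i_t(a,b)$, $i=1,2,3$, be the cone-manifolds constructed from $P(a,b)$ and $q(a,b)$. Then for every $\varepsilon>0$ there exist indices $i\ne j$ in $\{1,2,3\}$, numbers $t_1,t_2\in(0,\varepsilon]$,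 $a_1,a_2\in A$ and $b_1,b_2\in B$ such that the cone-manifolds $M^i_{t_1}(a_1,b_1)$ and $M^j_{t_2}(a_2,b_2)$ are defined and have the same cone angles at all twelve pairs of corresponding segments. -/

import Mathlib

namespace TwistedOcta

/-! ### Hyperbolic space: the hyperboloid in Minkowski space `ℝ^{3,1}` -/

/-- The vector space underlying Minkowski space; coordinate `0` is the time coordinate. -/
abbrev Mink : Type := Fin 4 → ℝ

/-- The Minkowski scalar product. -/
def mink (x y : Mink) : ℝ := -(x 0 * y 0) + x 1 * y 1 + x 2 * y 2 + x 3 * y 3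

/-- Hyperbolic 3-space: the upper sheet of the hyperboloid `⟨x, x⟩ = -1`. -/
def Hyp : Set Mink := {x | mink x x = -1 ∧ 0 < x 0}

/-- The hyperbolic distance, `cosh (hdist x y) = -⟨x, y⟩`. -/
noncomputable def hdist (x y : Mink) : ℝ := Real.arcosh (-mink x y)

/-- The exponential map of hyperbolic space at `p`, applied to a tangent vector `w`
(so `⟨p, w⟩ = 0`). -/
noncomputable def hexp (p w : Mink) : Mink :=
  Real.cosh (Real.sqrt (mink w w)) • p +
    (Real.sinh (Real.sqrt (mink w w)) / Real.sqrt (mink w w)) • w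

/-- The inverse of the Klein model: the point `(x, y, z)` of the open unit ball is sent to the
point of the hyperboloid on the ray through `(1, x, y, z)`. -/
noncomputable def ofKlein (x y z : ℝ) : Mink :=
  (Real.sqrt (1 - (x ^ 2 + y ^ 2 + z ^ 2)))⁻¹ • ![1, x, y, z]

/-! ### Polyhedra with the combinatorics of the octahedron -/

/-- The six vertices: `(0, 0), (0, 1), (0, 2)` are `A, B, C` and `(1, 0), (1, 1), (1, 2)` are
`A', B', C'`. -/
abbrev Vert : Type := Fin 2 × Fin 3

/-- Two vertices span an edge unless they are equal or one of the pairs `AA'`, `BB'`, `CC'`. -/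
def Adj (u v : Vert) : Prop := u.2 ≠ v.2

/-- The eight triangular faces `ABC`, `A'B'C'`, `ABC'`, `A'BC`, `AB'C`, `A'B'C`, `AB'C'`, `A'BC'`:
one vertex is chosen from each of the pairs `AA'`, `BB'`, `CC'`. -/
def face (s : Fin 3 → Fin 2) : Finset Vert := Finset.univ.image fun k => (s k, k)

/-- The geodesic simplex in hyperbolic space spanned by the vertices in `S`. -/
def hull (p : Vert → Mink) (S : Finset Vert) : Set Mink :=
  {x | x ∈ Hyp ∧ ∃ c : Vert → ℝ, (∀ v, 0 ≤ c v) ∧ (∀ v, v ∉ S → c v = 0) ∧ x = ∑ v, c v • p v}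

/-- The boundary surface: the union of the eight faces. -/
def surface (p : Vert → Mink) : Set Mink := ⋃ s : Fin 3 → Fin 2, hull p (face s)

/-- The solid polyhedron: the surface together with the bounded components of its complement. -/
def solid (p : Vert → Mink) : Set Mink :=
  surface p ∪ {x | x ∈ Hyp \ surface p ∧
    Bornology.IsBounded (connectedComponentIn (Hyp \ surface p) x)}

/-- The points `p v` are the vertices of a compact hyperbolic polyhedron with the combinatorics of
the octahedron: faces are non-degenerate geodesic triangles, and two of them meet exactly in the
simplex spanned by their common vertices (in particular the surface is not self-intersecting). -/
structure IsPolyhedron (p : Vert → Mink) : Prop where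
  mem_hyp : ∀ v, p v ∈ Hyp
  face_nondegenerate : ∀ s : Fin 3 → Fin 2,
    LinearIndependent ℝ fun k : Fin 3 => p (s k, k)
  face_inter : ∀ s t : Fin 3 → Fin 2,
    hull p (face s) ∩ hull p (face t) = hull p (face s ∩ face t)

/-- Near the point `y` the region `P` of hyperbolic space coincides with a dihedral wedge of angle
`θ ∈ (0, 2π)` whose axis passes through `y`. Here `e₁, e₂` is an orthonormal basis of the plane
in the tangent space at `y` that is orthogonal to the axis, and the wedge is described in polar
coordinates around the axis. -/
def HasDihedralAngle (P : Set Mink) (y : Mink) (θ : ℝ) : Prop :=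
  0 < θ ∧ θ < 2 * Real.pi ∧
  ∃ e₁ e₂ : Mink, mink e₁ y = 0 ∧ mink e₂ y = 0 ∧
    mink e₁ e₁ = 1 ∧ mink e₂ e₂ = 1 ∧ mink e₁ e₂ = 0 ∧
    ∀ᶠ x in nhdsWithin y Hyp, (x ∈ P ↔
      ∃ ρ φ : ℝ, 0 ≤ ρ ∧ 0 ≤ φ ∧ φ ≤ θ ∧
        mink x e₁ = ρ * Real.cos φ ∧ mink x e₂ = ρ * Real.sin φ)

/-! ### Gluing two polyhedra along their boundaries -/

/-- Corresponding boundary points of `solid p` and `solid p'`. On each face, the identification is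
the restriction of the linear map taking the vertices `p v` of the face to the vertices `p' v`; it
is an isometry of the faces if corresponding edges have equal lengths. -/
def BoundaryRel (p p' : Vert → Mink) (x x' : Mink) : Prop :=
  ∃ (s : Fin 3 → Fin 2) (c : Vert → ℝ), (∀ v, 0 ≤ c v) ∧ (∀ v, v ∉ face s → c v = 0) ∧
    x = ∑ v, c v • p v ∧ x' = ∑ v, c v • p' v

/-- The relation generating the gluing of two solid polyhedra along their boundaries. -/
inductive GlueRel (p p' : Vert → Mink) : solid p ⊕ solid p' → solid p ⊕ solid p' → Prop
  | glue (x : solid p) (x' : solid p') (h : BoundaryRel p p' x x') :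
      GlueRel p p' (Sum.inl x) (Sum.inr x')

/-- The space `P ∪_∂ P'` obtained by gluing two solid polyhedra along their boundaries. -/
abbrev Glued (p p' : Vert → Mink) : Type := Quot (GlueRel p p')

/-- The gluing `P ∪_∂ P'` is defined and yields a hyperbolic cone-manifold: `P` and `P'` are
polyhedra, and corresponding edges have equal lengths, so that corresponding faces are isometric. -/
structure IsConeManifold (p p' : Vert → Mink) : Prop where
  left : IsPolyhedron p
  right : IsPolyhedron p'
  edge_length : ∀ u v, Adj u v → hdist (p u) (p v) = hdist (p' u) (p' v)

/-- The open segment of `P ∪_∂ P'` that is the image of the edge `uv`. -/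
def segment (p p' : Vert → Mink) (u v : Vert) : Set (Glued p p') :=
  {x | ∃ (y : solid p) (c d : ℝ), 0 < c ∧ 0 < d ∧ (y : Mink) = c • p u + d • p v ∧
    x = Quot.mk _ (Sum.inl y)}

/-- The cone angle of `P ∪_∂ P'` at a point `x` of a segment is `θ`: the two wedges of `P` and
`P'` that are glued together around `x` have total angle `θ`. -/
def HasConeAngle (p p' : Vert → Mink) (x : Glued p p') (θ : ℝ) : Prop :=
  ∃ (y : solid p) (y' : solid p') (α α' : ℝ),
    x = Quot.mk _ (Sum.inl y) ∧ x = Quot.mk _ (Sum.inr y') ∧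
    HasDihedralAngle (solid p) y α ∧ HasDihedralAngle (solid p') y' α' ∧ θ = α + α'

/-- The cone-manifolds `P ∪_∂ P'` and `Q ∪_∂ Q'` have the same cone angles at all twelve pairs of
corresponding segments. -/
def SameConeAngles (p p' r r' : Vert → Mink) : Prop :=
  ∀ u v, Adj u v → ∃ θ : ℝ,
    (∀ x ∈ segment p p' u v, HasConeAngle p p' x θ) ∧
    (∀ x ∈ segment r r' u v, HasConeAngle r r' x θ)

/-! ### Infinitesimal isometric deformations -/

/-- `q` is an infinitesimal isometric deformation of the polyhedron with vertices `p`. -/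
def IsInfIsometric (p q : Vert → Mink) : Prop :=
  (∀ v, mink (p v) (q v) = 0) ∧
  ∀ u v, Adj u v →
    HasDerivAt (fun t : ℝ => hdist (hexp (p u) (t • q u)) (hexp (p v) (t • q v))) 0 0

/-- `q` is the restriction of a Killing field of hyperbolic space. The Killing fields are the
restrictions of the linear vector fields `X` that are skew for the Minkowski product. -/
def IsTrivial (p q : Vert → Mink) : Prop :=
  ∃ X : Mink →ₗ[ℝ] Mink, (∀ x y, mink (X x) y + mink x (X y) = 0) ∧ ∀ v, q v = X (p v)

/-- The rotation through `2π/3` about the axis of the octahedron. -/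
noncomputable def rot (x : Mink) : Mink :=
  ![x 0, Real.cos (2 * Real.pi / 3) * x 1 - Real.sin (2 * Real.pi / 3) * x 2,
    Real.sin (2 * Real.pi / 3) * x 1 + Real.cos (2 * Real.pi / 3) * x 2, x 3]

/-- The half-turn about a line through the center orthogonal to the axis that interchanges
`A` with `A'`, `B` with `C'`, and `C` with `B'`. -/
def halfTurn (x : Mink) : Mink := ![x 0, x 2, x 1, -x 3]

/-- An assignment of points or vectors to the vertices is symmetric if it is equivariant under the
symmetry group of the twisted octahedron, which is generated by `rot` and `halfTurn`. -/
def IsSymmetric (q : Vert → Mink) : Prop :=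
  (∀ (l : Fin 2) (k : Fin 3), q (l, k + 1) = rot (q (l, k))) ∧
  (∀ (l : Fin 2) (k : Fin 3), q (1 - l, -k) = halfTurn (q (l, k)))

/-! ### The twisted octahedra and the three families -/

/-- The vertices of the hyperbolic twisted octahedron `P(a, b)`. In the Klein model, `ABC` is an
equilateral triangle with edge length `a` (hence circumradius `a / √3`), orthogonal to the axis and
centered on it, and `A'B'C'` is its image under the screw motion with rotation angle `π/2` and
translation length `b`. The center of the octahedron is the center of the Klein model. -/
noncomputable def twisted (a b : ℝ) (v : Vert) : Mink :=
  ofKlein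
    (a / Real.sqrt 3 * Real.cos (2 * Real.pi / 3 * (v.2 : ℕ) + Real.pi / 2 * (v.1 : ℕ)))
    (a / Real.sqrt 3 * Real.sin (2 * Real.pi / 3 * (v.2 : ℕ) + Real.pi / 2 * (v.1 : ℕ)))
    (b * ((v.1 : ℕ) : ℝ) - b / 2)

/-- The pairs `(a, b)` for which the Euclidean twisted octahedron with base edge `a` and height `b`
exists and lies in the open unit ball. -/
def paramDomain : Set (ℝ × ℝ) := {x | 0 < x.1 ∧ 0 < x.2 ∧ x.1 ^ 2 / 3 + x.2 ^ 2 / 4 < 1}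

/-- The vertices `exp_p (t q)` of the deformed polyhedron `P_t`. -/
noncomputable def deform (p q : Vert → Mink) (t : ℝ) (v : Vert) : Mink := hexp (p v) (t • q v)

/-- The signs of the left pieces of `P_t ∪ P_t`, `P_t ∪ P_{-t}`, `P_{-t} ∪ P_{-t}`. -/
def signL : Fin 3 → ℝ := ![1, 1, -1]

/-- The signs of the right pieces of `P_t ∪ P_t`, `P_t ∪ P_{-t}`, `P_{-t} ∪ P_{-t}`. -/
def signR : Fin 3 → ℝ := ![1, -1, -1]

/-- The left piece of the `i`-th cone-manifold `M^i_t(a, b)`. -/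
noncomputable def leftPiece (q : ℝ → ℝ → Vert → Mink) (i : Fin 3) (t a b : ℝ) : Vert → Mink :=
  deform (twisted a b) (q a b) (signL i * t)

/-- The right piece of the `i`-th cone-manifold `M^i_t(a, b)`. -/
noncomputable def rightPiece (q : ℝ → ℝ → Vert → Mink) (i : Fin 3) (t a b : ℝ) : Vert → Mink :=
  deform (twisted a b) (q a b) (signR i * t)

end TwistedOcta

open TwistedOcta

open TwistedOcta
namespace TwistedOcta

/-! A symmetric octahedron is described by three numbers (`IsOcta`): the squared distance u of the
vertices from the axis, a height parameter c, and the deviation φ of the twist from π/2. The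
parameter c is chosen so that the edge lengths depend only on u, c and cos φ (`IsOcta.neg_mink_eq`).
They are therefore even in φ, and the undeformed octahedra are those with φ = 0; this is the source
of their infinitesimal flexibility. The symmetric infinitesimal isometric deformation is unique up
to a factor (`IsInfIsometric.eq_octaOf`), and along it u and c are even while φ is odd in t
(`isOcta_deform`, `deformParam_neg`). So P_t and P_{-t} have parameters (u, c, φ) and (u, c, -φ).

Let E be `angleMap`, from which the three dihedral angles are obtained by affine functions. The cone
angles of M² are governed by E(u, c, φ) + E(u, c, -φ), those of M¹ and M³ by 2 E(x) with x the
parameters of P_t or P_{-t}. Hence it is enough to solve 2 E(x) = E(u, c, φ) + E(u, c, -φ) near (u,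
c, 0) with φ ≠ 0 and x off the plane φ = 0; the sign of the time belonging to x then decides between
M¹ and M³.

The equation is solved by transversality. E is a local diffeomorphism at (u, c, 0), and half of the
right-hand side, as a function of s = φ², is a curve with initial velocity E_φφ/2. If this velocity
is not in the image under dE of the horizontal directions, the preimage of the curve leaves the
plane φ = 0 (`eventually_exists_eq_of_transversal`). An explicit covector annihilates that image
(`normal_first`) and is nonzero on E_φφ (`normal_second`); together this gives
`exists_even_coincidence`. By `exists_nhds_realizable`, all parameters near (u, c, 0) come from some
a ∈ A, b ∈ B and |t| ≤ ε.

There remains the geometry of the solid, which is defined by bounded complementary components and is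
not convex. It is star-shaped: the cones over the eight faces form a complete fan around the center
(`IsStarOcta`). This identifies the solid (`IsStarOcta.solid_eq`) and splits each dihedral angle by
the plane through the edge and the center (`IsStarOcta.hasDihedralAngle`). -/

/-! ### The fan of cones over the faces -/

/-- The determinant of the spatial parts of three vectors. -/
def det3 (x y w : Mink) : ℝ :=
  x 1 * (y 2 * w 3 - y 3 * w 2) - x 2 * (y 1 * w 3 - y 3 * w 1) + x 3 * (y 1 * w 2 - y 2 * w 1)

/-- The vertex `v`, with the opposite sign if it is one of `A, B, C`. -/
def signedVert (p : Vert → Mink) (v : Vert) : Mink := (if v.1 = 0 then (-1 : ℝ) else 1) • p v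

/-- Six points at the same distance from the origin of the hyperboloid model, spanning an
octahedron that is star-shaped with respect to this origin. -/
structure IsStarOcta (p : Vert → Mink) (T : ℝ) : Prop where
  mem : ∀ v, p v ∈ Hyp
  time : ∀ v, p v 0 = T
  orient : ∀ s : Fin 3 → Fin 2,
    0 < det3 (signedVert p (s 0, 0)) (signedVert p (s 1, 1)) (signedVert p (s 2, 2))

/-- By multilinearity the determinant is a nonnegative combination of the eight positive face
determinants. The minus signs are those built into `signedVert`. -/
lemma det3_pos_of_comb {p : Vert → Mink}
    (h : ∀ s : Fin 3 → Fin 2,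
      0 < det3 (signedVert p (s 0, 0)) (signedVert p (s 1, 1)) (signedVert p (s 2, 2)))
    (α β : Fin 3 → ℝ) (hα : ∀ k, 0 ≤ α k) (hβ : ∀ k, 0 ≤ β k) (hαβ : ∀ k, 0 < α k + β k) :
    0 < det3 (α 0 • p (1, 0) - β 0 • p (0, 0)) (α 1 • p (1, 1) - β 1 • p (0, 1))
      (α 2 • p (1, 2) - β 2 • p (0, 2)) := by
  have comb : ∀ {a b x y : ℝ}, 0 ≤ a → 0 ≤ b → 0 < a + b → 0 < x → 0 < y → 0 < a * x + b * y := by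
    intro a b x y ha hb hab hx hy
    rcases ha.lt_or_eq with ha' | ha'
    · have := mul_pos ha' hx
      have := mul_nonneg hb hy.le
      linarith
    · subst ha'
      have : 0 < b := by linarith
      have := mul_pos this hy
      linarith
  have h' : ∀ i j l : Fin 2,
      0 < det3 (signedVert p (i, 0)) (signedVert p (j, 1)) (signedVert p (l, 2)) :=
    fun i j l => by simpa using h ![i, j, l]
  have s0 : ∀ k, signedVert p (0, k) = (-1 : ℝ) • p (0, k) := fun k => by simp [signedVert]
  have s1 : ∀ k, signedVert p (1, k) = p (1, k) := fun k => by simp [signedVert]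
  have step0 : ∀ j l : Fin 2,
      0 < det3 (α 0 • p (1, 0) - β 0 • p (0, 0)) (signedVert p (j, 1)) (signedVert p (l, 2)) := by
    intro j l
    have := comb (hα 0) (hβ 0) (hαβ 0) (h' 1 j l) (h' 0 j l)
    rw [s0, s1] at this
    convert this using 1
    simp only [det3, Pi.sub_apply, Pi.smul_apply, smul_eq_mul]
    ring
  have step1 : ∀ l : Fin 2,
      0 < det3 (α 0 • p (1, 0) - β 0 • p (0, 0)) (α 1 • p (1, 1) - β 1 • p (0, 1))
        (signedVert p (l, 2)) := by
    intro l
    have := comb (hα 1) (hβ 1) (hαβ 1) (step0 1 l) (step0 0 l)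
    rw [s0, s1] at this
    convert this using 1
    simp only [det3, Pi.sub_apply, Pi.smul_apply, smul_eq_mul]
    ring
  have := comb (hα 2) (hβ 2) (hαβ 2) (step1 1) (step1 0)
  rw [s0, s1] at this
  convert this using 1
  simp only [det3, Pi.sub_apply, Pi.smul_apply, smul_eq_mul]
  ring

lemma eq_zero_of_comb_eq_zero {x y w : Mink} (h : det3 x y w ≠ 0) {a b c : ℝ}
    (h1 : a * x 1 + b * y 1 + c * w 1 = 0) (h2 : a * x 2 + b * y 2 + c * w 2 = 0)
    (h3 : a * x 3 + b * y 3 + c * w 3 = 0) : a = 0 ∧ b = 0 ∧ c = 0 := by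
  refine ⟨?_, ?_, ?_⟩ <;> refine (mul_eq_zero.1 (?_ : _ * det3 x y w = 0)).resolve_right h
  · simp only [det3]
    linear_combination (y 2 * w 3 - y 3 * w 2) * h1 - (y 1 * w 3 - y 3 * w 1) * h2 +
      (y 1 * w 2 - y 2 * w 1) * h3
  · simp only [det3]
    linear_combination -(x 2 * w 3 - x 3 * w 2) * h1 + (x 1 * w 3 - x 3 * w 1) * h2 -
      (x 1 * w 2 - x 2 * w 1) * h3
  · simp only [det3]
    linear_combination (x 2 * y 3 - x 3 * y 2) * h1 - (x 1 * y 3 - x 3 * y 1) * h2 +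
      (x 1 * y 2 - x 2 * y 1) * h3

/-- Brings a pair of coefficients of opposite signs into the form required by `det3_pos_of_comb`, up
to a common factor s that may vanish or be negative. -/
lemma exists_cone_factor {a b : ℝ} (h : a * b ≤ 0) :
    ∃ s α β : ℝ, 0 ≤ α ∧ 0 ≤ β ∧ 0 < α + β ∧ a = s * α ∧ b = -(s * β) := by
  by_cases h0 : a = 0 ∧ b = 0
  · exact ⟨0, 1, 1, by simp [h0.1, h0.2]⟩
  rcases mul_nonpos_iff.1 h with ⟨ha, hb⟩ | ⟨ha, hb⟩
  · refine ⟨1, a, -b, ha, by linarith, ?_, by ring, by ring⟩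
    rcases ha.lt_or_eq with h1 | h1
    · linarith
    · rcases hb.lt_or_eq with h2 | h2
      · linarith
      · exact absurd ⟨h1.symm, h2⟩ h0
  · refine ⟨-1, -a, b, by linarith, hb, ?_, by ring, by ring⟩
    rcases ha.lt_or_eq with h1 | h1
    · linarith
    · rcases hb.lt_or_eq with h2 | h2
      · linarith
      · exact absurd ⟨h1, h2.symm⟩ h0

namespace IsStarOcta

variable {p : Vert → Mink} {T : ℝ}

/-- In each column the two terms combine to a multiple of a vector α p(1,k) - β p(0,k), and three
such vectors are independent by `det3_pos_of_comb`. This single fact yields both that the cones over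
the faces do not overlap and that they cover space. -/
lemma eq_zero (hp : IsStarOcta p T) {a b : Fin 3 → ℝ} (hab : ∀ k, a k * b k ≤ 0)
    (h : ∀ i : Fin 4, i ≠ 0 → ∑ k, (a k * p (1, k) i + b k * p (0, k) i) = 0) :
    (∀ k, a k = 0) ∧ ∀ k, b k = 0 := by
  choose s α β hα hβ hαβ ha hb using fun k => exists_cone_factor (hab k)
  have hdet := det3_pos_of_comb hp.orient α β hα hβ hαβ
  have key : ∀ i : Fin 4, i ≠ 0 → s 0 * (α 0 • p (1, 0) - β 0 • p (0, 0)) i +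
      s 1 * (α 1 • p (1, 1) - β 1 • p (0, 1)) i + s 2 * (α 2 • p (1, 2) - β 2 • p (0, 2)) i = 0 := by
    intro i hi
    have := h i hi
    simp only [Fin.sum_univ_three, ha, hb] at this
    simp only [Pi.sub_apply, Pi.smul_apply, smul_eq_mul]
    linear_combination this
  obtain ⟨h0, h1, h2⟩ := eq_zero_of_comb_eq_zero hdet.ne' (key 1 (by decide)) (key 2 (by decide))
    (key 3 (by decide))
  have hs : ∀ k, s k = 0 := by intro k; fin_cases k <;> assumption
  exact ⟨fun k => by rw [ha, hs, zero_mul], fun k => by rw [hb, hs, zero_mul, neg_zero]⟩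

end IsStarOcta

/-- Nonnegative coefficients on the vertices that are supported on a face. -/
def FaceCoeff (c : Vert → ℝ) : Prop := (∀ v, 0 ≤ c v) ∧ ∃ s : Fin 3 → Fin 2, ∀ v ∉ face s, c v = 0

lemma mem_face {s : Fin 3 → Fin 2} {v : Vert} : v ∈ face s ↔ s v.2 = v.1 := by
  simp only [face, Finset.mem_image, Finset.mem_univ, true_and]
  constructor
  · rintro ⟨k, rfl⟩; rfl
  · intro h; exact ⟨v.2, by rw [h]⟩

lemma faceCoeff_iff {c : Vert → ℝ} :
    FaceCoeff c ↔ (∀ v, 0 ≤ c v) ∧ ∀ k, c (0, k) * c (1, k) = 0 := by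
  refine and_congr_right fun hc => ⟨?_, fun h => ?_⟩
  · rintro ⟨s, hs⟩ k
    by_cases h : s k = 0
    · rw [hs (1, k) (by simp [mem_face, h]), mul_zero]
    · rw [hs (0, k) (by simpa [mem_face] using h), zero_mul]
  · refine ⟨fun k => if c (1, k) = 0 then 0 else 1, ?_⟩
    rintro ⟨l, k⟩ hv
    rw [mem_face] at hv
    have := h k
    by_cases h1 : c (1, k) = 0
    · fin_cases l
      · simp [h1] at hv
      · exact h1
    · have h0 : c (0, k) = 0 := (mul_eq_zero.1 this).resolve_right h1
      fin_cases l
      · exact h0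
      · simp [h1] at hv

lemma sum_vert {M : Type*} [AddCommMonoid M] (f : Vert → M) :
    ∑ v, f v = ∑ k, (f (1, k) + f (0, k)) := by
  rw [Fintype.sum_prod_type, Fin.sum_univ_two, ← Finset.sum_add_distrib]
  exact Finset.sum_congr rfl fun k _ => add_comm _ _

namespace IsStarOcta

variable {p : Vert → Mink} {T : ℝ}

/-- The cones over the faces do not overlap. -/
lemma coeff_unique (hp : IsStarOcta p T) {c d : Vert → ℝ} (hc : FaceCoeff c) (hd : FaceCoeff d)
    (h : ∀ i : Fin 4, i ≠ 0 → ∑ v, c v * p v i = ∑ v, d v * p v i) : c = d := by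
  rw [faceCoeff_iff] at hc hd
  have := hp.eq_zero (a := fun k => c (1, k) - d (1, k)) (b := fun k => c (0, k) - d (0, k)) ?_ ?_
  · ext ⟨l, k⟩
    have h1 := this.1 k
    have h2 := this.2 k
    fin_cases l
    · exact sub_eq_zero.1 h2
    · exact sub_eq_zero.1 h1
  -- Since c₀c₁ = d₀d₁ = 0 in each column, (c₁ - d₁)(c₀ - d₀) = -(c₁d₀ + c₀d₁) ≤ 0.
  · intro k
    have h1 := mul_nonneg (hc.1 (1, k)) (hd.1 (0, k))
    have h2 := mul_nonneg (hc.1 (0, k)) (hd.1 (1, k))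
    have h3 := hc.2 k
    have h4 := hd.2 k
    nlinarith
  · intro i hi
    have := h i hi
    rw [sum_vert, sum_vert, ← sub_eq_zero, ← Finset.sum_sub_distrib] at this
    rw [← this]
    exact Finset.sum_congr rfl fun k _ => by ring

end IsStarOcta


/-- The coordinate of `X` at the first of the three vectors `x, y, w`. -/
lemma exists_comb_of_det3_ne_zero {x y w : Mink} (h : det3 x y w ≠ 0) (X : Mink) :
    ∃ a b c : ℝ, ∀ i : Fin 4, i ≠ 0 → a * x i + b * y i + c * w i = X i := by
  refine ⟨det3 X y w / det3 x y w, det3 x X w / det3 x y w, det3 x y X / det3 x y w, ?_⟩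
  intro i hi
  rw [div_mul_eq_mul_div, div_mul_eq_mul_div, div_mul_eq_mul_div, ← add_div, ← add_div,
    div_eq_iff h]
  fin_cases i
  · exact absurd rfl hi
  all_goals simp [det3]; ring

namespace IsStarOcta

variable {p : Vert → Mink} {T : ℝ}

lemma det3_ne_zero (hp : IsStarOcta p T) (s : Fin 3 → Fin 2) :
    det3 (p (s 0, 0)) (p (s 1, 1)) (p (s 2, 2)) ≠ 0 := by
  intro h
  have := hp.orient s
  have hs : ∀ v, ∃ ε : ℝ, signedVert p v = ε • p v := fun v => ⟨_, rfl⟩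
  obtain ⟨a, ha⟩ := hs (s 0, 0)
  obtain ⟨b, hb⟩ := hs (s 1, 1)
  obtain ⟨c, hc⟩ := hs (s 2, 2)
  have key : det3 (signedVert p (s 0, 0)) (signedVert p (s 1, 1)) (signedVert p (s 2, 2)) =
      a * b * c * det3 (p (s 0, 0)) (p (s 1, 1)) (p (s 2, 2)) := by
    rw [ha, hb, hc]
    simp only [det3, Pi.smul_apply, smul_eq_mul]
    ring
  rw [key, h, mul_zero] at this
  exact lt_irrefl _ this

/-- Induction on the number n of columns in which the coefficients already are as in `FaceCoeff`. In
the other columns only the vertex selected by s is used, with a coefficient of arbitrary sign; n = 0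
is Cramer's rule and n = 3 is the covering statement. -/
lemma exists_partial (hp : IsStarOcta p T) (X : Mink) (n : ℕ) (hn : n ≤ 3) :
    ∀ s : Fin 3 → Fin 2, ∃ a b : Fin 3 → ℝ,
      (∀ k : Fin 3, (k : ℕ) < n → 0 ≤ a k ∧ 0 ≤ b k ∧ a k * b k = 0) ∧
      (∀ k : Fin 3, n ≤ (k : ℕ) → (s k = 0 → a k = 0) ∧ (s k = 1 → b k = 0)) ∧
      ∀ i : Fin 4, i ≠ 0 → ∑ k, (a k * p (1, k) i + b k * p (0, k) i) = X i := by
  induction n with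
  | zero =>
    intro s
    obtain ⟨x, y, w, h⟩ := exists_comb_of_det3_ne_zero (hp.det3_ne_zero s) X
    refine ⟨fun k => if s k = 1 then ![x, y, w] k else 0,
      fun k => if s k = 1 then 0 else ![x, y, w] k, by simp, fun k _ => ⟨?_, ?_⟩, ?_⟩
    · intro h; simp [h]
    · intro h; simp [h]
    · intro i hi
      rw [← h i hi, Fin.sum_univ_three]
      have : ∀ (k : Fin 3) (r : ℝ), (if s k = 1 then r else 0) * p (1, k) i +
          (if s k = 1 then 0 else r) * p (0, k) i = r * p (s k, k) i := by
        intro k r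
        rcases Fin.eq_zero_or_eq_succ (s k) with h0 | ⟨j, hj⟩
        · simp [h0]
        · have : s k = 1 := by rw [hj]; fin_cases j; rfl
          simp [this]
      simp only [this]
      simp
  | succ n ih =>
    intro s
    have hn3 : n < 3 := hn
    set k₀ : Fin 3 := ⟨n, hn3⟩ with hk₀
    -- Both choices of the vertex in column n are tried; one of them must give a nonnegative
    -- coefficient there.
    obtain ⟨a, b, h1, h2, h3⟩ := ih (by omega) (Function.update s k₀ 1)
    obtain ⟨a', b', h1', h2', h3'⟩ := ih (by omega) (Function.update s k₀ 0)
    have hb0 : b k₀ = 0 := (h2 k₀ le_rfl).2 (by simp)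
    have ha0 : a' k₀ = 0 := (h2' k₀ le_rfl).1 (by simp)
    have hlt : ∀ k : Fin 3, (k : ℕ) < n + 1 → (k : ℕ) < n ∨ k = k₀ := by
      intro k hk
      rcases Nat.lt_succ_iff_lt_or_eq.1 hk with h | h
      · exact Or.inl h
      · exact Or.inr (Fin.ext h)
    have hne : ∀ k : Fin 3, n + 1 ≤ (k : ℕ) → k ≠ k₀ := by
      rintro k hk rfl
      simp [hk₀] at hk
    by_cases hpos : 0 ≤ a k₀
    · refine ⟨a, b, fun k hk => ?_, fun k hk => ?_, h3⟩
      · rcases hlt k hk with h | rfl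
        · exact h1 k h
        · exact ⟨hpos, hb0.ge, by rw [hb0, mul_zero]⟩
      · simpa [hne k hk] using h2 k (by omega)
    by_cases hpos' : 0 ≤ b' k₀
    · refine ⟨a', b', fun k hk => ?_, fun k hk => ?_, h3'⟩
      · rcases hlt k hk with h | rfl
        · exact h1' k h
        · exact ⟨ha0.ge, hpos', by rw [ha0, zero_mul]⟩
      · simpa [hne k hk] using h2' k (by omega)
    -- If both coefficients are negative, the difference of the two representations satisfies the
    -- sign condition of `eq_zero` but is nonzero in column n.
    exfalso
    push Not at hpos hpos'
    have := hp.eq_zero (a := fun k => a k - a' k) (b := fun k => b k - b' k) ?_ ?_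
    · have := this.1 k₀
      rw [ha0] at this
      linarith
    · intro k
      rcases lt_trichotomy (k : ℕ) n with h | h | h
      · obtain ⟨x1, x2, x3⟩ := h1 k h
        obtain ⟨y1, y2, y3⟩ := h1' k h
        nlinarith [mul_nonneg x1 y2, mul_nonneg x2 y1]
      · obtain rfl : k = k₀ := Fin.ext h
        rw [ha0, hb0]
        nlinarith [mul_pos_of_neg_of_neg hpos hpos']
      · have hk := hne k h
        have e1 := h2 k h.le
        have e2 := h2' k h.le
        simp only [Function.update_of_ne hk] at e1 e2
        rcases Fin.eq_zero_or_eq_succ (s k) with h0 | ⟨j, hj⟩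
        · rw [e1.1 h0, e2.1 h0]; simp
        · have : s k = 1 := by rw [hj]; fin_cases j; rfl
          rw [e1.2 this, e2.2 this]; simp
    · intro i hi
      have e1 := h3 i hi
      have e2 := h3' i hi
      rw [← sub_eq_zero.2 (e1.trans e2.symm), ← Finset.sum_sub_distrib]
      exact Finset.sum_congr rfl fun k _ => by ring

/-- The cones over the faces cover space. -/
lemma exists_coeff (hp : IsStarOcta p T) (X : Mink) :
    ∃ c : Vert → ℝ, FaceCoeff c ∧ ∀ i : Fin 4, i ≠ 0 → ∑ v, c v * p v i = X i := by
  obtain ⟨a, b, h1, -, h3⟩ := hp.exists_partial X 3 le_rfl 0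
  refine ⟨fun v => if v.1 = 1 then a v.2 else b v.2, ?_, fun i hi => ?_⟩
  · rw [faceCoeff_iff]
    refine ⟨fun v => ?_, fun k => ?_⟩
    · by_cases h : v.1 = 1
      · simpa [h] using (h1 v.2 v.2.2).1
      · simpa [h] using (h1 v.2 v.2.2).2.1
    · simpa [mul_comm] using (h1 k k.2).2.2
  · rw [← h3 i hi, sum_vert]
    simp

end IsStarOcta

end TwistedOcta

open TwistedOcta
namespace TwistedOcta

/-! ### The solid bounded by a star-shaped octahedron -/

lemma one_le_neg_mink {x y : Mink} (hx : x ∈ Hyp) (hy : y ∈ Hyp) : 1 ≤ -mink x y := by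
  obtain ⟨hx1, hx0⟩ := hx
  obtain ⟨hy1, hy0⟩ := hy
  simp only [mink] at *
  have hsq : (1 + (x 1 * y 1 + x 2 * y 2 + x 3 * y 3)) ^ 2 ≤ (x 0 * y 0) ^ 2 := by
    have hxx : x 0 ^ 2 = 1 + x 1 ^ 2 + x 2 ^ 2 + x 3 ^ 2 := by linarith
    have hyy : y 0 ^ 2 = 1 + y 1 ^ 2 + y 2 ^ 2 + y 3 ^ 2 := by linarith
    rw [mul_pow, hxx, hyy]
    nlinarith [sq_nonneg (x 1 - y 1), sq_nonneg (x 2 - y 2), sq_nonneg (x 3 - y 3),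
      sq_nonneg (x 1 * y 2 - x 2 * y 1), sq_nonneg (x 1 * y 3 - x 3 * y 1),
      sq_nonneg (x 2 * y 3 - x 3 * y 2)]
  have := abs_le_of_sq_le_sq' hsq (mul_pos hx0 hy0).le
  linarith [this.2]

lemma one_le_time {x : Mink} (hx : x ∈ Hyp) : 1 ≤ x 0 := by
  have h := hx.1
  have h0 := hx.2
  simp only [mink] at h
  nlinarith [sq_nonneg (x 1), sq_nonneg (x 2), sq_nonneg (x 3)]

lemma mink_sum_left (c : Vert → ℝ) (p : Vert → Mink) (y : Mink) :
    mink (∑ v, c v • p v) y = ∑ v, c v * mink (p v) y := by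
  simp only [mink, Finset.sum_apply, Pi.smul_apply, smul_eq_mul, Finset.sum_mul, mul_add,
    Finset.sum_add_distrib, mul_neg, Finset.sum_neg_distrib, mul_assoc]

/-- The coordinates with respect to the vertices of a face of the spatial part of a vector. -/
noncomputable def faceCoord (p : Vert → Mink) (s : Fin 3 → Fin 2) (X : Mink) : Fin 3 → ℝ :=
  ![det3 X (p (s 1, 1)) (p (s 2, 2)) / det3 (p (s 0, 0)) (p (s 1, 1)) (p (s 2, 2)),
    det3 (p (s 0, 0)) X (p (s 2, 2)) / det3 (p (s 0, 0)) (p (s 1, 1)) (p (s 2, 2)),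
    det3 (p (s 0, 0)) (p (s 1, 1)) X / det3 (p (s 0, 0)) (p (s 1, 1)) (p (s 2, 2))]

lemma continuous_faceCoord (p : Vert → Mink) (s : Fin 3 → Fin 2) (k : Fin 3) :
    Continuous fun X => faceCoord p s X k := by
  fin_cases k <;> simp only [faceCoord, det3] <;> simp <;> fun_prop

/-- The coefficients on all vertices obtained from coordinates on a face. -/
def extendFace (s : Fin 3 → Fin 2) (f : Fin 3 → ℝ) (v : Vert) : ℝ := if s v.2 = v.1 then f v.2 else 0

lemma sum_extendFace {M : Type*} [AddCommGroup M] [Module ℝ M] (s : Fin 3 → Fin 2) (f : Fin 3 → ℝ)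
    (g : Vert → M) : ∑ v, extendFace s f v • g v = ∑ k, f k • g (s k, k) := by
  rw [sum_vert]
  refine Finset.sum_congr rfl fun k _ => ?_
  simp only [extendFace]
  rcases Fin.eq_zero_or_eq_succ (s k) with h0 | ⟨j, hj⟩
  · simp [h0]
  · have : s k = 1 := by rw [hj]; fin_cases j; rfl
    simp [this]

lemma faceCoeff_extendFace {s : Fin 3 → Fin 2} {f : Fin 3 → ℝ} (hf : ∀ k, 0 ≤ f k) :
    FaceCoeff (extendFace s f) := by
  refine ⟨fun v => ?_, s, fun v hv => ?_⟩
  · unfold extendFace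
    split_ifs
    exacts [hf _, le_rfl]
  · rw [mem_face] at hv
    simp [extendFace, hv]

lemma exists_extendFace {c : Vert → ℝ} (hc : FaceCoeff c) :
    ∃ (s : Fin 3 → Fin 2) (f : Fin 3 → ℝ), (∀ k, 0 ≤ f k) ∧ c = extendFace s f := by
  obtain ⟨h0, s, hs⟩ := hc
  refine ⟨s, fun k => c (s k, k), fun k => h0 _, ?_⟩
  ext v
  unfold extendFace
  split_ifs with h
  · simp only [h]
  · exact hs v (by rwa [mem_face])

/-- The vector `x` lies below the surface, seen from the center. -/
def Inner (p : Vert → Mink) (T : ℝ) : Set Mink :=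
  {x | ∃ c : Vert → ℝ, FaceCoeff c ∧ (∀ i : Fin 4, i ≠ 0 → ∑ v, c v * p v i = x i) ∧
    T * ∑ v, c v ≤ x 0}

/-- The vector `x` lies above the surface, seen from the center. -/
def Outer (p : Vert → Mink) (T : ℝ) : Set Mink :=
  {x | ∃ c : Vert → ℝ, FaceCoeff c ∧ (∀ i : Fin 4, i ≠ 0 → ∑ v, c v * p v i = x i) ∧
    x 0 ≤ T * ∑ v, c v}

namespace IsStarOcta

variable {p : Vert → Mink} {T : ℝ}

lemma sum_time (hp : IsStarOcta p T) (c : Vert → ℝ) : ∑ v, c v * p v 0 = T * ∑ v, c v := by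
  simp only [hp.time, Finset.mul_sum, mul_comm]

lemma time_pos (hp : IsStarOcta p T) : 0 < T := hp.time (0, 0) ▸ (hp.mem (0, 0)).2

lemma faceCoord_spec (hp : IsStarOcta p T) (s : Fin 3 → Fin 2) (X : Mink) (i : Fin 4)
    (hi : i ≠ 0) : ∑ k, faceCoord p s X k * p (s k, k) i = X i := by
  have h := hp.det3_ne_zero s
  simp only [Fin.sum_univ_three, faceCoord, Matrix.cons_val_zero, Matrix.cons_val_one,
    Matrix.cons_val]
  rw [div_mul_eq_mul_div, div_mul_eq_mul_div, div_mul_eq_mul_div, ← add_div, ← add_div,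
    div_eq_iff h]
  fin_cases i
  · exact absurd rfl hi
  all_goals simp [det3]; ring

lemma faceCoord_eq (hp : IsStarOcta p T) {s : Fin 3 → Fin 2} {X : Mink} {f : Fin 3 → ℝ}
    (h : ∀ i : Fin 4, i ≠ 0 → ∑ k, f k * p (s k, k) i = X i) : faceCoord p s X = f := by
  have key : ∀ i : Fin 4, i ≠ 0 → (faceCoord p s X 0 - f 0) * p (s 0, 0) i +
      (faceCoord p s X 1 - f 1) * p (s 1, 1) i + (faceCoord p s X 2 - f 2) * p (s 2, 2) i = 0 := by
    intro i hi
    have h1 := hp.faceCoord_spec s X i hi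
    have h2 := h i hi
    rw [Fin.sum_univ_three] at h1 h2
    linear_combination h1 - h2
  obtain ⟨h0, h1, h2⟩ := eq_zero_of_comb_eq_zero (hp.det3_ne_zero s) (key 1 (by decide))
    (key 2 (by decide)) (key 3 (by decide))
  ext k
  fin_cases k
  exacts [sub_eq_zero.1 h0, sub_eq_zero.1 h1, sub_eq_zero.1 h2]

/-- Replaces the existential over coefficients by a finite union over faces of conditions on
continuous coordinate functions, which makes `Inner` and `Outer` closed. -/
lemma exists_iff_exists_faceCoord (hp : IsStarOcta p T) (x : Mink) (P : ℝ → Prop) :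
    (∃ c : Vert → ℝ, FaceCoeff c ∧ (∀ i : Fin 4, i ≠ 0 → ∑ v, c v * p v i = x i) ∧ P (∑ v, c v)) ↔
      ∃ s : Fin 3 → Fin 2, (∀ k, 0 ≤ faceCoord p s x k) ∧ P (∑ k, faceCoord p s x k) := by
  constructor
  · rintro ⟨c, hc, hx, hP⟩
    obtain ⟨s, f, hf, rfl⟩ := exists_extendFace hc
    have e1 := sum_extendFace s f (fun _ => (1 : ℝ))
    have : faceCoord p s x = f := hp.faceCoord_eq fun i hi => by
      have := sum_extendFace s f (fun v => p v i)
      simp only [smul_eq_mul] at this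
      rw [← this, hx i hi]
    simp only [smul_eq_mul, mul_one] at e1
    exact ⟨s, by rwa [this], by rwa [this, ← e1]⟩
  · rintro ⟨s, hs, hP⟩
    refine ⟨_, faceCoeff_extendFace (s := s) hs, fun i hi => ?_, ?_⟩
    · have := sum_extendFace s (faceCoord p s x) (fun v => p v i)
      simp only [smul_eq_mul] at this
      rw [this, hp.faceCoord_spec s x i hi]
    · have := sum_extendFace s (faceCoord p s x) (fun _ => (1 : ℝ))
      simp only [smul_eq_mul, mul_one] at this
      rwa [this]

lemma isClosed_inner (hp : IsStarOcta p T) : IsClosed (Inner p T) := by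
  have : Inner p T = ⋃ s : Fin 3 → Fin 2, {x | (∀ k, 0 ≤ faceCoord p s x k) ∧
      T * ∑ k, faceCoord p s x k ≤ x 0} := by
    ext x
    simp only [Inner, Set.mem_ofPred_eq, Set.mem_iUnion]
    exact hp.exists_iff_exists_faceCoord x fun r => T * r ≤ x 0
  rw [this]
  refine isClosed_iUnion_of_finite fun s => ?_
  refine IsClosed.inter (s₁ := {x | ∀ k, 0 ≤ faceCoord p s x k}) ?_ ?_
  · simp only [Set.ofPred_forall]
    exact isClosed_iInter fun k => isClosed_le continuous_const (continuous_faceCoord p s k)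
  · exact isClosed_le (continuous_const.mul
      (continuous_finsetSum _ fun k _ => continuous_faceCoord p s k)) (continuous_apply 0)

lemma isClosed_outer (hp : IsStarOcta p T) : IsClosed (Outer p T) := by
  have : Outer p T = ⋃ s : Fin 3 → Fin 2, {x | (∀ k, 0 ≤ faceCoord p s x k) ∧
      x 0 ≤ T * ∑ k, faceCoord p s x k} := by
    ext x
    simp only [Outer, Set.mem_ofPred_eq, Set.mem_iUnion]
    exact hp.exists_iff_exists_faceCoord x fun r => x 0 ≤ T * r
  rw [this]
  refine isClosed_iUnion_of_finite fun s => ?_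
  refine IsClosed.inter (s₁ := {x | ∀ k, 0 ≤ faceCoord p s x k}) ?_ ?_
  · simp only [Set.ofPred_forall]
    exact isClosed_iInter fun k => isClosed_le continuous_const (continuous_faceCoord p s k)
  · exact isClosed_le (continuous_apply 0) (continuous_const.mul
      (continuous_finsetSum _ fun k _ => continuous_faceCoord p s k))

lemma inner_union_outer (hp : IsStarOcta p T) : Inner p T ∪ Outer p T = Set.univ := by
  refine Set.eq_univ_of_forall fun x => ?_
  obtain ⟨c, hc, hx⟩ := hp.exists_coeff x
  rcases le_total (T * ∑ v, c v) (x 0) with h | h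
  exacts [Or.inl ⟨c, hc, hx, h⟩, Or.inr ⟨c, hc, hx, h⟩]

/-- Uniqueness of the face coefficients forces those for `Inner` and `Outer` to agree, so that the
time coordinate of x is exactly that of a point on a face. -/
lemma mem_surface (hp : IsStarOcta p T) {x : Mink} :
    x ∈ surface p ↔ x ∈ Hyp ∧ x ∈ Inner p T ∧ x ∈ Outer p T := by
  constructor
  · intro h
    obtain ⟨s, hx, c, h0, hs, rfl⟩ := Set.mem_iUnion.1 h
    have hc : FaceCoeff c := ⟨h0, s, hs⟩
    have e0 : (∑ v, c v • p v) 0 = T * ∑ v, c v := by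
      rw [← hp.sum_time]; simp
    exact ⟨hx, ⟨c, hc, fun i _ => by simp, e0.ge⟩, ⟨c, hc, fun i _ => by simp, e0.le⟩⟩
  · rintro ⟨hx, ⟨c, hc, hxc, h1⟩, ⟨d, hd, hxd, h2⟩⟩
    obtain rfl : c = d := hp.coeff_unique hc hd fun i hi => by rw [hxc i hi, hxd i hi]
    obtain ⟨h0, s, hs⟩ := hc
    refine Set.mem_iUnion.2 ⟨s, hx, c, h0, hs, ?_⟩
    ext i
    by_cases hi : i = 0
    · subst hi
      have : (∑ v, c v • p v) 0 = T * ∑ v, c v := by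
        rw [← hp.sum_time]; simp
      rw [this]
      exact le_antisymm h2 h1
    · simp [hxc i hi]

/-- Write x = ∑ c p + l e₀ with l ≥ 0 and pair with x: since ⟨p v, x⟩ ≤ -1, this gives ∑ c + l x₀ ≤
1, and therefore x₀ = l + T ∑ c ≤ T + 1. -/
lemma isBounded_inner (hp : IsStarOcta p T) : Bornology.IsBounded (Hyp ∩ Inner p T) := by
  refine isBounded_iff_forall_norm_le.2 ⟨T + 1, ?_⟩
  rintro x ⟨hx, c, hc, hxc, h⟩
  have hT := hp.time_pos
  set l := x 0 - T * ∑ v, c v with hl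
  have hl0 : 0 ≤ l := by linarith
  have hx1 := one_le_time hx
  have hself : mink x x = mink (∑ v, c v • p v) x - l * x 0 := by
    have e0 : (∑ v, c v • p v) 0 = x 0 - l := by
      have : (∑ v, c v • p v) 0 = T * ∑ v, c v := by
        rw [← hp.sum_time]; simp
      rw [this]; ring
    have e : ∀ i : Fin 4, i ≠ 0 → (∑ v, c v • p v) i = x i := fun i hi => by simp [hxc i hi]
    simp only [mink, e0, e 1 (by decide), e 2 (by decide), e 3 (by decide)]
    ring
  rw [hx.1, mink_sum_left] at hself
  have hsum : ∑ v, c v * mink (p v) x ≤ -∑ v, c v := by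
    rw [← Finset.sum_neg_distrib]
    refine Finset.sum_le_sum fun v _ => ?_
    nlinarith [one_le_neg_mink (hp.mem v) hx, hc.1 v]
  have hs0 : 0 ≤ ∑ v, c v := Finset.sum_nonneg fun v _ => hc.1 v
  have hlx : 0 ≤ l * (x 0 - 1) := mul_nonneg hl0 (by linarith)
  have hl1 : l ≤ 1 := by nlinarith
  have hs1 : ∑ v, c v ≤ 1 := by nlinarith [mul_nonneg hl0 hx.2.le]
  have hbd : x 0 ≤ T + 1 := by nlinarith
  have hxx := hx.1
  simp only [mink] at hxx
  refine (pi_norm_le_iff_of_nonneg (by linarith)).2 fun i => ?_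
  refine le_trans ?_ hbd
  refine abs_le_of_sq_le_sq ?_ hx.2.le
  fin_cases i <;> simp <;> nlinarith [sq_nonneg (x 1), sq_nonneg (x 2), sq_nonneg (x 3)]

/-- The geodesic ray from the center through x, continued beyond x, escapes to infinity without
meeting the surface. -/
lemma not_isBounded_of_not_mem_inner (hp : IsStarOcta p T) {x : Mink} (hx : x ∈ Hyp)
    (hxi : x ∉ Inner p T) :
    ¬ Bornology.IsBounded (connectedComponentIn (Hyp \ surface p) x) := by
  obtain ⟨c, hc, hxc⟩ := hp.exists_coeff x
  have hlt : x 0 < T * ∑ v, c v := by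
    by_contra h
    exact hxi ⟨c, hc, hxc, not_lt.1 h⟩
  have hxx := hx.1
  have hx0 := hx.2
  simp only [mink] at hxx
  set n := x 1 ^ 2 + x 2 ^ 2 + x 3 ^ 2 with hn
  have hn0 : 0 ≤ n := by positivity
  have hx0n : x 0 ^ 2 = 1 + n := by rw [hn]; linarith
  -- The ray is parametrized by the factor r by which the spatial part is stretched, so the face
  -- coefficients are just multiplied by r.
  let γ : ℝ → Mink := fun r => ![Real.sqrt (1 + r ^ 2 * n), r * x 1, r * x 2, r * x 3]
  have hγ : Continuous γ := by
    refine continuous_pi fun i => ?_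
    fin_cases i <;> simp [γ] <;> fun_prop
  have hγ1 : γ 1 = x := by
    ext i
    fin_cases i
    · simp [γ, ← hx0n, Real.sqrt_sq hx0.le]
    all_goals simp [γ]
  have hmem : ∀ r : ℝ, 1 ≤ r → γ r ∈ Hyp \ surface p := by
    intro r hr
    have hpos : 0 < 1 + r ^ 2 * n := by positivity
    have hH : γ r ∈ Hyp := by
      refine ⟨?_, ?_⟩
      · have := Real.mul_self_sqrt hpos.le
        simp only [mink, γ, Matrix.cons_val_zero, Matrix.cons_val_one, Matrix.cons_val]
        rw [this, hn]
        ring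
      · simpa [γ] using Real.sqrt_pos.2 hpos
    refine ⟨hH, fun hs => ?_⟩
    obtain ⟨-, ⟨d, hd, hd1, hd2⟩, -⟩ := hp.mem_surface.1 hs
    have hrc : FaceCoeff (fun v => r * c v) := by
      obtain ⟨h0, s, hs⟩ := hc
      exact ⟨fun v => mul_nonneg (by linarith) (h0 v), s, fun v hv => by simp [hs v hv]⟩
    obtain rfl : (fun v => r * c v) = d := by
      refine hp.coeff_unique hrc hd fun i hi => ?_
      rw [hd1 i hi]
      simp only [mul_assoc, ← Finset.mul_sum, hxc i hi]
      fin_cases i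
      · exact absurd rfl hi
      all_goals simp [γ]
    rw [← Finset.mul_sum] at hd2
    -- The time coordinate grows at most by the factor r while T ∑ c grows exactly by r, so the ray
    -- stays strictly above the surface.
    have hle : γ r 0 ≤ r * x 0 := by
      simp only [γ, Matrix.cons_val_zero]
      refine Real.sqrt_le_iff.2 ⟨by positivity, ?_⟩
      rw [mul_pow, hx0n]
      nlinarith
    nlinarith
  have hsub : γ '' Set.Ici 1 ⊆ connectedComponentIn (Hyp \ surface p) x := by
    refine IsPreconnected.subset_connectedComponentIn (isPreconnected_Ici.image γ hγ.continuousOn)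
      ⟨1, Set.mem_Ici.2 le_rfl, hγ1⟩ ?_
    rintro _ ⟨r, hr, rfl⟩
    exact hmem r hr
  have hnpos : 0 < n := by
    rcases hn0.lt_or_eq with h | h
    · exact h
    · exfalso
      have h1 : x 1 = 0 := by nlinarith [sq_nonneg (x 1), sq_nonneg (x 2), sq_nonneg (x 3)]
      have h2 : x 2 = 0 := by nlinarith [sq_nonneg (x 1), sq_nonneg (x 2), sq_nonneg (x 3)]
      have h3 : x 3 = 0 := by nlinarith [sq_nonneg (x 1), sq_nonneg (x 2), sq_nonneg (x 3)]
      have : c = fun _ => 0 := hp.coeff_unique hc ⟨fun _ => le_rfl, 0, fun _ _ => rfl⟩ fun i hi => by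
        rw [hxc i hi]
        fin_cases i
        · exact absurd rfl hi
        all_goals simp [h1, h2, h3]
      simp only [this, Finset.sum_const_zero, mul_zero] at hlt
      linarith
  intro hb
  obtain ⟨K, hK⟩ := isBounded_iff_forall_norm_le.1 (hb.subset hsub)
  have hbig : ∀ r : ℝ, 1 ≤ r → 1 + r ^ 2 * n ≤ K ^ 2 := by
    intro r hr
    have h1 := (norm_le_pi_norm (γ r) 0).trans (hK _ ⟨r, hr, rfl⟩)
    have h2 : Real.sqrt (1 + r ^ 2 * n) ≤ K := by
      simpa [γ, abs_of_nonneg (Real.sqrt_nonneg _)] using h1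
    exact (Real.sqrt_le_left ((Real.sqrt_nonneg _).trans h2)).1 h2
  have := hbig (1 + K ^ 2 / n) (by have : 0 ≤ K ^ 2 / n := by positivity
                                   linarith)
  have e : K ^ 2 / n * n = K ^ 2 := by field_simp
  nlinarith [sq_nonneg (K ^ 2 / n), mul_nonneg (sq_nonneg (K ^ 2 / n)) hn0]

/-- The solid polyhedron consists of the points of hyperbolic space below the surface. -/
lemma solid_eq (hp : IsStarOcta p T) : solid p = Hyp ∩ Inner p T := by
  ext x
  constructor
  · rintro (h | ⟨⟨hx, hxs⟩, hb⟩)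
    · exact ⟨(hp.mem_surface.1 h).1, (hp.mem_surface.1 h).2.1⟩
    · refine ⟨hx, ?_⟩
      by_contra hxi
      exact hp.not_isBounded_of_not_mem_inner hx hxi hb
  · rintro ⟨hx, hxi⟩
    by_cases hxs : x ∈ surface p
    · exact Or.inl hxs
    refine Or.inr ⟨⟨hx, hxs⟩, hp.isBounded_inner.subset ?_⟩
    set K := connectedComponentIn (Hyp \ surface p) x
    have hK : K ⊆ Hyp \ surface p := connectedComponentIn_subset _ _
    intro y hy
    refine ⟨(hK hy).1, ?_⟩
    by_contra hyi
    have hyo : y ∈ Outer p T := by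
      have : y ∈ Inner p T ∪ Outer p T := by rw [hp.inner_union_outer]; trivial
      exact this.resolve_left hyi
    -- A connected set meeting both closed sets `Inner` and `Outer`, which cover everything, meets
    -- their intersection, hence the surface.
    have := isPreconnected_closed_iff.1 (isPreconnected_connectedComponentIn (x := x)
      (F := Hyp \ surface p)) _ _ hp.isClosed_inner hp.isClosed_outer (by rw [hp.inner_union_outer]; exact Set.subset_univ K)
      ⟨x, mem_connectedComponentIn ⟨hx, hxs⟩, hxi⟩ ⟨y, hy, hyo⟩
    obtain ⟨w, hw, hwi, hwo⟩ := this
    exact (hK hw).2 (hp.mem_surface.2 ⟨(hK hw).1, hwi, hwo⟩)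

lemma isPolyhedron (hp : IsStarOcta p T) : IsPolyhedron p where
  mem_hyp := hp.mem
  face_nondegenerate s := by
    rw [Fintype.linearIndependent_iff]
    intro g hg
    have key : ∀ i, g 0 * p (s 0, 0) i + g 1 * p (s 1, 1) i + g 2 * p (s 2, 2) i = 0 := by
      intro i
      have := congrFun hg i
      simpa [Fin.sum_univ_three] using this
    obtain ⟨h0, h1, h2⟩ := eq_zero_of_comb_eq_zero (hp.det3_ne_zero s) (key 1) (key 2) (key 3)
    intro k
    fin_cases k <;> assumption
  face_inter s t := by
    ext x
    constructor
    · rintro ⟨⟨hx, c, h0, hs, hxc⟩, ⟨-, d, h0', ht, hxd⟩⟩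
      obtain rfl : c = d := hp.coeff_unique ⟨h0, s, hs⟩ ⟨h0', t, ht⟩ fun i _ => by
        have := congrFun (hxc.symm.trans hxd) i
        simpa using this
      refine ⟨hx, c, h0, fun v hv => ?_, hxc⟩
      by_cases h : v ∈ face s
      · exact ht v fun h' => hv (Finset.mem_inter.2 ⟨h, h'⟩)
      · exact hs v h
    · rintro ⟨hx, c, h0, hst, hxc⟩
      exact ⟨⟨hx, c, h0, fun v hv => hst v fun h => hv (Finset.mem_inter.1 h).1, hxc⟩,
        ⟨hx, c, h0, fun v hv => hst v fun h => hv (Finset.mem_inter.1 h).2, hxc⟩⟩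

end IsStarOcta

end TwistedOcta

open TwistedOcta
namespace TwistedOcta

/-! ### Dihedral angles of a star-shaped octahedron -/

/-- The wedge is the union of a wedge of angle δ₁ above the ray Q = 0, P ≥ 0 and one of angle δ₂
below it. Rotating by δ₂ moves the lower side to φ = 0, as polar coordinates in `HasDihedralAngle`
demand. -/
lemma wedge_iff {δ₁ δ₂ P Q : ℝ} (h₁ : 0 < δ₁) (h₁' : δ₁ < Real.pi) (h₂ : 0 < δ₂)
    (h₂' : δ₂ < Real.pi) :
    ((0 ≤ Q ∧ 0 ≤ P * Real.sin δ₁ - Q * Real.cos δ₁) ∨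
      (Q ≤ 0 ∧ 0 ≤ P * Real.sin δ₂ + Q * Real.cos δ₂)) ↔
    ∃ ρ φ : ℝ, 0 ≤ ρ ∧ 0 ≤ φ ∧ φ ≤ δ₁ + δ₂ ∧
      P * Real.cos δ₂ - Q * Real.sin δ₂ = ρ * Real.cos φ ∧
      P * Real.sin δ₂ + Q * Real.cos δ₂ = ρ * Real.sin φ := by
  constructor
  · intro h
    obtain ⟨ρ, ψ, hρ, hψ, hψ', hP, hQ⟩ : ∃ ρ ψ : ℝ, 0 ≤ ρ ∧ -Real.pi < ψ ∧ ψ ≤ Real.pi ∧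
        P = ρ * Real.cos ψ ∧ Q = ρ * Real.sin ψ := by
      refine ⟨‖(⟨P, Q⟩ : ℂ)‖, Complex.arg ⟨P, Q⟩, norm_nonneg _, Complex.neg_pi_lt_arg _,
        Complex.arg_le_pi _, ?_, ?_⟩
      · rw [Complex.norm_mul_cos_arg]
      · rw [Complex.norm_mul_sin_arg]
    rcases hρ.eq_or_lt with rfl | hρ
    · exact ⟨0, 0, le_rfl, le_rfl, by linarith, by simp [hP, hQ], by simp [hP, hQ]⟩
    have hcos : P * Real.cos δ₂ - Q * Real.sin δ₂ = ρ * Real.cos (ψ + δ₂) := by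
      rw [hP, hQ, Real.cos_add]; ring
    have hsin : P * Real.sin δ₂ + Q * Real.cos δ₂ = ρ * Real.sin (ψ + δ₂) := by
      rw [hP, hQ, Real.sin_add]; ring
    refine ⟨ρ, ψ + δ₂, hρ.le, ?_, ?_, hcos, hsin⟩
    · rcases h with h | h
      · by_contra hneg
        have : Real.sin ψ < 0 := Real.sin_neg_of_neg_of_neg_pi_lt (by linarith) hψ
        nlinarith [h.1]
      · rw [hsin] at h
        by_contra hneg
        have : Real.sin (ψ + δ₂) < 0 :=
          Real.sin_neg_of_neg_of_neg_pi_lt (by linarith) (by linarith)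
        nlinarith [h.2]
    · rcases h with h | h
      · have e : P * Real.sin δ₁ - Q * Real.cos δ₁ = -(ρ * Real.sin (ψ - δ₁)) := by
          rw [hP, hQ, Real.sin_sub]; ring
        by_contra hgt
        have : 0 < Real.sin (ψ - δ₁) := Real.sin_pos_of_pos_of_lt_pi (by linarith) (by linarith)
        have := mul_pos hρ this
        linarith [h.2]
      · by_contra hgt
        have hψ0 : 0 < ψ := by linarith
        rcases hψ'.lt_or_eq with hlt | rfl
        · have := mul_pos hρ (Real.sin_pos_of_pos_of_lt_pi hψ0 hlt)
          linarith [h.1]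
        · rw [hsin, add_comm, Real.sin_add_pi] at h
          have := mul_pos hρ (Real.sin_pos_of_pos_of_lt_pi h₂ h₂')
          linarith [h.2]
  · rintro ⟨ρ, φ, hρ, hφ, hφ', hc, hs⟩
    have hP : P = ρ * Real.cos (φ - δ₂) := by
      rw [Real.cos_sub]
      linear_combination Real.cos δ₂ * hc + Real.sin δ₂ * hs - P * Real.sin_sq_add_cos_sq δ₂
    have hQ : Q = ρ * Real.sin (φ - δ₂) := by
      rw [Real.sin_sub]
      linear_combination Real.cos δ₂ * hs - Real.sin δ₂ * hc - Q * Real.sin_sq_add_cos_sq δ₂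
    rcases le_total δ₂ φ with h | h
    · left
      have e : P * Real.sin δ₁ - Q * Real.cos δ₁ = ρ * Real.sin (δ₁ - (φ - δ₂)) := by
        rw [hP, hQ, Real.sin_sub δ₁]; ring
      rw [e, hQ]
      exact ⟨mul_nonneg hρ (Real.sin_nonneg_of_nonneg_of_le_pi (by linarith) (by linarith)),
        mul_nonneg hρ (Real.sin_nonneg_of_nonneg_of_le_pi (by linarith) (by linarith))⟩
    · right
      rw [hs, hQ]
      exact ⟨mul_nonpos_of_nonneg_of_nonpos hρ
        (Real.sin_nonpos_of_nonpos_of_neg_pi_le (by linarith) (by linarith)),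
        mul_nonneg hρ (Real.sin_nonneg_of_nonneg_of_le_pi hφ (by linarith))⟩

/-- The angle in `(0, π)` with cotangent `x`. -/
noncomputable def arccot (x : ℝ) : ℝ := Real.pi / 2 - Real.arctan x

lemma arccot_pos (x : ℝ) : 0 < arccot x := sub_pos.2 (Real.arctan_lt_pi_div_two x)

lemma arccot_lt_pi (x : ℝ) : arccot x < Real.pi := by
  have := Real.neg_pi_div_two_lt_arctan x
  unfold arccot
  linarith

lemma sin_arccot_pos (x : ℝ) : 0 < Real.sin (arccot x) :=
  Real.sin_pos_of_pos_of_lt_pi (arccot_pos x) (arccot_lt_pi x)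

lemma cos_arccot (x : ℝ) : Real.cos (arccot x) = x * Real.sin (arccot x) := by
  rw [arccot, Real.cos_pi_div_two_sub, Real.sin_pi_div_two_sub, Real.sin_arctan, Real.cos_arctan]
  ring

lemma wedge_iff' {P Q x₁ x₂ : ℝ} :
    ((0 ≤ Q ∧ 0 ≤ P - x₁ * Q) ∨ (Q ≤ 0 ∧ 0 ≤ P + x₂ * Q)) ↔
    ∃ ρ φ : ℝ, 0 ≤ ρ ∧ 0 ≤ φ ∧ φ ≤ arccot x₁ + arccot x₂ ∧
      P * Real.cos (arccot x₂) - Q * Real.sin (arccot x₂) = ρ * Real.cos φ ∧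
      P * Real.sin (arccot x₂) + Q * Real.cos (arccot x₂) = ρ * Real.sin φ := by
  rw [← wedge_iff (arccot_pos x₁) (arccot_lt_pi x₁) (arccot_pos x₂) (arccot_lt_pi x₂)]
  have e₁ : P * Real.sin (arccot x₁) - Q * Real.cos (arccot x₁) =
      Real.sin (arccot x₁) * (P - x₁ * Q) := by rw [cos_arccot]; ring
  have e₂ : P * Real.sin (arccot x₂) + Q * Real.cos (arccot x₂) =
      Real.sin (arccot x₂) * (P + x₂ * Q) := by rw [cos_arccot]; ring
  rw [e₁, e₂, mul_nonneg_iff_of_pos_left (sin_arccot_pos _),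
    mul_nonneg_iff_of_pos_left (sin_arccot_pos _)]

/-- The cotangent of the dihedral angle at the edge `uv` between the triangle `uvw` and the plane
through `u, v` and the center. -/
noncomputable def edgeCot (p : Vert → Mink) (u v w : Vert) : ℝ :=
  p u 0 * (-mink (p u) (p w) - mink (p v) (p w) - 1 + mink (p u) (p v)) /
    |det3 (p u) (p v) (p w)| * Real.sqrt ((-mink (p u) (p v) - 1) / (-mink (p u) (p v) + 1))

namespace IsStarOcta

variable {p : Vert → Mink} {T : ℝ}

/-- Inside the cone over one face the solid is cut out by a single linear inequality, because the
face coefficients are unique. -/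
lemma mem_solid_iff (hp : IsStarOcta p T) {u v w : Vert} (huv : u.2 ≠ v.2) (huw : u.2 ≠ w.2)
    (hvw : v.2 ≠ w.2) {a b f : ℝ} (ha : 0 ≤ a) (hb : 0 ≤ b) (hf : 0 ≤ f) {x : Mink}
    (hx : x ∈ Hyp) (h : ∀ i : Fin 4, i ≠ 0 → a * p u i + b * p v i + f * p w i = x i) :
    x ∈ solid p ↔ T * (a + b + f) ≤ x 0 := by
  let c : Vert → ℝ := Pi.single u a + Pi.single v b + Pi.single w f
  have hsum : ∀ g : Vert → ℝ, ∑ i, c i * g i = a * g u + b * g v + f * g w := by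
    intro g
    simp [c, add_mul, Finset.sum_add_distrib, Pi.single_apply]
  have hc : FaceCoeff c := by
    refine ⟨fun i => ?_, fun k => if k = u.2 then u.1 else if k = v.2 then v.1 else w.1,
      fun i hi => ?_⟩
    · simp only [c, Pi.add_apply, Pi.single_apply]
      split_ifs <;> simp [ha, hb, hf, add_nonneg]
    · rw [mem_face] at hi
      have h1 : i ≠ u := by rintro rfl; simp at hi
      have h2 : i ≠ v := by rintro rfl; simp [huv.symm] at hi
      have h3 : i ≠ w := by rintro rfl; simp [huw.symm, hvw.symm] at hi
      simp [c, h1, h2, h3]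
  have hsum1 : ∑ i, c i = a + b + f := by simpa using hsum fun _ => 1
  rw [hp.solid_eq]
  constructor
  · rintro ⟨-, d, hd, hdx, hle⟩
    obtain rfl : c = d := hp.coeff_unique hc hd fun i hi => by rw [hdx i hi, hsum, h i hi]
    rwa [hsum1] at hle
  · intro hle
    exact ⟨hx, c, hc, fun i hi => by rw [hsum, h i hi], by rwa [hsum1]⟩

end IsStarOcta

lemma mink_comb_left (r r' : ℝ) (x z z' : Mink) :
    mink (r • z + r' • z') x = r * mink z x + r' * mink z' x := by
  simp only [mink, Pi.add_apply, Pi.smul_apply, smul_eq_mul]; ring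

lemma mink_comb_right (r r' : ℝ) (x z z' : Mink) :
    mink x (r • z + r' • z') = r * mink x z + r' * mink x z' := by
  simp only [mink, Pi.add_apply, Pi.smul_apply, smul_eq_mul]; ring

lemma mink_comm (x y : Mink) : mink x y = mink y x := by simp only [mink]; ring

/-- The cross product of the spatial parts of two vectors. -/
def cross (x y : Mink) : Mink :=
  ![0, x 2 * y 3 - x 3 * y 2, x 3 * y 1 - x 1 * y 3, x 1 * y 2 - x 2 * y 1]

lemma mink_cross (x y w : Mink) : mink w (cross x y) = det3 x y w := by
  simp [mink, cross, det3]; ring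

lemma mink_cross_self (x y : Mink) : mink (cross x y) (cross x y) =
    (x 1 ^ 2 + x 2 ^ 2 + x 3 ^ 2) * (y 1 ^ 2 + y 2 ^ 2 + y 3 ^ 2) -
      (x 1 * y 1 + x 2 * y 2 + x 3 * y 3) ^ 2 := by
  simp only [mink, cross, Matrix.cons_val_zero, Matrix.cons_val_one, Matrix.cons_val]; ring

lemma mink_cross_self_pos {x y w : Mink} (h : det3 x y w ≠ 0) :
    0 < mink (cross x y) (cross x y) := by
  have e : mink (cross x y) (cross x y) = (x 2 * y 3 - x 3 * y 2) ^ 2 +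
      (x 3 * y 1 - x 1 * y 3) ^ 2 + (x 1 * y 2 - x 2 * y 1) ^ 2 := by
    simp only [mink, cross, Matrix.cons_val_zero, Matrix.cons_val_one, Matrix.cons_val]; ring
  rw [e]
  refine lt_of_le_of_ne (by positivity) fun h0 => h ?_
  have s1 := sq_nonneg (x 2 * y 3 - x 3 * y 2)
  have s2 := sq_nonneg (x 3 * y 1 - x 1 * y 3)
  have s3 := sq_nonneg (x 1 * y 2 - x 2 * y 1)
  have z1 : x 2 * y 3 - x 3 * y 2 = 0 := pow_eq_zero_iff two_ne_zero |>.1 (by linarith)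
  have z2 : x 3 * y 1 - x 1 * y 3 = 0 := pow_eq_zero_iff two_ne_zero |>.1 (by linarith)
  have z3 : x 1 * y 2 - x 2 * y 1 = 0 := pow_eq_zero_iff two_ne_zero |>.1 (by linarith)
  simp only [det3]
  linear_combination w 1 * z1 + w 2 * z2 + w 3 * z3

namespace IsStarOcta

variable {p : Vert → Mink} {T : ℝ}

/-- An orthogonal basis of the plane orthogonal to an edge. -/
lemma exists_edge_frame (hp : IsStarOcta p T) {u v w : Vert}
    (hD : det3 (p u) (p v) (p w) ≠ 0) :
    ∃ (F : Mink) (K n₁ n₂ : ℝ), 0 < K ∧ 0 < n₁ ∧ 0 < n₂ ∧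
      mink (p u) F = 0 ∧ mink (p v) F = 0 ∧ mink F F = n₁ ^ 2 ∧
      mink (cross (p u) (p v)) (cross (p u) (p v)) = n₂ ^ 2 ∧ mink F (cross (p u) (p v)) = 0 ∧
      Real.sqrt ((-mink (p u) (p v) - 1) / (-mink (p u) (p v) + 1)) = n₂ / n₁ ∧
      (∀ z, mink (p z) F =
        T * (-mink (p u) (p z) - mink (p v) (p z) - 1 + mink (p u) (p v))) ∧
      ∀ (z : Vert) (x : Mink) (a b f : ℝ),
        (∀ i : Fin 4, i ≠ 0 → a * p u i + b * p v i + f * p z i = x i) →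
        mink x F = f * mink (p z) F + (x 0 - T * (a + b + f)) * K := by
  have hT := hp.time_pos
  have hu := (hp.mem u).1
  have hv := (hp.mem v).1
  obtain ⟨C, hC⟩ : ∃ C, C = -mink (p u) (p v) := ⟨_, rfl⟩
  have hC1 : 1 ≤ C := hC ▸ one_le_neg_mink (hp.mem u) (hp.mem v)
  obtain ⟨K, hK⟩ : ∃ K, K = 2 * T ^ 2 - 1 - C := ⟨_, rfl⟩
  have huT := hp.time u
  have hvT := hp.time v
  -- F₁ = (1 + C) e₀ - T (p u + p v): the vector in the span of the center and the edge that is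
  -- orthogonal to the edge. Its product with the center is K > 0, so it points to the inside.
  let F₁ : Mink := ![(1 + C) - 2 * T ^ 2, -T * (p u 1 + p v 1), -T * (p u 2 + p v 2),
    -T * (p u 3 + p v 3)]
  have hF₁ : ∀ x, mink x F₁ = x 0 * K - T * (x 1 * (p u 1 + p v 1) + x 2 * (p u 2 + p v 2) +
      x 3 * (p u 3 + p v 3)) := by
    intro x; rw [hK]; simp [mink, F₁]; ring
  have hu' : p u 1 ^ 2 + p u 2 ^ 2 + p u 3 ^ 2 = T ^ 2 - 1 := by
    simp only [mink, huT] at hu; linarith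
  have hv' : p v 1 ^ 2 + p v 2 ^ 2 + p v 3 ^ 2 = T ^ 2 - 1 := by
    simp only [mink, hvT] at hv; linarith
  have huv' : p u 1 * p v 1 + p u 2 * p v 2 + p u 3 * p v 3 = T ^ 2 - C := by
    simp only [mink, huT, hvT] at hC; linarith
  have hF₁u : mink (p u) F₁ = 0 := by
    rw [hF₁, huT, hK]; linear_combination -T * hu' - T * huv'
  have hF₁v : mink (p v) F₁ = 0 := by
    rw [hF₁, hvT, hK]; linear_combination -T * hv' - T * huv'
  have hN₁ : mink F₁ F₁ = (1 + C) * K := by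
    rw [hF₁]
    simp only [F₁, Matrix.cons_val_zero, Matrix.cons_val_one, Matrix.cons_val, hK]
    linear_combination T ^ 2 * hu' + T ^ 2 * hv' + 2 * T ^ 2 * huv'
  have hN₂ : mink (cross (p u) (p v)) (cross (p u) (p v)) = (C - 1) * K := by
    rw [mink_cross_self, hu', hv', huv', hK]; ring
  have h12 : mink F₁ (cross (p u) (p v)) = 0 := by
    rw [mink_cross]
    simp only [F₁, det3, Matrix.cons_val_one, Matrix.cons_val]
    ring
  have hN₂pos : 0 < (C - 1) * K := hN₂ ▸ mink_cross_self_pos hD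
  have hC1' : 0 < C - 1 := by
    rcases (sub_nonneg.2 hC1).lt_or_eq with h | h
    · exact h
    · rw [← h, zero_mul] at hN₂pos
      exact absurd hN₂pos (lt_irrefl _)
  have hKpos : 0 < K := (mul_pos_iff_of_pos_left hC1').1 hN₂pos
  have hN₁pos : 0 < (1 + C) * K := mul_pos (by linarith) hKpos
  refine ⟨F₁, K, Real.sqrt ((1 + C) * K), Real.sqrt ((C - 1) * K), hKpos, Real.sqrt_pos.2 hN₁pos,
    Real.sqrt_pos.2 hN₂pos, hF₁u, hF₁v, by rw [hN₁, Real.sq_sqrt hN₁pos.le],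
    by rw [hN₂, Real.sq_sqrt hN₂pos.le], h12, ?_, ?_, ?_⟩
  · rw [← hC, ← Real.sqrt_div hN₂pos.le, mul_comm (1 + C), mul_comm (C - 1),
      mul_div_mul_left _ _ hKpos.ne', add_comm]
  · intro z
    rw [hF₁, hp.time z, hK, hC]
    simp only [mink, huT, hvT, hp.time z]
    ring
  · intro z x a b f hx'
    rw [hF₁, huT] at hF₁u
    rw [hF₁, hvT] at hF₁v
    rw [hF₁ x, hF₁ (p z), hp.time z, ← hx' 1 (by decide), ← hx' 2 (by decide),
      ← hx' 3 (by decide)]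
    linear_combination a * hF₁u + b * hF₁v

/-- Near an inner point of the edge the two coordinates along the edge stay positive, so only the
sign of the third one decides which adjacent cone contains x. -/
lemma eventually_pos_coord {u v z : Vert} (hz : det3 (p u) (p v) (p z) ≠ 0) {c d : ℝ}
    (hc : 0 < c) (hd : 0 < d) :
    ∀ᶠ x in nhdsWithin (c • p u + d • p v) Hyp, x ∈ Hyp ∧
      0 < det3 x (p v) (p z) / det3 (p u) (p v) (p z) ∧
      0 < det3 (p u) x (p z) / det3 (p u) (p v) (p z) := by
  have c1 : Continuous fun x => det3 x (p v) (p z) / det3 (p u) (p v) (p z) := by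
    simp only [det3]; fun_prop
  have c2 : Continuous fun x => det3 (p u) x (p z) / det3 (p u) (p v) (p z) := by
    simp only [det3]; fun_prop
  have v1 : det3 (c • p u + d • p v) (p v) (p z) / det3 (p u) (p v) (p z) = c := by
    rw [div_eq_iff hz]; simp only [det3, Pi.add_apply, Pi.smul_apply, smul_eq_mul]; ring
  have v2 : det3 (p u) (c • p u + d • p v) (p z) / det3 (p u) (p v) (p z) = d := by
    rw [div_eq_iff hz]; simp only [det3, Pi.add_apply, Pi.smul_apply, smul_eq_mul]; ring
  refine Filter.eventually_and.2 ⟨eventually_mem_nhdsWithin, Filter.Eventually.filter_mono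
    nhdsWithin_le_nhds (Filter.eventually_and.2 ⟨?_, ?_⟩)⟩
  · exact c1.continuousAt.eventually (lt_mem_nhds (by simpa only [v1] using hc))
  · exact c2.continuousAt.eventually (lt_mem_nhds (by simpa only [v2] using hd))

/-- The plane through the edge and the center separates w from w' and cuts the solid near the edge
into two wedges, one below each adjacent face. Their angles, the `arccot` values, add up; nothing
requires the sum to be less than π. -/
lemma hasDihedralAngle (hp : IsStarOcta p T) {u v w w' : Vert} (huv : u.2 ≠ v.2)
    (huw : u.2 ≠ w.2) (hvw : v.2 ≠ w.2) (hww : w'.2 = w.2)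
    (hD : 0 < det3 (p u) (p v) (p w)) (hD' : det3 (p u) (p v) (p w') < 0)
    {c d : ℝ} (hc : 0 < c) (hd : 0 < d) :
    HasDihedralAngle (solid p) (c • p u + d • p v)
      (arccot (edgeCot p u v w) + arccot (edgeCot p u v w')) := by
  refine ⟨add_pos (arccot_pos _) (arccot_pos _), by
    linarith [arccot_lt_pi (edgeCot p u v w), arccot_lt_pi (edgeCot p u v w')], ?_⟩
  obtain ⟨F, K, n₁, n₂, hK, hn₁, hn₂, hFu, hFv, hFF, hGG, hFG, hratio, hFz, hFx⟩ :=
    hp.exists_edge_frame hD.ne'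
  obtain ⟨G, hG⟩ : ∃ G, G = cross (p u) (p v) := ⟨_, rfl⟩
  have hGx : ∀ x, mink x G = det3 (p u) (p v) x := fun x => by rw [hG, mink_cross]
  have hGu : mink (p u) G = 0 := by rw [hGx]; simp only [det3]; ring
  have hGv : mink (p v) G = 0 := by rw [hGx]; simp only [det3]; ring
  rw [← hG] at hGG hFG
  obtain ⟨θ, hθ⟩ : ∃ θ, θ = arccot (edgeCot p u v w') := ⟨_, rfl⟩
  have hcs := Real.sin_sq_add_cos_sq θ
  have hee : ∀ a b a' b' : ℝ, mink (a • F + b • G) (a' • F + b' • G) =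
      a * a' * n₁ ^ 2 + b * b' * n₂ ^ 2 := by
    intro a b a' b'
    rw [mink_comb_right, mink_comb_left, mink_comb_left, mink_comm G F, hFG, hFF, hGG]
    ring
  -- The orthonormal frame F/n₁, G/n₂ rotated by the angle θ on the side of w', so that the face
  -- with w' becomes the ray of polar angle 0.
  refine ⟨(Real.cos θ / n₁) • F + (-(Real.sin θ / n₂)) • G,
    (Real.sin θ / n₁) • F + (Real.cos θ / n₂) • G, ?_, ?_, ?_, ?_, ?_, ?_⟩
  · rw [mink_comm, mink_comb_right, mink_comb_left, mink_comb_left, hFu, hFv, hGu, hGv]; ring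
  · rw [mink_comm, mink_comb_right, mink_comb_left, mink_comb_left, hFu, hFv, hGu, hGv]; ring
  · rw [hee]; field_simp; linarith
  · rw [hee]; field_simp; linarith
  · rw [hee]; field_simp; ring
  -- With P = ⟨x, F⟩/n₁ and Q = ⟨x, G⟩/n₂, the inequality of `mem_solid_iff` in the cone over the
  -- face with z becomes P - cot · Q ≥ 0. The cotangent carries the sign of the determinant, which
  -- produces the plus sign for w'.
  have repr : ∀ z : Vert, u.2 ≠ z.2 → v.2 ≠ z.2 → det3 (p u) (p v) (p z) ≠ 0 → ∀ x ∈ Hyp,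
      0 < det3 x (p v) (p z) / det3 (p u) (p v) (p z) →
      0 < det3 (p u) x (p z) / det3 (p u) (p v) (p z) →
      0 ≤ det3 (p u) (p v) x / det3 (p u) (p v) (p z) →
      (x ∈ solid p ↔ 0 ≤ mink x F / n₁ - (p u 0 * (-mink (p u) (p z) - mink (p v) (p z) - 1 +
        mink (p u) (p v)) / det3 (p u) (p v) (p z) * (n₂ / n₁)) * (mink x G / n₂)) := by
    intro z huz hvz hz x hx ha hb hf
    obtain ⟨a, haa⟩ : ∃ a, a = det3 x (p v) (p z) / det3 (p u) (p v) (p z) := ⟨_, rfl⟩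
    obtain ⟨b, hbb⟩ : ∃ b, b = det3 (p u) x (p z) / det3 (p u) (p v) (p z) := ⟨_, rfl⟩
    obtain ⟨f, hff⟩ : ∃ f, f = det3 (p u) (p v) x / det3 (p u) (p v) (p z) := ⟨_, rfl⟩
    rw [← haa] at ha
    rw [← hbb] at hb
    rw [← hff] at hf
    have hx' : ∀ i : Fin 4, i ≠ 0 → a * p u i + b * p v i + f * p z i = x i := by
      intro i hi
      rw [haa, hbb, hff, div_mul_eq_mul_div, div_mul_eq_mul_div, div_mul_eq_mul_div, ← add_div,
        ← add_div, div_eq_iff hz]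
      fin_cases i
      · exact absurd rfl hi
      all_goals simp [det3]; ring
    rw [hp.mem_solid_iff huv huz hvz ha.le hb.le hf hx hx']
    have e2 : mink x G = f * det3 (p u) (p v) (p z) := by
      rw [hGx, hff, div_mul_cancel₀ _ hz]
    have e3 : mink x F / n₁ - (p u 0 * (-mink (p u) (p z) - mink (p v) (p z) - 1 +
        mink (p u) (p v)) / det3 (p u) (p v) (p z) * (n₂ / n₁)) * (mink x G / n₂) =
        (K / n₁) * (x 0 - T * (a + b + f)) := by
      rw [hFx z x a b f hx', e2, hp.time u, ← hFz]
      field_simp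
      ring
    rw [e3, mul_nonneg_iff_of_pos_left (div_pos hK hn₁), sub_nonneg]
  filter_upwards [eventually_pos_coord hD.ne' hc hd, eventually_pos_coord hD'.ne hc hd]
    with x ⟨hx, ha, hb⟩ ⟨_, ha', hb'⟩
  have m1 : mink x ((Real.cos θ / n₁) • F + (-(Real.sin θ / n₂)) • G) =
      mink x F / n₁ * Real.cos θ - mink x G / n₂ * Real.sin θ := by
    rw [mink_comb_right]; ring
  have m2 : mink x ((Real.sin θ / n₁) • F + (Real.cos θ / n₂) • G) =
      mink x F / n₁ * Real.sin θ + mink x G / n₂ * Real.cos θ := by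
    rw [mink_comb_right]; ring
  rw [m1, m2, hθ, ← wedge_iff']
  have c1 : edgeCot p u v w = p u 0 * (-mink (p u) (p w) - mink (p v) (p w) - 1 +
      mink (p u) (p v)) / det3 (p u) (p v) (p w) * (n₂ / n₁) := by
    rw [edgeCot, abs_of_pos hD, hratio]
  have c2 : p u 0 * (-mink (p u) (p w') - mink (p v) (p w') - 1 +
      mink (p u) (p v)) / det3 (p u) (p v) (p w') * (n₂ / n₁) = -edgeCot p u v w' := by
    rw [edgeCot, abs_of_neg hD', hratio]
    ring
  have hQ : mink x G / n₂ = det3 (p u) (p v) x / n₂ := by rw [hGx]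
  rcases le_total 0 (det3 (p u) (p v) x) with h | h
  · rw [repr w huw hvw hD.ne' x hx ha hb (div_nonneg h hD.le), ← c1]
    have hQ0 : 0 ≤ mink x G / n₂ := by rw [hQ]; exact div_nonneg h hn₂.le
    constructor
    · intro h'; exact Or.inl ⟨hQ0, h'⟩
    · rintro (h' | h')
      · exact h'.2
      · have : mink x G / n₂ = 0 := le_antisymm h'.1 hQ0
        rw [this] at h' ⊢
        simpa using h'.2
  · rw [repr w' (hww ▸ huw) (hww ▸ hvw) hD'.ne x hx ha' hb' (div_nonneg_of_nonpos h hD'.le)]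
    rw [c2, neg_mul, sub_neg_eq_add]
    have hQ0 : mink x G / n₂ ≤ 0 := by rw [hQ]; exact div_nonpos_of_nonpos_of_nonneg h hn₂.le
    constructor
    · intro h'; exact Or.inr ⟨hQ0, h'⟩
    · rintro (h' | h')
      · have : mink x G / n₂ = 0 := le_antisymm hQ0 h'.1
        rw [this] at h' ⊢
        simpa using h'.2
      · exact h'.2

end IsStarOcta

end TwistedOcta

open TwistedOcta
namespace TwistedOcta

open Filter Topology

/-! ### Local analysis of the angle map -/

/-- The positive function `f` has logarithmic derivative `l` at `x`. -/
def HasLogDeriv (f : ℝ → ℝ) (l x : ℝ) : Prop := 0 < f x ∧ HasDerivAt f (f x * l) x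

namespace HasLogDeriv

variable {f g : ℝ → ℝ} {l m x : ℝ}

lemma of_hasDerivAt {f' : ℝ} (h0 : 0 < f x) (h : HasDerivAt f f' x) :
    HasLogDeriv f (f' / f x) x := ⟨h0, by rwa [mul_div_cancel₀ _ h0.ne']⟩

lemma mul (hf : HasLogDeriv f l x) (hg : HasLogDeriv g m x) :
    HasLogDeriv (fun t => f t * g t) (l + m) x :=
  ⟨mul_pos hf.1 hg.1, (hf.2.mul hg.2).congr_deriv (by ring)⟩

lemma div (hf : HasLogDeriv f l x) (hg : HasLogDeriv g m x) :
    HasLogDeriv (fun t => f t / g t) (l - m) x :=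
  ⟨div_pos hf.1 hg.1, (hf.2.div hg.2 hg.1.ne').congr_deriv (by
    have := hg.1.ne'
    field_simp)⟩

lemma sq (hf : HasLogDeriv f l x) : HasLogDeriv (fun t => f t ^ 2) (2 * l) x :=
  ⟨pow_pos hf.1 2, (hf.2.pow 2).congr_deriv (by push_cast; ring)⟩

lemma arctan_sqrt (hf : HasLogDeriv f l x) :
    HasDerivAt (fun t => Real.arctan (Real.sqrt (f t)))
      (Real.sqrt (f x) / (1 + f x) * (l / 2)) x := by
  refine ((hf.2.sqrt hf.1.ne').arctan).congr_deriv ?_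
  have hs := Real.sqrt_pos.2 hf.1
  have h1 : Real.sqrt (f x) ^ 2 = f x := Real.sq_sqrt hf.1.le
  have h2 := hf.1
  have h3 : 0 < 1 + f x := by linarith
  rw [h1]
  field_simp
  rw [h1]
  ring

lemma sqrt_div_one_add (hf : HasLogDeriv f l x) :
    HasDerivAt (fun t => Real.sqrt (f t) / (1 + f t))
      (Real.sqrt (f x) / (1 + f x) * ((1 - f x) / (1 + f x)) * (l / 2)) x := by
  have hs := Real.sqrt_pos.2 hf.1
  have h1 : Real.sqrt (f x) ^ 2 = f x := Real.sq_sqrt hf.1.le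
  have h2 := hf.1
  have h3 : 0 < 1 + f x := by linarith
  refine ((hf.2.sqrt hf.1.ne').div (hf.2.const_add 1) h3.ne').congr_deriv ?_
  field_simp
  rw [h1]
  ring

end HasLogDeriv

/-- One application of L'Hôpital's rule reduces the quotient to a symmetric difference quotient of
g', so twice differentiability at the single point 0 suffices. -/
lemma tendsto_symm_second_difference {g g' : ℝ → ℝ} {g₂ : ℝ}
    (hg : ∀ᶠ x in 𝓝 0, HasDerivAt g (g' x) x) (hg' : HasDerivAt g' g₂ 0) :
    Tendsto (fun x => (g x + g (-x) - 2 * g 0) / x ^ 2) (𝓝[>] 0) (𝓝 g₂) := by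
  have hneg : Tendsto (fun x : ℝ => -x) (𝓝 0) (𝓝 0) := by
    simpa using (continuous_neg (G := ℝ)).tendsto 0
  have hg0 : ContinuousAt g 0 := hg.self_of_nhds.continuousAt
  have hgn : Tendsto (fun x => g (-x)) (𝓝 0) (𝓝 (g 0)) := hg0.tendsto.comp hneg
  refine HasDerivAt.lhopital_zero_nhdsGT (f' := fun x => g' x - g' (-x)) (g' := fun x => 2 * x)
    ?_ ?_ ?_ ?_ ?_ ?_
  · refine Eventually.filter_mono nhdsWithin_le_nhds ?_
    filter_upwards [hg, hneg.eventually hg] with x h1 h2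
    refine ((h1.add (h2.comp x (hasDerivAt_neg x))).sub_const (2 * g 0)).congr_deriv (by ring)
  · refine Eventually.of_forall fun x => ?_
    simpa using hasDerivAt_pow 2 x
  · filter_upwards [self_mem_nhdsWithin] with x hx
    have : (0 : ℝ) < x := hx
    positivity
  · refine Tendsto.mono_left ?_ nhdsWithin_le_nhds
    have := (hg0.tendsto.add hgn).sub_const (2 * g 0)
    rwa [← two_mul, sub_self] at this
  · refine Tendsto.mono_left ?_ nhdsWithin_le_nhds
    have : Continuous fun x : ℝ => x ^ 2 := by fun_prop
    simpa using this.tendsto 0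
  · have h1 : HasDerivAt (fun x => g' x - g' (-x)) (2 * g₂) 0 := by
      have h2 : HasDerivAt g' g₂ (-0) := by simpa using hg'
      exact (hg'.sub (h2.comp 0 (hasDerivAt_neg 0))).congr_deriv (by ring)
    have h3 := (hasDerivAt_iff_tendsto_slope_zero.1 h1).mono_left
      (nhdsWithin_mono 0 (fun x (hx : 0 < x) => hx.ne'))
    have h4 := h3.const_mul (1 / 2)
    rw [show (1 / 2 : ℝ) * (2 * g₂) = g₂ by ring] at h4
    refine h4.congr fun x => ?_
    simp only [zero_add, neg_zero, sub_self, sub_zero, smul_eq_mul]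
    ring

/-- The substitution s = x² turns the second derivative of the even part into a one-sided first
derivative, so that a transversality argument of first order becomes available. -/
lemma hasDerivWithinAt_even_part {g g' : ℝ → ℝ} {g₂ : ℝ}
    (hg : ∀ᶠ x in 𝓝 0, HasDerivAt g (g' x) x) (hg' : HasDerivAt g' g₂ 0) :
    HasDerivWithinAt (fun s => (g (Real.sqrt s) + g (-Real.sqrt s)) / 2) (g₂ / 2)
      (Set.Ici 0) 0 := by
  rw [hasDerivWithinAt_iff_tendsto_slope]
  have hset : Set.Ici (0 : ℝ) \ {0} = Set.Ioi 0 := by simp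
  rw [hset]
  have hs : Tendsto Real.sqrt (𝓝[>] 0) (𝓝[>] 0) := by
    refine tendsto_nhdsWithin_iff.2 ⟨?_, ?_⟩
    · have := (Real.continuous_sqrt.tendsto 0).mono_left (nhdsWithin_le_nhds (s := Set.Ioi 0))
      rwa [Real.sqrt_zero] at this
    · filter_upwards [self_mem_nhdsWithin] with x hx
      exact Real.sqrt_pos.2 hx
  have h := ((tendsto_symm_second_difference hg hg').comp hs).div_const 2
  refine h.congr' ?_
  filter_upwards [self_mem_nhdsWithin] with x hx
  have hx0 : (0 : ℝ) < x := hx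
  simp only [Function.comp, slope_def_field, Real.sqrt_zero, neg_zero, sub_zero,
    Real.sq_sqrt hx0.le]
  field_simp
  ring

/-- If the curve `F` starts transversally to the images of the horizontal directions, its points
are images of points off the horizontal plane. -/
lemma eventually_exists_eq_of_transversal {E : ℝ × ℝ × ℝ → ℝ × ℝ × ℝ}
    {E' : ℝ × ℝ × ℝ →L[ℝ] ℝ × ℝ × ℝ} {x₀ : ℝ × ℝ × ℝ} (hE : HasStrictFDerivAt E E' x₀)
    (hinj : Function.Injective E') {F : ℝ → ℝ × ℝ × ℝ} {v : ℝ × ℝ × ℝ} (hF0 : F 0 = E x₀)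
    (hF : HasDerivWithinAt F v (Set.Ici 0) 0) (hv : ∀ x, E' x = v → x.2.2 ≠ 0)
    {V : Set (ℝ × ℝ × ℝ)} (hV : V ∈ 𝓝 x₀) :
    ∀ᶠ s in 𝓝[>] 0, ∃ x ∈ V, E x = F s ∧ x.2.2 ≠ x₀.2.2 := by
  -- An injective endomorphism of a finite-dimensional space is invertible, as the inverse function
  -- theorem needs; the curve is then pulled back by the local inverse.
  let L : (ℝ × ℝ × ℝ) ≃L[ℝ] ℝ × ℝ × ℝ :=
    (LinearEquiv.ofInjectiveEndo (E' : ℝ × ℝ × ℝ →ₗ[ℝ] ℝ × ℝ × ℝ) hinj).toContinuousLinearEquiv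
  have hL : ∀ x, L x = E' x := fun x => rfl
  have hE2 : HasStrictFDerivAt E (L : ℝ × ℝ × ℝ →L[ℝ] ℝ × ℝ × ℝ) x₀ := by
    have : (L : ℝ × ℝ × ℝ →L[ℝ] ℝ × ℝ × ℝ) = E' := by ext <;> rfl
    rwa [this]
  let G := hE2.localInverse E L x₀
  have hG : HasStrictFDerivAt G (L.symm : ℝ × ℝ × ℝ →L[ℝ] ℝ × ℝ × ℝ) (E x₀) :=
    hE2.to_localInverse
  have hG0 : G (E x₀) = x₀ := hE2.localInverse_apply_image
  have hright : ∀ᶠ y in 𝓝 (E x₀), E (G y) = y := hE2.eventually_right_inverse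
  have hFt : Tendsto F (𝓝[>] 0) (𝓝 (E x₀)) := by
    have := hF.continuousWithinAt.tendsto
    rw [hF0] at this
    exact this.mono_left (nhdsWithin_mono 0 Set.Ioi_subset_Ici_self)
  have hGt : Tendsto (fun s => G (F s)) (𝓝[>] 0) (𝓝 x₀) := by
    have := hG.continuousAt.tendsto.comp hFt
    rwa [hG0] at this
  have hGF : HasDerivWithinAt (fun s => G (F s)) (L.symm v) (Set.Ici 0) 0 := by
    have h := hG.hasFDerivAt
    rw [← hF0] at h
    exact h.comp_hasDerivWithinAt 0 hF
  have h3 : HasDerivWithinAt (fun s => (G (F s)).2.2) (L.symm v).2.2 (Set.Ici 0) 0 := by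
    have h := ((ContinuousLinearMap.snd ℝ ℝ ℝ).comp
      (ContinuousLinearMap.snd ℝ ℝ (ℝ × ℝ))).hasFDerivAt (x := G (F 0))
    exact h.comp_hasDerivWithinAt 0 hGF
  have hne : (L.symm v).2.2 ≠ 0 := hv _ (by rw [← hL, L.apply_symm_apply])
  have h4 := h3.eventually_ne (c := x₀.2.2) hne
  have hset : Set.Ici (0 : ℝ) \ {0} = Set.Ioi 0 := by simp
  rw [hset] at h4
  filter_upwards [h4, hFt.eventually hright, hGt hV] with s h1 h2 h5
  exact ⟨G (F s), h5, h2, h1⟩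

end TwistedOcta

/-! ### The angle map in explicit coordinates -/

open TwistedOcta
namespace TwistedOcta
open Filter Topology

/-- The square of the height of the vertices over the horizontal plane. -/
noncomputable def heightSq (u c φ : ℝ) : ℝ := c / 2 + u / 4 * Real.sin φ

/-- The squared ratio of the time coordinate and the height of the vertices. -/
noncomputable def ratioSq (u c φ : ℝ) : ℝ := (1 + u + heightSq u c φ) / heightSq u c φ

/-- The squared cotangent of the angle at a base edge on the side of the base. -/
noncomputable def cotSqBase (u c φ : ℝ) : ℝ := ratioSq u c φ * (u / (4 + 3 * u))

/-- The squared cotangent of the angle at a base edge on the side of a lateral face. -/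
noncomputable def cotSqSide (u c φ : ℝ) : ℝ :=
  ratioSq u c φ * ((u + 4 * c) ^ 2 / (u * (4 + 3 * u) * (1 + 2 * Real.sin φ) ^ 2))

/-- The squared cotangent of half the dihedral angle at the lateral edges; the two kinds of lateral
edges correspond to `e = √3` and `e = -√3`. -/
noncomputable def cotSqLat (e u c φ : ℝ) : ℝ :=
  ratioSq u c φ * ((e + 2 * Real.cos φ) ^ 2 / (1 + 2 * Real.sin φ) ^ 2 *
    ((2 * u + 2 * c - e * u * Real.cos φ) / (4 + (2 * u + 2 * c - e * u * Real.cos φ))))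

/-- The map that determines the dihedral angles of a symmetric octahedron. -/
noncomputable def angleMap (x : ℝ × ℝ × ℝ) : ℝ × ℝ × ℝ :=
  (Real.arctan (Real.sqrt (cotSqBase x.1 x.2.1 x.2.2)) +
      Real.arctan (Real.sqrt (cotSqSide x.1 x.2.1 x.2.2)),
    Real.arctan (Real.sqrt (cotSqLat (Real.sqrt 3) x.1 x.2.1 x.2.2)),
    Real.arctan (Real.sqrt (cotSqLat (-Real.sqrt 3) x.1 x.2.1 x.2.2)))

/-! ### Logarithmic derivatives of the squared cotangents -/

section LogDerivatives

variable {u c φ : ℝ → ℝ} {u' c' φ' t : ℝ}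

lemma hasDerivAt_heightSq (hu : HasDerivAt u u' t) (hc : HasDerivAt c c' t)
    (hφ : HasDerivAt φ φ' t) : HasDerivAt (fun t => heightSq (u t) (c t) (φ t))
      (c' / 2 + (u' / 4 * Real.sin (φ t) + u t / 4 * (Real.cos (φ t) * φ'))) t :=
  (hc.div_const 2).add ((hu.div_const 4).mul hφ.sin)

/-- The logarithmic derivative of `ratioSq`. -/
noncomputable def ratioLog (u c φ u' c' φ' : ℝ) : ℝ :=
  (u' + (c' / 2 + (u' / 4 * Real.sin φ + u / 4 * (Real.cos φ * φ')))) / (1 + u + heightSq u c φ) -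
    (c' / 2 + (u' / 4 * Real.sin φ + u / 4 * (Real.cos φ * φ'))) / heightSq u c φ

lemma hasLogDeriv_ratioSq (hu : HasDerivAt u u' t) (hc : HasDerivAt c c' t)
    (hφ : HasDerivAt φ φ' t) (h0 : 0 < u t) (hZ : 0 < heightSq (u t) (c t) (φ t)) :
    HasLogDeriv (fun t => ratioSq (u t) (c t) (φ t))
      (ratioLog (u t) (c t) (φ t) u' c' φ') t := by
  have h := hasDerivAt_heightSq hu hc hφ
  exact (HasLogDeriv.of_hasDerivAt (f := fun t => 1 + u t + heightSq (u t) (c t) (φ t))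
    (by linarith) ((hu.const_add 1).add h)).div (HasLogDeriv.of_hasDerivAt hZ h)

lemma hasLogDeriv_cotSqBase (hu : HasDerivAt u u' t) (hc : HasDerivAt c c' t)
    (hφ : HasDerivAt φ φ' t) (h0 : 0 < u t) (hZ : 0 < heightSq (u t) (c t) (φ t)) :
    HasLogDeriv (fun t => cotSqBase (u t) (c t) (φ t))
      (ratioLog (u t) (c t) (φ t) u' c' φ' + (u' / u t - 3 * u' / (4 + 3 * u t))) t :=
  (hasLogDeriv_ratioSq hu hc hφ h0 hZ).mul ((HasLogDeriv.of_hasDerivAt h0 hu).div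
    (HasLogDeriv.of_hasDerivAt (by linarith) ((hu.const_mul 3).const_add 4)))

lemma hasLogDeriv_one_add_two_sin (hφ : HasDerivAt φ φ' t) (hs : 0 < 1 + 2 * Real.sin (φ t)) :
    HasLogDeriv (fun t => 1 + 2 * Real.sin (φ t))
      (2 * (Real.cos (φ t) * φ') / (1 + 2 * Real.sin (φ t))) t :=
  HasLogDeriv.of_hasDerivAt hs ((hφ.sin.const_mul 2).const_add 1)

lemma hasLogDeriv_cotSqSide (hu : HasDerivAt u u' t) (hc : HasDerivAt c c' t)
    (hφ : HasDerivAt φ φ' t) (h0 : 0 < u t) (hc0 : 0 < u t + 4 * c t)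
    (hZ : 0 < heightSq (u t) (c t) (φ t)) (hs : 0 < 1 + 2 * Real.sin (φ t)) :
    HasLogDeriv (fun t => cotSqSide (u t) (c t) (φ t))
      (ratioLog (u t) (c t) (φ t) u' c' φ' + (2 * ((u' + 4 * c') / (u t + 4 * c t)) -
        (u' / u t + 3 * u' / (4 + 3 * u t) +
          2 * (2 * (Real.cos (φ t) * φ') / (1 + 2 * Real.sin (φ t)))))) t :=
  (hasLogDeriv_ratioSq hu hc hφ h0 hZ).mul
    ((HasLogDeriv.of_hasDerivAt (f := fun t => u t + 4 * c t) hc0 (hu.add (hc.const_mul 4))).sq.div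
      (((HasLogDeriv.of_hasDerivAt h0 hu).mul (HasLogDeriv.of_hasDerivAt
        (f := fun t => 4 + 3 * u t) (by linarith) ((hu.const_mul 3).const_add 4))).mul
          (hasLogDeriv_one_add_two_sin hφ hs).sq))

lemma hasLogDeriv_cotSqLat {e : ℝ} (hu : HasDerivAt u u' t) (hc : HasDerivAt c c' t)
    (hφ : HasDerivAt φ φ' t) (h0 : 0 < u t)
    (hZ : 0 < heightSq (u t) (c t) (φ t)) (hs : 0 < 1 + 2 * Real.sin (φ t))
    (he : 0 < e + 2 * Real.cos (φ t))
    (hm : 0 < 2 * u t + 2 * c t - e * u t * Real.cos (φ t)) :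
    HasLogDeriv (fun t => cotSqLat e (u t) (c t) (φ t))
      (ratioLog (u t) (c t) (φ t) u' c' φ' +
        (2 * (2 * (-Real.sin (φ t) * φ') / (e + 2 * Real.cos (φ t))) -
          2 * (2 * (Real.cos (φ t) * φ') / (1 + 2 * Real.sin (φ t))) +
        ((2 * u' + 2 * c' - (e * u' * Real.cos (φ t) + e * u t * (-Real.sin (φ t) * φ'))) /
            (2 * u t + 2 * c t - e * u t * Real.cos (φ t)) -
          (2 * u' + 2 * c' - (e * u' * Real.cos (φ t) + e * u t * (-Real.sin (φ t) * φ'))) /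
            (4 + (2 * u t + 2 * c t - e * u t * Real.cos (φ t)))))) t := by
  have hmd : HasDerivAt (fun t => 2 * u t + 2 * c t - e * u t * Real.cos (φ t))
      (2 * u' + 2 * c' - (e * u' * Real.cos (φ t) + e * u t * (-Real.sin (φ t) * φ'))) t :=
    ((hu.const_mul 2).add (hc.const_mul 2)).sub ((hu.const_mul e).mul hφ.cos)
  have hed : HasDerivAt (fun t => e + 2 * Real.cos (φ t)) (2 * (-Real.sin (φ t) * φ')) t :=
    (hφ.cos.const_mul 2).const_add e
  exact (hasLogDeriv_ratioSq hu hc hφ h0 hZ).mul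
    (((HasLogDeriv.of_hasDerivAt (f := fun t => e + 2 * Real.cos (φ t)) he hed).sq.div (hasLogDeriv_one_add_two_sin hφ hs).sq).mul
      ((HasLogDeriv.of_hasDerivAt
        (f := fun t => 2 * u t + 2 * c t - e * u t * Real.cos (φ t)) hm hmd).div
        (HasLogDeriv.of_hasDerivAt
          (f := fun t => 4 + (2 * u t + 2 * c t - e * u t * Real.cos (φ t))) (by linarith)
          (hmd.const_add 4))))

end LogDerivatives

/-! ### Values at twist deviation zero -/

section Values

variable {u c : ℝ}

lemma heightSq_zero : heightSq u c 0 = c / 2 := by simp [heightSq]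

lemma ratioSq_zero (hc : 0 < c) : ratioSq u c 0 = (2 + 2 * u + c) / c := by
  rw [ratioSq, heightSq_zero]
  field_simp

lemma cotSqBase_zero (hc : 0 < c) :
    cotSqBase u c 0 = (2 + 2 * u + c) / c * (u / (4 + 3 * u)) := by
  rw [cotSqBase, ratioSq_zero hc]

lemma cotSqSide_zero (hc : 0 < c) :
    cotSqSide u c 0 = (2 + 2 * u + c) / c * ((u + 4 * c) ^ 2 / (u * (4 + 3 * u))) := by
  rw [cotSqSide, ratioSq_zero hc]
  simp

lemma cotSqLat_zero {e : ℝ} (hc : 0 < c) :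
    cotSqLat e u c 0 = (2 + 2 * u + c) / c * ((e + 2) ^ 2 *
      ((2 * u + 2 * c - e * u) / (4 + (2 * u + 2 * c - e * u)))) := by
  rw [cotSqLat, ratioSq_zero hc]
  simp

/-- The quadratic form that measures the area of the lateral faces. -/
def areaForm (u c : ℝ) : ℝ := (1 + u) * (u + 8 * c) + 4 * c ^ 2

lemma one_add_cotSqBase_zero (hu : 0 < u) (hc : 0 < c) :
    1 + cotSqBase u c 0 = 2 * (1 + u) * (2 * c + u) / (c * (4 + 3 * u)) := by
  rw [cotSqBase_zero hc]
  field_simp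
  ring

lemma one_add_cotSqSide_zero (hu : 0 < u) (hc : 0 < c) :
    1 + cotSqSide u c 0 = 2 * (u + 2 * c) * areaForm u c / (c * u * (4 + 3 * u)) := by
  rw [cotSqSide_zero hc, areaForm]
  field_simp
  ring

/-- Only e² = 3 enters, so both kinds of lateral edges are treated at once. The common factor
`areaForm` reappears in the normal covector. -/
lemma one_add_cotSqLat_zero {e : ℝ} (he : e ^ 2 = 3) (hc : 0 < c)
    (hm : 0 < 2 * u + 2 * c - e * u) :
    1 + cotSqLat e u c 0 =
      2 * (2 + e) * areaForm u c / (c * (4 + (2 * u + 2 * c - e * u))) := by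
  have : 0 < 4 + (2 * u + 2 * c - e * u) := by linarith
  rw [cotSqLat_zero hc, areaForm]
  field_simp
  grind

end Values

end TwistedOcta

open TwistedOcta
namespace TwistedOcta
open Filter Topology

/-! ### Second derivatives in the direction of the twist -/

section SecondDerivatives

variable {u c : ℝ}

lemma eventually_regular (hc : 0 < c) {e : ℝ} (he : 0 < e + 2) (hm : 0 < 2 * u + 2 * c - e * u) :
    ∀ᶠ φ in 𝓝 (0 : ℝ), 0 < heightSq u c φ ∧ 0 < 1 + 2 * Real.sin φ ∧ 0 < e + 2 * Real.cos φ ∧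
      0 < 2 * u + 2 * c - e * u * Real.cos φ := by
  have h1 : ContinuousAt (fun φ => heightSq u c φ) 0 := by
    unfold heightSq; fun_prop
  have h2 : ContinuousAt (fun φ => 1 + 2 * Real.sin φ) 0 := by fun_prop
  have h3 : ContinuousAt (fun φ => e + 2 * Real.cos φ) 0 := by fun_prop
  have h4 : ContinuousAt (fun φ => 2 * u + 2 * c - e * u * Real.cos φ) 0 := by fun_prop
  have e1 := h1.eventually (lt_mem_nhds (a := 0) (by
    change 0 < heightSq u c 0
    rw [heightSq_zero]
    linarith))
  have e2 := h2.eventually (lt_mem_nhds (a := 0) (by simp))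
  have e3 := h3.eventually (lt_mem_nhds (a := 0) (by simpa using he))
  have e4 := h4.eventually (lt_mem_nhds (a := 0) (by simpa using hm))
  filter_upwards [e1, e2, e3, e4] with φ a1 a2 a3 a4
  exact ⟨a1, a2, a3, a4⟩

lemma ratioLog_zero (hu : 0 < u) (hc : 0 < c) (x y w : ℝ) : ratioLog u c 0 x y w =
    (2 * x + y + u * w / 2) / (2 + 2 * u + c) - (y + u * w / 2) / c := by
  rw [ratioLog, heightSq_zero]
  simp only [Real.sin_zero, Real.cos_zero]
  field_simp
  ring

lemma hasDerivAt_ratioLog (hu : 0 < u) (hc : 0 < c) :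
    HasDerivAt (fun φ => ratioLog u c φ 0 0 1)
      (u ^ 2 / 4 * (1 / c ^ 2 - 1 / (2 + 2 * u + c) ^ 2)) 0 := by
  have hN : HasDerivAt (fun φ : ℝ => (0 : ℝ) / 2 + (0 / 4 * Real.sin φ + u / 4 * (Real.cos φ * 1)))
      0 0 := by
    have := (((Real.hasDerivAt_sin 0).const_mul ((0 : ℝ) / 4)).add
      (((Real.hasDerivAt_cos 0).mul_const 1).const_mul (u / 4))).const_add ((0 : ℝ) / 2)
    simpa using this
  have hZ : HasDerivAt (fun φ => heightSq u c φ) (u / 4) 0 := by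
    have := hasDerivAt_heightSq (hasDerivAt_const (0 : ℝ) u) (hasDerivAt_const (0 : ℝ) c)
      (hasDerivAt_id (0 : ℝ))
    simpa using this
  have h0 : heightSq u c 0 = c / 2 := heightSq_zero
  have h := ((hN.const_add 0).div (hZ.const_add (1 + u)) (by rw [h0]; positivity)).sub
    (hN.div hZ (by rw [h0]; positivity))
  refine h.congr_deriv ?_
  rw [h0]
  simp only [Real.sin_zero, Real.cos_zero]
  field_simp
  ring

/-- The second derivative of the arctangent of the square root of a function, in terms of its
logarithmic derivative. -/
lemma hasDerivWithinAt_even_arctan_sqrt {f l : ℝ → ℝ} {l₂ : ℝ}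
    (h : ∀ᶠ φ in 𝓝 0, HasLogDeriv f (l φ) φ) (hl : HasDerivAt l l₂ 0) :
    HasDerivWithinAt (fun s => (Real.arctan (Real.sqrt (f (Real.sqrt s))) +
        Real.arctan (Real.sqrt (f (-Real.sqrt s)))) / 2)
      (Real.sqrt (f 0) / (1 + f 0) * (l₂ + (2 / (1 + f 0) - 1) * l 0 ^ 2 / 2) / 4)
      (Set.Ici 0) 0 := by
  have h0 := h.self_of_nhds
  have hpos := h0.1
  refine (hasDerivWithinAt_even_part (g' := fun φ => Real.sqrt (f φ) / (1 + f φ) * (l φ / 2))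
    (h.mono fun φ hφ => hφ.arctan_sqrt) (h0.sqrt_div_one_add.mul (hl.div_const 2))).congr_deriv ?_
  field_simp
  ring

/-- The second logarithmic derivatives in the direction of the angle. -/
noncomputable def ratioLog₂ (u c : ℝ) : ℝ := u ^ 2 / 4 * (1 / c ^ 2 - 1 / (2 + 2 * u + c) ^ 2)

lemma hasDerivAt_sinLog : HasDerivAt
    (fun φ : ℝ => 2 * (2 * (Real.cos φ * 1) / (1 + 2 * Real.sin φ))) (-8) 0 := by
  have := ((((Real.hasDerivAt_cos 0).mul_const 1).const_mul 2).div
    (((Real.hasDerivAt_sin 0).const_mul 2).const_add 1) (by simp)).const_mul 2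
  refine this.congr_deriv ?_
  simp
  norm_num

/-- This lemma and the next two supply the initial velocity of `evenPart`, contribution by
contribution. In each, √q/(1 + q) is the same weight as in the first derivative, which lets the
covector cancel the square roots. -/
lemma even_cotSqBase (hu : 0 < u) (hc : 0 < c) :
    HasDerivWithinAt (fun s => (Real.arctan (Real.sqrt (cotSqBase u c (Real.sqrt s))) +
        Real.arctan (Real.sqrt (cotSqBase u c (-Real.sqrt s)))) / 2)
      (Real.sqrt (cotSqBase u c 0) / (1 + cotSqBase u c 0) *
        (ratioLog₂ u c + (2 / (1 + cotSqBase u c 0) - 1) * ratioLog u c 0 0 0 1 ^ 2 / 2) / 4)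
      (Set.Ici 0) 0 := by
  have := hasDerivWithinAt_even_arctan_sqrt (f := fun φ => cotSqBase u c φ)
    (l := fun φ => ratioLog u c φ 0 0 1 + (0 / u - 3 * 0 / (4 + 3 * u)))
    (l₂ := ratioLog₂ u c) ?_ ((hasDerivAt_ratioLog hu hc).add_const _)
  · simpa using this
  · filter_upwards [eventually_regular (u := u) (e := 0) hc (by norm_num) (by linarith)] with φ h
    exact hasLogDeriv_cotSqBase (hasDerivAt_const φ u) (hasDerivAt_const φ c) (hasDerivAt_id φ) hu h.1

lemma even_cotSqSide (hu : 0 < u) (hc : 0 < c) :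
    HasDerivWithinAt (fun s => (Real.arctan (Real.sqrt (cotSqSide u c (Real.sqrt s))) +
        Real.arctan (Real.sqrt (cotSqSide u c (-Real.sqrt s)))) / 2)
      (Real.sqrt (cotSqSide u c 0) / (1 + cotSqSide u c 0) *
        (ratioLog₂ u c + 8 +
          (2 / (1 + cotSqSide u c 0) - 1) * (ratioLog u c 0 0 0 1 - 4) ^ 2 / 2) / 4)
      (Set.Ici 0) 0 := by
  have := hasDerivWithinAt_even_arctan_sqrt (f := fun φ => cotSqSide u c φ)
    (l := fun φ => ratioLog u c φ 0 0 1 + (2 * ((0 + 4 * 0) / (u + 4 * c)) -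
        (0 / u + 3 * 0 / (4 + 3 * u) +
          2 * (2 * (Real.cos φ * 1) / (1 + 2 * Real.sin φ)))))
    (l₂ := ratioLog₂ u c + 8) ?_ ?_
  · convert this using 6
    simp
    norm_num
    ring
  · filter_upwards [eventually_regular (u := u) (e := 0) hc (by norm_num) (by linarith)] with φ h
    exact hasLogDeriv_cotSqSide (hasDerivAt_const φ u) (hasDerivAt_const φ c) (hasDerivAt_id φ) hu
      (by linarith) h.1 h.2.1
  · refine ((hasDerivAt_ratioLog hu hc).add ((hasDerivAt_sinLog.const_add _).const_sub _)).congr_deriv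
      ?_
    rw [ratioLog₂]; ring

lemma even_cotSqLat {e : ℝ} (hu : 0 < u) (hc : 0 < c) (he : 0 < e + 2)
    (hm : 0 < 2 * u + 2 * c - e * u) :
    HasDerivWithinAt (fun s => (Real.arctan (Real.sqrt (cotSqLat e u c (Real.sqrt s))) +
        Real.arctan (Real.sqrt (cotSqLat e u c (-Real.sqrt s)))) / 2)
      (Real.sqrt (cotSqLat e u c 0) / (1 + cotSqLat e u c 0) *
        (ratioLog₂ u c + 8 - 4 / (e + 2) + e * u * (1 / (2 * u + 2 * c - e * u) -
          1 / (4 + (2 * u + 2 * c - e * u))) +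
          (2 / (1 + cotSqLat e u c 0) - 1) * (ratioLog u c 0 0 0 1 - 4) ^ 2 / 2) / 4)
      (Set.Ici 0) 0 := by
  have := hasDerivWithinAt_even_arctan_sqrt (f := fun φ => cotSqLat e u c φ)
    (l := fun φ => ratioLog u c φ 0 0 1 +
        (2 * (2 * (-Real.sin φ * 1) / (e + 2 * Real.cos φ)) -
          2 * (2 * (Real.cos φ * 1) / (1 + 2 * Real.sin φ)) +
        ((2 * 0 + 2 * 0 - (e * 0 * Real.cos φ + e * u * (-Real.sin φ * 1))) /
            (2 * u + 2 * c - e * u * Real.cos φ) -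
          (2 * 0 + 2 * 0 - (e * 0 * Real.cos φ + e * u * (-Real.sin φ * 1))) /
            (4 + (2 * u + 2 * c - e * u * Real.cos φ)))))
    (l₂ := ratioLog₂ u c + 8 - 4 / (e + 2) + e * u * (1 / (2 * u + 2 * c - e * u) -
          1 / (4 + (2 * u + 2 * c - e * u)))) ?_ ?_
  · convert this using 6
    simp
    norm_num
    ring
  · filter_upwards [eventually_regular (u := u) hc he hm] with φ h
    exact hasLogDeriv_cotSqLat (hasDerivAt_const φ u) (hasDerivAt_const φ c) (hasDerivAt_id φ) hu
      h.1 h.2.1 h.2.2.1 h.2.2.2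
  · have hs := Real.hasDerivAt_sin 0
    have hcos := Real.hasDerivAt_cos 0
    have d1 : HasDerivAt (fun φ : ℝ => 2 * (2 * (-Real.sin φ * 1) / (e + 2 * Real.cos φ)))
        (-4 / (e + 2)) 0 := by
      refine ((((hs.neg.mul_const 1).const_mul 2).div ((hcos.const_mul 2).const_add e)
        (by simpa using he.ne')).const_mul 2).congr_deriv ?_
      simp
      field_simp
      norm_num
    have dn : HasDerivAt
        (fun φ : ℝ => 2 * 0 + 2 * 0 - (e * 0 * Real.cos φ + e * u * (-Real.sin φ * 1))) (e * u) 0 := by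
      refine (((hcos.const_mul (e * 0)).add ((hs.neg.mul_const 1).const_mul (e * u))).const_sub
        (2 * 0 + 2 * 0)).congr_deriv ?_
      simp
    have dm : HasDerivAt (fun φ : ℝ => 2 * u + 2 * c - e * u * Real.cos φ) 0 0 := by
      refine ((hcos.const_mul (e * u)).const_sub (2 * u + 2 * c)).congr_deriv ?_
      simp
    have hm4 : 0 < 4 + (2 * u + 2 * c - e * u) := by linarith
    refine ((hasDerivAt_ratioLog hu hc).add ((d1.sub hasDerivAt_sinLog).add
      ((dn.div dm (by simpa using hm.ne')).sub
        (dn.div (dm.const_add 4) (by simpa using hm4.ne'))))).congr_deriv ?_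
    rw [ratioLog₂]
    simp
    field_simp
    ring

end SecondDerivatives

end TwistedOcta

open TwistedOcta
namespace TwistedOcta
open Filter Topology

/-! ### Transversality of the angle map -/

/-- Clears the denominators of a lateral component; this is why the covector contains the factors m
(4 + m). -/
lemma lat_factor {m k r : ℝ} (hm : m ≠ 0) (hm4 : 4 + m ≠ 0) :
    m * (4 + m) * (r + (k / m - k / (4 + m))) = m * (4 + m) * r + 4 * k := by
  field_simp
  ring

section Transversality

variable {u c e : ℝ}

/-- The normal to the image of the plane `φ = 0` under the angle map, in rescaled coordinates,
evaluated at first derivatives. -/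
lemma normal_first {w x y lr : ℝ} (hu : 0 < u) (hc : 0 < c) (he : e ^ 2 = 3)
    (hp : 0 < 2 * u + 2 * c - e * u) (hm : 0 < 2 * u + 2 * c + e * u)
    (hr : lr = (2 * x + y + u * w / 2) / (2 + 2 * u + c) - (y + u * w / 2) / c) :
    -e * (u * (4 + 3 * u)) * (areaForm u c * (lr + (x / u - 3 * x / (4 + 3 * u))) +
      (1 + u) * (u + 4 * c) * (lr + (2 * ((x + 4 * y) / (u + 4 * c)) -
        (x / u + 3 * x / (4 + 3 * u) + 2 * (2 * w))))) +
    (u + 2 * c) * (1 + c + u + e * (1 + u)) *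
      ((2 * u + 2 * c - e * u) * (4 + (2 * u + 2 * c - e * u)) * ((lr - 4 * w) +
        ((2 * x + 2 * y - e * x) / (2 * u + 2 * c - e * u) -
          (2 * x + 2 * y - e * x) / (4 + (2 * u + 2 * c - e * u))))) +
    (u + 2 * c) * (e * (1 + u) - (1 + c + u)) *
      ((2 * u + 2 * c + e * u) * (4 + (2 * u + 2 * c + e * u)) * ((lr - 4 * w) +
        ((2 * x + 2 * y + e * x) / (2 * u + 2 * c + e * u) -
          (2 * x + 2 * y + e * x) / (4 + (2 * u + 2 * c + e * u))))) =
    -8 * e * areaForm u c * (u + 2 * c) * w := by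
  -- The quadratic form is kept as one atom while denominators are cleared and is expanded only for
  -- the final polynomial identity modulo e² = 3.
  obtain ⟨Q, hQ⟩ : ∃ Q, Q = areaForm u c := ⟨_, rfl⟩
  rw [← hQ]
  rw [areaForm] at hQ
  rw [lat_factor hp.ne' (by linarith), lat_factor hm.ne' (by linarith)]
  have h1 : u * (4 + 3 * u) * (lr + (x / u - 3 * x / (4 + 3 * u))) =
      u * (4 + 3 * u) * lr + 4 * x := by field_simp; ring
  have h2 : u * (4 + 3 * u) * (u + 4 * c) * (lr + (2 * ((x + 4 * y) / (u + 4 * c)) -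
      (x / u + 3 * x / (4 + 3 * u) + 2 * (2 * w)))) =
      u * (4 + 3 * u) * (u + 4 * c) * (lr - 4 * w) + 2 * (x + 4 * y) * (u * (4 + 3 * u)) -
        (4 + 6 * u) * (u + 4 * c) * x := by field_simp; ring
  have hr' : c * (2 + 2 * u + c) * lr =
      c * (2 * x + y + u * w / 2) - (2 + 2 * u + c) * (y + u * w / 2) := by
    rw [hr]; field_simp
  have hW : c * (2 + 2 * u + c) ≠ 0 := by positivity
  have h3 : -e * (u * (4 + 3 * u)) * (Q * (lr + (x / u - 3 * x / (4 + 3 * u))) +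
      (1 + u) * (u + 4 * c) * (lr + (2 * ((x + 4 * y) / (u + 4 * c)) -
        (x / u + 3 * x / (4 + 3 * u) + 2 * (2 * w))))) =
      -e * (Q * (u * (4 + 3 * u) * lr + 4 * x) + (1 + u) * (u * (4 + 3 * u) * (u + 4 * c) *
        (lr - 4 * w) + 2 * (x + 4 * y) * (u * (4 + 3 * u)) - (4 + 6 * u) * (u + 4 * c) * x)) := by
    rw [← h1, ← h2]; ring
  rw [h3]
  refine mul_left_cancel₀ hW ?_
  clear h1 h2 h3 hr
  subst hQ
  grind

/-- The normal to the image of the plane `φ = 0` under the angle map, in rescaled coordinates,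
evaluated at the second derivative in the direction of `φ`. -/
lemma normal_second {L1 L2 tB tS tP tM : ℝ} (hu : 0 < u) (hc : 0 < c) (he : e ^ 2 = 3)
    (hp : 0 < 2 * u + 2 * c - e * u) (hm : 0 < 2 * u + 2 * c + e * u)
    (h1 : L1 = -(u * (1 + u) / (c * (2 + 2 * u + c))))
    (h2 : L2 = u ^ 2 / 4 * (1 / c ^ 2 - 1 / (2 + 2 * u + c) ^ 2))
    (hB : tB = c * (4 + 3 * u) / ((1 + u) * (u + 2 * c)) - 1)
    (hS : tS = c * u * (4 + 3 * u) / ((u + 2 * c) * areaForm u c) - 1)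
    (hP : tP = c * (2 - e) * (4 + (2 * u + 2 * c - e * u)) / areaForm u c - 1)
    (hM : tM = c * (2 + e) * (4 + (2 * u + 2 * c + e * u)) / areaForm u c - 1) :
    -e * (u * (4 + 3 * u)) * (areaForm u c * (L2 + tB * L1 ^ 2 / 2) +
      (1 + u) * (u + 4 * c) * (L2 + 8 + tS * (L1 - 4) ^ 2 / 2)) +
    (u + 2 * c) * (1 + c + u + e * (1 + u)) *
      ((2 * u + 2 * c - e * u) * (4 + (2 * u + 2 * c - e * u)) *
        ((L2 + 8 - 4 * (2 - e) + tP * (L1 - 4) ^ 2 / 2) +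
          (e * u / (2 * u + 2 * c - e * u) - e * u / (4 + (2 * u + 2 * c - e * u))))) +
    (u + 2 * c) * (e * (1 + u) - (1 + c + u)) *
      ((2 * u + 2 * c + e * u) * (4 + (2 * u + 2 * c + e * u)) *
        ((L2 + 8 - 4 * (2 + e) + tM * (L1 - 4) ^ 2 / 2) +
          (-e * u / (2 * u + 2 * c + e * u) - -e * u / (4 + (2 * u + 2 * c + e * u))))) =
    -2 * e * areaForm u c * (u + 2 * c) * u * (2 + u) * (1 + u + c) / (c * (2 + 2 * u + c)) := by
  obtain ⟨Q, hQ⟩ : ∃ Q, Q = areaForm u c := ⟨_, rfl⟩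
  rw [← hQ] at hS hP hM ⊢
  rw [areaForm] at hQ
  rw [lat_factor hp.ne' (by linarith), lat_factor hm.ne' (by linarith)]
  have hQ0 : 0 < Q := by rw [hQ]; positivity
  clear hp hm
  subst h1 h2 hB hS hP hM
  field_simp
  subst hQ
  set_option maxRecDepth 100000 in
  grind

/-- The two lateral components alone determine the horizontal direction: the 2 × 2 determinant of
the system is a nonzero multiple of `areaForm`. Together with the normal covector this gives
injectivity of the derivative. -/
lemma eq_zero_of_lateral_eq_zero {x y lr : ℝ} (hu : 0 < u) (hc : 0 < c) (he : e ^ 2 = 3)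
    (hr : lr = (2 * x + y) / (2 + 2 * u + c) - y / c)
    (h1 : (2 * u + 2 * c - e * u) * (4 + (2 * u + 2 * c - e * u)) * lr +
      4 * (2 * x + 2 * y - e * x) = 0)
    (h2 : (2 * u + 2 * c + e * u) * (4 + (2 * u + 2 * c + e * u)) * lr +
      4 * (2 * x + 2 * y + e * x) = 0) : x = 0 ∧ y = 0 := by
  have he0 : e ≠ 0 := by rintro rfl; norm_num at he
  have hr' : c * (2 + 2 * u + c) * lr = 2 * c * x - (2 + 2 * u) * y := by
    rw [hr]; field_simp; ring
  have hW : 0 < c * (2 + 2 * u + c) := by positivity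
  obtain ⟨Mp, hMp⟩ : ∃ M, M = (2 * u + 2 * c - e * u) * (4 + (2 * u + 2 * c - e * u)) := ⟨_, rfl⟩
  obtain ⟨Mm, hMm⟩ : ∃ M, M = (2 * u + 2 * c + e * u) * (4 + (2 * u + 2 * c + e * u)) := ⟨_, rfl⟩
  rw [← hMp] at h1
  rw [← hMm] at h2
  have a1 : Mp * (2 * c * x - (2 + 2 * u) * y) +
      4 * (c * (2 + 2 * u + c)) * ((2 - e) * x + 2 * y) = 0 := by
    rw [← hr']; linear_combination (c * (2 + 2 * u + c)) * h1
  have a2 : Mm * (2 * c * x - (2 + 2 * u) * y) +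
      4 * (c * (2 + 2 * u + c)) * ((2 + e) * x + 2 * y) = 0 := by
    rw [← hr']; linear_combination (c * (2 + 2 * u + c)) * h2
  -- The determinant of the system a1, a2 in the unknowns x, y, used below through Cramer's rule.
  have hdet : (2 * c * Mp + 4 * (c * (2 + 2 * u + c)) * (2 - e)) *
        (-(2 + 2 * u) * Mm + 8 * (c * (2 + 2 * u + c))) -
      (2 * c * Mm + 4 * (c * (2 + 2 * u + c)) * (2 + e)) *
        (-(2 + 2 * u) * Mp + 8 * (c * (2 + 2 * u + c))) =
      -16 * e * u * areaForm u c * (c * (2 + 2 * u + c)) := by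
    rw [hMp, hMm, areaForm]
    clear a1 a2 h1 h2 hMp hMm hr hr' hW he0
    grind
  have hQ : 0 < areaForm u c := by rw [areaForm]; positivity
  have hne : -16 * e * u * areaForm u c * (c * (2 + 2 * u + c)) ≠ 0 := by
    have := hu.ne'; have := hQ.ne'; have := hW.ne'
    simp_all
  constructor
  · refine (mul_eq_zero.1 (?_ : (-16 * e * u * areaForm u c * (c * (2 + 2 * u + c))) * x = 0)
      ).resolve_left hne
    rw [← hdet]
    linear_combination (-(2 + 2 * u) * Mm + 8 * (c * (2 + 2 * u + c))) * a1 -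
      (-(2 + 2 * u) * Mp + 8 * (c * (2 + 2 * u + c))) * a2
  · refine (mul_eq_zero.1 (?_ : (-16 * e * u * areaForm u c * (c * (2 + 2 * u + c))) * y = 0)
      ).resolve_left hne
    rw [← hdet]
    linear_combination (2 * c * Mp + 4 * (c * (2 + 2 * u + c)) * (2 - e)) * a2 -
      (2 * c * Mm + 4 * (c * (2 + 2 * u + c)) * (2 + e)) * a1

end Transversality

lemma sqrt_three_bounds : 0 < Real.sqrt 3 ∧ Real.sqrt 3 < 2 ∧ Real.sqrt 3 ^ 2 = 3 :=
  ⟨by positivity, by rw [Real.sqrt_lt' (by norm_num)]; norm_num, Real.sq_sqrt (by norm_num)⟩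

/-- The weight with which logarithmic derivatives enter the derivative of the angles. -/
noncomputable def weight (q : ℝ) : ℝ := Real.sqrt q / (1 + q)

lemma weight_pos {q : ℝ} (hq : 0 < q) : 0 < weight q := by
  have := Real.sqrt_pos.2 hq
  unfold weight
  positivity

/-! ### The derivative of the angle map -/

section AtZero

variable {u c : ℝ}

lemma cotSqBase_zero_pos (hu : 0 < u) (hc : 0 < c) : 0 < cotSqBase u c 0 := by
  rw [cotSqBase_zero hc]; positivity

lemma cotSqSide_zero_pos (hu : 0 < u) (hc : 0 < c) : 0 < cotSqSide u c 0 := by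
  rw [cotSqSide_zero hc]; positivity

lemma cotSqLat_zero_pos {e : ℝ} (hu : 0 < u) (hc : 0 < c) (he : 0 < e + 2)
    (hm : 0 < 2 * u + 2 * c - e * u) : 0 < cotSqLat e u c 0 := by
  rw [cotSqLat_zero hc]; positivity

/-- The weights of the two cotangents at a base edge are proportional. -/
lemma exists_weight_factor (hu : 0 < u) (hc : 0 < c) : ∃ ω, 0 < ω ∧
    weight (cotSqBase u c 0) = ω * areaForm u c ∧
    weight (cotSqSide u c 0) = ω * ((1 + u) * (u + 4 * c)) := by
  have hQ : 0 < areaForm u c := by rw [areaForm]; positivity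
  have h0 := weight_pos (cotSqBase_zero_pos hu hc)
  refine ⟨weight (cotSqBase u c 0) / areaForm u c, div_pos h0 hQ, by field_simp, ?_⟩
  -- At φ = 0 the two squared cotangents differ by the square of a rational function, so the ratio
  -- of the weights contains no square root.
  have hs : Real.sqrt (cotSqSide u c 0) = Real.sqrt (cotSqBase u c 0) * ((u + 4 * c) / u) := by
    have : cotSqSide u c 0 = cotSqBase u c 0 * ((u + 4 * c) / u) ^ 2 := by
      rw [cotSqSide_zero hc, cotSqBase_zero hc]
      field_simp
    rw [this, Real.sqrt_mul (cotSqBase_zero_pos hu hc).le, Real.sqrt_sq (by positivity)]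
  rw [weight, weight, hs, one_add_cotSqBase_zero hu hc, one_add_cotSqSide_zero hu hc]
  field_simp
  ring

lemma hasStrictFDerivAt_angleMap (hu : 0 < u) (hc : 0 < c) :
    HasStrictFDerivAt angleMap (fderiv ℝ angleMap (u, c, 0)) (u, c, 0) := by
  have h3 := sqrt_three_bounds
  have hm : 0 < 2 * u + 2 * c - Real.sqrt 3 * u := by nlinarith
  have hp : 0 < 2 * u + 2 * c - -Real.sqrt 3 * u := by nlinarith
  have hh : ContDiff ℝ 1 fun x : ℝ × ℝ × ℝ => heightSq x.1 x.2.1 x.2.2 := by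
    unfold heightSq
    have := Real.contDiff_sin (n := 1)
    fun_prop
  have hsin : ContDiff ℝ 1 fun x : ℝ × ℝ × ℝ => 1 + 2 * Real.sin x.2.2 := by
    have := Real.contDiff_sin (n := 1)
    fun_prop
  have hcos : ContDiff ℝ 1 fun x : ℝ × ℝ × ℝ => Real.cos x.2.2 := by
    have := Real.contDiff_cos (n := 1)
    fun_prop
  have hr : ContDiffAt ℝ 1 (fun x : ℝ × ℝ × ℝ => ratioSq x.1 x.2.1 x.2.2) (u, c, 0) := by
    unfold ratioSq
    refine ContDiffAt.div (ContDiffAt.add (by fun_prop) hh.contDiffAt) hh.contDiffAt ?_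
    simp only [heightSq_zero]
    positivity
  have hb : ContDiffAt ℝ 1 (fun x : ℝ × ℝ × ℝ => cotSqBase x.1 x.2.1 x.2.2) (u, c, 0) := by
    unfold cotSqBase
    refine hr.mul (ContDiffAt.div (by fun_prop) (by fun_prop) ?_)
    positivity
  have hs : ContDiffAt ℝ 1 (fun x : ℝ × ℝ × ℝ => cotSqSide x.1 x.2.1 x.2.2) (u, c, 0) := by
    unfold cotSqSide
    refine hr.mul (ContDiffAt.div (by fun_prop)
      (ContDiffAt.mul (by fun_prop) (hsin.contDiffAt.pow 2)) ?_)
    simp only [Real.sin_zero]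
    positivity
  have hl : ∀ e : ℝ, 0 < 2 * u + 2 * c - e * u →
      ContDiffAt ℝ 1 (fun x : ℝ × ℝ × ℝ => cotSqLat e x.1 x.2.1 x.2.2) (u, c, 0) := by
    intro e he
    unfold cotSqLat
    have hmm : ContDiffAt ℝ 1 (fun x : ℝ × ℝ × ℝ =>
        2 * x.1 + 2 * x.2.1 - e * x.1 * Real.cos x.2.2) (u, c, 0) :=
      ContDiffAt.sub (by fun_prop) (ContDiffAt.mul (by fun_prop) hcos.contDiffAt)
    refine hr.mul (ContDiffAt.mul (ContDiffAt.div ?_ (hsin.contDiffAt.pow 2) ?_)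
      (hmm.div (contDiffAt_const.add hmm) ?_))
    · exact (contDiffAt_const.add (contDiffAt_const.mul hcos.contDiffAt)).pow 2
    · simp
    · simp only [Real.cos_zero, mul_one]
      positivity
  have hat : ∀ {f : ℝ × ℝ × ℝ → ℝ}, ContDiffAt ℝ 1 f (u, c, 0) → 0 < f (u, c, 0) →
      ContDiffAt ℝ 1 (fun x => Real.arctan (Real.sqrt (f x))) (u, c, 0) :=
    fun hf h0 => (hf.sqrt h0.ne').arctan
  have : ContDiffAt ℝ 1 angleMap (u, c, 0) :=
    ((hat hb (cotSqBase_zero_pos hu hc)).add (hat hs (cotSqSide_zero_pos hu hc))).prodMk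
      ((hat (hl _ hm) (cotSqLat_zero_pos hu hc (by linarith) hm)).prodMk
        (hat (hl _ hp) (cotSqLat_zero_pos hu hc (by linarith) hp)))
  exact this.hasStrictFDerivAt (by norm_num)

/-- The directional derivatives of the angle map. -/
lemma fderiv_angleMap (hu : 0 < u) (hc : 0 < c) (x y w : ℝ) :
    fderiv ℝ angleMap (u, c, 0) (x, y, w) =
      (weight (cotSqBase u c 0) *
          ((ratioLog u c 0 x y w + (x / u - 3 * x / (4 + 3 * u))) / 2) +
        weight (cotSqSide u c 0) *
          ((ratioLog u c 0 x y w + (2 * ((x + 4 * y) / (u + 4 * c)) -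
            (x / u + 3 * x / (4 + 3 * u) + 2 * (2 * w)))) / 2),
      weight (cotSqLat (Real.sqrt 3) u c 0) * (((ratioLog u c 0 x y w - 4 * w) +
        ((2 * x + 2 * y - Real.sqrt 3 * x) / (2 * u + 2 * c - Real.sqrt 3 * u) -
          (2 * x + 2 * y - Real.sqrt 3 * x) / (4 + (2 * u + 2 * c - Real.sqrt 3 * u)))) / 2),
      weight (cotSqLat (-Real.sqrt 3) u c 0) * (((ratioLog u c 0 x y w - 4 * w) +
        ((2 * x + 2 * y + Real.sqrt 3 * x) / (2 * u + 2 * c + Real.sqrt 3 * u) -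
          (2 * x + 2 * y + Real.sqrt 3 * x) / (4 + (2 * u + 2 * c + Real.sqrt 3 * u)))) / 2)) := by
  have h3 := sqrt_three_bounds
  have hm : 0 < 2 * u + 2 * c - Real.sqrt 3 * u := by nlinarith
  have hp : 0 < 2 * u + 2 * c - -Real.sqrt 3 * u := by nlinarith
  have du : HasDerivAt (fun t : ℝ => u + t * x) x 0 := by
    simpa using ((hasDerivAt_id (0 : ℝ)).mul_const x).const_add u
  have dc : HasDerivAt (fun t : ℝ => c + t * y) y 0 := by
    simpa using ((hasDerivAt_id (0 : ℝ)).mul_const y).const_add c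
  have dφ : HasDerivAt (fun t : ℝ => t * w) w 0 := by
    simpa using (hasDerivAt_id (0 : ℝ)).mul_const w
  have d : HasDerivAt (fun t : ℝ => (u + t * x, c + t * y, t * w)) (x, y, w) 0 :=
    du.prodMk (dc.prodMk dφ)
  have h1 : HasDerivAt (fun t : ℝ => angleMap (u + t * x, c + t * y, t * w))
      (fderiv ℝ angleMap (u, c, 0) (x, y, w)) 0 := by
    have h := (hasStrictFDerivAt_angleMap hu hc).hasFDerivAt
    have e0 : (u, c, (0 : ℝ)) = (u + 0 * x, c + 0 * y, 0 * w) := by simp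
    rw [e0] at h
    have := h.comp_hasDerivAt (0 : ℝ) d
    rwa [← e0] at this
  have hZ : 0 < heightSq (u + 0 * x) (c + 0 * y) (0 * w) := by
    simp only [zero_mul, add_zero, heightSq_zero]; positivity
  have hB := (hasLogDeriv_cotSqBase du dc dφ (by simpa) hZ).arctan_sqrt
  have hS := (hasLogDeriv_cotSqSide du dc dφ (by simpa) (by simp; positivity) hZ
    (by simp)).arctan_sqrt
  have hP := (hasLogDeriv_cotSqLat (e := Real.sqrt 3) du dc dφ (by simpa) hZ (by simp)
    (by simp; linarith) (by simpa using hm)).arctan_sqrt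
  have hM := (hasLogDeriv_cotSqLat (e := -Real.sqrt 3) du dc dφ (by simpa) hZ (by simp)
    (by simp; linarith) (by simpa using hp)).arctan_sqrt
  have h2 := (hB.add hS).prodMk (hP.prodMk hM)
  rw [h1.unique h2]
  simp only [weight, zero_mul, add_zero, Real.sin_zero, Real.cos_zero, mul_zero, neg_zero, mul_one,
    div_one, one_mul, zero_div, zero_sub, neg_mul, sub_neg_eq_add]
  refine Prod.ext rfl (Prod.ext ?_ ?_)
  · simp only
    ring
  · simp only
    ring

end AtZero

end TwistedOcta

open TwistedOcta
namespace TwistedOcta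
open Filter Topology

/-! ### Solving the equation between cone angles -/

section Coincidence

variable {u c : ℝ}

/-- The even part of the angle map along the line in the direction of `φ`, as a function of the
square of the parameter. -/
noncomputable def evenPart (u c s : ℝ) : ℝ × ℝ × ℝ :=
  ((Real.arctan (Real.sqrt (cotSqBase u c (Real.sqrt s))) +
        Real.arctan (Real.sqrt (cotSqBase u c (-Real.sqrt s)))) / 2 +
      (Real.arctan (Real.sqrt (cotSqSide u c (Real.sqrt s))) +
        Real.arctan (Real.sqrt (cotSqSide u c (-Real.sqrt s)))) / 2,
    (Real.arctan (Real.sqrt (cotSqLat (Real.sqrt 3) u c (Real.sqrt s))) +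
        Real.arctan (Real.sqrt (cotSqLat (Real.sqrt 3) u c (-Real.sqrt s)))) / 2,
    (Real.arctan (Real.sqrt (cotSqLat (-Real.sqrt 3) u c (Real.sqrt s))) +
        Real.arctan (Real.sqrt (cotSqLat (-Real.sqrt 3) u c (-Real.sqrt s)))) / 2)

lemma two_smul_evenPart (s : ℝ) : (2 : ℝ) • evenPart u c s =
    angleMap (u, c, Real.sqrt s) + angleMap (u, c, -Real.sqrt s) := by
  refine Prod.ext ?_ (Prod.ext ?_ ?_)
  all_goals
    simp only [evenPart, angleMap, Prod.smul_fst, Prod.smul_snd, Prod.fst_add, Prod.snd_add,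
      smul_eq_mul]
    ring

lemma evenPart_zero : evenPart u c 0 = angleMap (u, c, 0) := by
  refine Prod.ext ?_ (Prod.ext ?_ ?_)
  all_goals
    simp only [evenPart, angleMap, Real.sqrt_zero, neg_zero]
    ring

/-- A linear form that vanishes on the image of the horizontal plane, up to the choice of weights
`ω, h₁, h₂`. -/
noncomputable def normalForm (u c ω h₁ h₂ : ℝ) (V : ℝ × ℝ × ℝ) : ℝ :=
  -Real.sqrt 3 * (u * (4 + 3 * u)) * (2 * V.1 / ω) +
    (u + 2 * c) * (1 + c + u + Real.sqrt 3 * (1 + u)) *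
      ((2 * u + 2 * c - Real.sqrt 3 * u) * (4 + (2 * u + 2 * c - Real.sqrt 3 * u)) *
        (2 * V.2.1 / h₁)) +
    (u + 2 * c) * (Real.sqrt 3 * (1 + u) - (1 + c + u)) *
      ((2 * u + 2 * c + Real.sqrt 3 * u) * (4 + (2 * u + 2 * c + Real.sqrt 3 * u)) *
        (2 * V.2.2 / h₂))

lemma two_mul_weight_div {ω a b x y : ℝ} (hω : 0 < ω) :
    2 * (ω * a * (x / 2) + ω * b * (y / 2)) / ω = a * x + b * y := by
  field_simp

lemma two_div_mul_div {e Q c X : ℝ} (he : e ^ 2 = 3) (h0 : 0 < 2 + e) (hQ : 0 < Q) :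
    2 / (2 * (2 + e) * Q / (c * X)) = c * (2 - e) * X / Q := by
  rw [div_div_eq_mul_div, div_eq_div_iff (by positivity) hQ.ne']
  linear_combination (-2 * c * X * Q) * (-1) * he

lemma two_mul_half_div {h x : ℝ} (hh : 0 < h) : 2 * (h * (x / 2)) / h = x := by
  field_simp

/-- Transversality applied to `evenPart`: its velocity E_φφ/2 at s = 0 is not tangent to the image
of the plane φ = 0, so the solution x leaves that plane for small s = φ² > 0. -/
lemma exists_even_coincidence (hu : 0 < u) (hc : 0 < c) {V : Set (ℝ × ℝ × ℝ)}
    (hV : V ∈ 𝓝 (u, c, (0 : ℝ))) :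
    ∃ φ : ℝ, 0 < φ ∧ (u, c, φ) ∈ V ∧ ∃ x ∈ V, x.2.2 ≠ 0 ∧
      (2 : ℝ) • angleMap x = angleMap (u, c, φ) + angleMap (u, c, -φ) := by
  obtain ⟨hs0, hs2, hs3⟩ := sqrt_three_bounds
  have hm : 0 < 2 * u + 2 * c - Real.sqrt 3 * u := by nlinarith
  have hp : 0 < 2 * u + 2 * c + Real.sqrt 3 * u := by nlinarith
  have hp' : 0 < 2 * u + 2 * c - -Real.sqrt 3 * u := by linarith
  have hQ : 0 < areaForm u c := by rw [areaForm]; positivity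
  obtain ⟨ω, hω, hωB, hωS⟩ := exists_weight_factor hu hc
  have hh₁ := weight_pos (cotSqLat_zero_pos (e := Real.sqrt 3) hu hc (by linarith) hm)
  have hh₂ := weight_pos (cotSqLat_zero_pos (e := -Real.sqrt 3) hu hc (by linarith) hp')
  set h₁ := weight (cotSqLat (Real.sqrt 3) u c 0) with hh₁d
  set h₂ := weight (cotSqLat (-Real.sqrt 3) u c 0) with hh₂d
  set κ := normalForm u c ω h₁ h₂ with hκ
  set E' := fderiv ℝ angleMap (u, c, 0) with hE'
  -- κ composed with the derivative of the angle map sees only the component w, so κ is a conormal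
  -- of the image of the horizontal plane. Dividing by the weights has made its coefficients
  -- polynomial.
  have key : ∀ x y w, κ (E' (x, y, w)) =
      -8 * Real.sqrt 3 * areaForm u c * (u + 2 * c) * w := by
    intro x y w
    rw [hE', fderiv_angleMap hu hc, hκ, normalForm, hωB, hωS]
    simp only
    rw [two_mul_weight_div hω, ← hh₁d, ← hh₂d, two_mul_half_div hh₁, two_mul_half_div hh₂]
    exact normal_first hu hc hs3 hm hp (ratioLog_zero hu hc x y w)
  have hκ0 : κ 0 = 0 := by simp [hκ, normalForm]
  have hcoef : -8 * Real.sqrt 3 * areaForm u c * (u + 2 * c) ≠ 0 := by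
    have : 0 < Real.sqrt 3 * areaForm u c * (u + 2 * c) := by positivity
    linarith
  have hinj : Function.Injective E' := by
    refine (injective_iff_map_eq_zero E').2 ?_
    rintro ⟨x, y, w⟩ h
    -- κ detects w; afterwards the lateral components detect x and y.
    have hw : w = 0 := by
      have := key x y w
      rw [h, hκ0] at this
      exact (mul_eq_zero.1 this.symm).resolve_left hcoef
    subst hw
    rw [hE', fderiv_angleMap hu hc, Prod.mk_eq_zero, Prod.mk_eq_zero] at h
    obtain ⟨-, h1, h2⟩ := h
    have h1' := (mul_eq_zero.1 h1).resolve_left hh₁.ne'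
    have h2' := (mul_eq_zero.1 h2).resolve_left hh₂.ne'
    have hr := ratioLog_zero hu hc x y 0
    simp only [mul_zero, zero_div, add_zero] at hr
    have e1 := lat_factor (k := 2 * x + 2 * y - Real.sqrt 3 * x) (r := ratioLog u c 0 x y 0)
      hm.ne' (by linarith)
    have e2 := lat_factor (k := 2 * x + 2 * y + Real.sqrt 3 * x) (r := ratioLog u c 0 x y 0)
      hp.ne' (by linarith)
    obtain ⟨rfl, rfl⟩ := eq_zero_of_lateral_eq_zero hu hc hs3 hr
      (by linear_combination -e1 + 2 * ((2 * u + 2 * c - Real.sqrt 3 * u) *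
        (4 + (2 * u + 2 * c - Real.sqrt 3 * u))) * h1')
      (by linear_combination -e2 + 2 * ((2 * u + 2 * c + Real.sqrt 3 * u) *
        (4 + (2 * u + 2 * c + Real.sqrt 3 * u))) * h2')
    rfl
  have hB := even_cotSqBase hu hc
  have hS := even_cotSqSide hu hc
  have hP := even_cotSqLat (e := Real.sqrt 3) hu hc (by linarith) hm
  have hM := even_cotSqLat (e := -Real.sqrt 3) hu hc (by linarith) hp'
  have hF := (hB.add hS).prodMk (hP.prodMk hM)
  have hev := eventually_exists_eq_of_transversal (F := evenPart u c)
    (hasStrictFDerivAt_angleMap hu hc) hinj evenPart_zero hF ?_ hV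
  · have hφV : ∀ᶠ s in 𝓝[>] (0 : ℝ), (u, c, Real.sqrt s) ∈ V := by
      have : Tendsto (fun s : ℝ => (u, c, Real.sqrt s)) (𝓝[>] 0) (𝓝 (u, c, 0)) := by
        have hcont : Continuous fun s : ℝ => (u, c, Real.sqrt s) := by fun_prop
        have := (hcont.tendsto 0).mono_left (nhdsWithin_le_nhds (s := Set.Ioi 0))
        rwa [Real.sqrt_zero] at this
      exact this hV
    have hpos : ∀ᶠ s in 𝓝[>] (0 : ℝ), 0 < s := eventually_mem_nhdsWithin
    obtain ⟨s, ⟨x, hxV, hxF, hx0⟩, hs, hs'⟩ := (hev.and (hφV.and hpos)).exists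
    exact ⟨Real.sqrt s, Real.sqrt_pos.2 hs', hs, x, hxV, hx0, by
      rw [hxF, two_smul_evenPart]⟩
  -- If w were 0, κ would vanish on the velocity of `evenPart`; but twice its value there is the
  -- negative number computed in `normal_second`.
  · rintro ⟨x, y, w⟩ hx hw
    have hk := key x y w
    rw [show E' (x, y, w) = _ from hx, show w = 0 from hw, mul_zero] at hk
    have hL1 : ratioLog u c 0 0 0 1 = -(u * (1 + u) / (c * (2 + 2 * u + c))) := by
      rw [ratioLog_zero hu hc]; field_simp; ring
    have hnorm := normal_second (L1 := ratioLog u c 0 0 0 1) (L2 := ratioLog₂ u c)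
      (tB := 2 / (1 + cotSqBase u c 0) - 1) (tS := 2 / (1 + cotSqSide u c 0) - 1)
      (tP := 2 / (1 + cotSqLat (Real.sqrt 3) u c 0) - 1)
      (tM := 2 / (1 + cotSqLat (-Real.sqrt 3) u c 0) - 1) hu hc hs3 hm hp hL1 rfl
      (by rw [one_add_cotSqBase_zero hu hc]; field_simp; ring)
      (by rw [one_add_cotSqSide_zero hu hc]; field_simp)
      (by
        rw [one_add_cotSqLat_zero hs3 hc hm]
        rw [two_div_mul_div hs3 (by linarith) hQ])
      (by
        rw [one_add_cotSqLat_zero (by rw [neg_sq]; exact hs3) hc hp']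
        rw [two_div_mul_div (by rw [neg_sq]; exact hs3) (by linarith) hQ]
        ring)
    have hneg : -2 * Real.sqrt 3 * areaForm u c * (u + 2 * c) * u * (2 + u) * (1 + u + c) /
        (c * (2 + 2 * u + c)) < 0 := by
      have : 0 < 2 * Real.sqrt 3 * areaForm u c * (u + 2 * c) * u * (2 + u) * (1 + u + c) /
        (c * (2 + 2 * u + c)) := by positivity
      rw [show -2 * Real.sqrt 3 * areaForm u c * (u + 2 * c) * u * (2 + u) * (1 + u + c) /
        (c * (2 + 2 * u + c)) = -(2 * Real.sqrt 3 * areaForm u c * (u + 2 * c) * u * (2 + u) *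
          (1 + u + c) / (c * (2 + 2 * u + c))) by ring]
      linarith
    rw [← hnorm] at hneg
    refine hneg.ne ?_
    rw [hκ, normalForm] at hk
    simp only at hk
    rw [show Real.sqrt (cotSqBase u c 0) / (1 + cotSqBase u c 0) = ω * areaForm u c from hωB,
      show Real.sqrt (cotSqSide u c 0) / (1 + cotSqSide u c 0) = ω * ((1 + u) * (u + 4 * c)) from hωS,
      show Real.sqrt (cotSqLat (Real.sqrt 3) u c 0) / (1 + cotSqLat (Real.sqrt 3) u c 0) = h₁ from rfl,
      show Real.sqrt (cotSqLat (-Real.sqrt 3) u c 0) / (1 + cotSqLat (-Real.sqrt 3) u c 0) = h₂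
        from rfl] at hk
    have quarter : ∀ {h x : ℝ}, 0 < h → 2 * (h * x / 4) / h = x / 2 := by
      intro h x hh; field_simp; ring
    have quarter' : ∀ {a b x y : ℝ}, 2 * (ω * a * x / 4 + ω * b * y / 4) / ω =
        (a * x + b * y) / 2 := by
      intro a b x y; field_simp; ring
    rw [quarter', quarter hh₁, quarter hh₂] at hk
    have d1 : 4 / (Real.sqrt 3 + 2) = 4 * (2 - Real.sqrt 3) := by
      rw [div_eq_iff (by linarith)]; linear_combination 4 * hs3
    have d2 : 4 / (-Real.sqrt 3 + 2) = 4 * (2 + Real.sqrt 3) := by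
      rw [div_eq_iff (by linarith)]; linear_combination 4 * hs3
    rw [d1, d2, show 2 * u + 2 * c - -Real.sqrt 3 * u = 2 * u + 2 * c + Real.sqrt 3 * u by ring] at hk
    linear_combination 2 * hk

end Coincidence

end TwistedOcta

open TwistedOcta
namespace TwistedOcta

/-! ### Symmetric octahedra -/

lemma rot_eq (x : Mink) : rot x =
    ![x 0, -(1 / 2) * x 1 - Real.sqrt 3 / 2 * x 2, Real.sqrt 3 / 2 * x 1 - 1 / 2 * x 2, x 3] := by
  have h : 2 * Real.pi / 3 = Real.pi - Real.pi / 3 := by ring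
  rw [rot, h, Real.cos_pi_sub, Real.sin_pi_sub, Real.cos_pi_div_three, Real.sin_pi_div_three]
  ext i
  fin_cases i
  · simp
  · simp
  · simp; ring
  · simp

/-- The symmetric octahedron with a given first vertex. -/
noncomputable def octaOf (x : Mink) (v : Vert) : Mink :=
  (![id, rot, rot ∘ rot] v.2) (![id, halfTurn] v.1 x)

lemma IsSymmetric.eq_octaOf {q : Vert → Mink} (hq : IsSymmetric q) : q = octaOf (q (0, 0)) := by
  obtain ⟨h1, h2⟩ := hq
  have key : ∀ l, q (l, 1) = rot (q (l, 0)) ∧ q (l, 2) = rot (rot (q (l, 0))) := by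
    intro l
    have a := h1 l 0
    have b := h1 l 1
    rw [zero_add] at a
    rw [show (1 : Fin 3) + 1 = 2 from rfl, a] at b
    exact ⟨a, b⟩
  have h3 : q (1, 0) = halfTurn (q (0, 0)) := h2 0 0
  funext ⟨l, k⟩
  fin_cases l <;> fin_cases k <;> simp [octaOf, key, h3]

lemma octaOf_eq (x : Mink) :
    octaOf x (0, 0) = x ∧
    octaOf x (0, 1) = ![x 0, -(1 / 2) * x 1 - Real.sqrt 3 / 2 * x 2,
      Real.sqrt 3 / 2 * x 1 - 1 / 2 * x 2, x 3] ∧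
    octaOf x (0, 2) = ![x 0, -(1 / 2) * x 1 + Real.sqrt 3 / 2 * x 2,
      -(Real.sqrt 3 / 2) * x 1 - 1 / 2 * x 2, x 3] ∧
    octaOf x (1, 0) = ![x 0, x 2, x 1, -x 3] ∧
    octaOf x (1, 1) = ![x 0, -(1 / 2) * x 2 - Real.sqrt 3 / 2 * x 1,
      Real.sqrt 3 / 2 * x 2 - 1 / 2 * x 1, -x 3] ∧
    octaOf x (1, 2) = ![x 0, -(1 / 2) * x 2 + Real.sqrt 3 / 2 * x 1,
      -(Real.sqrt 3 / 2) * x 2 - 1 / 2 * x 1, -x 3] := by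
  have hs3 := sqrt_three_bounds.2.2
  refine ⟨rfl, ?_, ?_, rfl, ?_, ?_⟩ <;> ext i <;> fin_cases i <;>
    simp [octaOf, rot_eq, halfTurn] <;> grind

/-- Symmetric octahedra in terms of the parameters `u`, `c`, `φ`: the squared distance of the
vertices from the axis, the height, and the deviation of the angle of twist from `π / 2`. -/
structure IsOcta (p : Vert → Mink) (u c φ : ℝ) : Prop where
  symm : IsSymmetric p
  mem : p (0, 0) ∈ Hyp
  neg : p (0, 0) 3 < 0
  radius : p (0, 0) 1 ^ 2 + p (0, 0) 2 ^ 2 = u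
  height : 2 * p (0, 0) 3 ^ 2 + p (0, 0) 1 * p (0, 0) 2 = c
  cos : p (0, 0) 1 ^ 2 - p (0, 0) 2 ^ 2 = u * Real.cos φ
  sin : -2 * (p (0, 0) 1 * p (0, 0) 2) = u * Real.sin φ

/-- The three types of edges: edges of the bases, and the two types of lateral edges. -/
def edgeType (u v : Vert) : Fin 3 :=
  if u.1 = v.1 then 0 else
    if (if u.1 = 0 then v.2 - u.2 else u.2 - v.2) = 1 then 1 else 2

/-- The hyperbolic cosines of the edge lengths. -/
noncomputable def gram (u c φ : ℝ) : Fin 3 → ℝ :=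
  ![1 + 3 * u / 2, 1 + u + c + Real.sqrt 3 / 2 * (u * Real.cos φ),
    1 + u + c - Real.sqrt 3 / 2 * (u * Real.cos φ)]

/-- The interior dihedral angles. -/
noncomputable def octaAngle (u c φ : ℝ) : Fin 3 → ℝ :=
  ![Real.pi - (angleMap (u, c, φ)).1, Real.pi + 2 * (angleMap (u, c, φ)).2.2,
    Real.pi - 2 * (angleMap (u, c, φ)).2.1]

namespace IsOcta

variable {p : Vert → Mink} {u c φ : ℝ}

/-- The two kinds of lateral edges together involve the height only through 2 x₃² + x₁x₂, which is
the definition of c, and x₁² - x₂² is u cos φ. No sin φ survives, so octahedra with opposite φ are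
isometric along their edges. -/
lemma neg_mink_eq (hp : IsOcta p u c φ) {v w : Vert} (h : Adj v w) :
    -mink (p v) (p w) = gram u c φ (edgeType v w) := by
  obtain ⟨hs, ⟨hm, -⟩, -, hr, hh, hcos, -⟩ := hp
  have h0 := hs.eq_octaOf
  generalize p (0, 0) = x at *
  subst h0
  clear hs
  have hs3 := sqrt_three_bounds.2.2
  obtain ⟨o1, o2, o3, o4, o5, o6⟩ := octaOf_eq x
  obtain ⟨l, k⟩ := v
  obtain ⟨l', k'⟩ := w
  rw [← hr] at hcos ⊢
  rw [← hh, gram, ← hcos]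
  generalize Real.sqrt 3 = e at *
  simp only [mink] at hm
  have h1 : (-1 : Fin 3) = 2 := rfl
  have h2 : (-2 : Fin 3) = 1 := rfl
  fin_cases l <;> fin_cases k <;> fin_cases l' <;> fin_cases k' <;> first
    | exact absurd rfl h
    | (simp [edgeType, mink, h1, h2, o1, o2, o3, o4, o5, o6]
       clear o1 o2 o3 o4 o5 o6 h h1 h2
       grind)

/-- The determinants of the spatial parts of the signed vertices of the faces. -/
lemma det3_signedVert (hp : IsOcta p u c φ) (s : Fin 3 → Fin 2) :
    det3 (signedVert p (s 0, 0)) (signedVert p (s 1, 1)) (signedVert p (s 2, 2)) =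
      if s 0 = s 1 ∧ s 1 = s 2 then 3 * Real.sqrt 3 / 2 * (-p (0, 0) 3) * u else
        Real.sqrt 3 * (-p (0, 0) 3) * (u / 2 + u * Real.sin φ) := by
  obtain ⟨hs, -, -, hr, -, -, hsin⟩ := hp
  have h0 := hs.eq_octaOf
  generalize p (0, 0) = x at *
  subst h0
  clear hs
  rw [← hr] at hsin ⊢
  rw [← hsin]
  clear hr hsin
  have hs3 := sqrt_three_bounds.2.2
  obtain ⟨o1, o2, o3, o4, o5, o6⟩ := octaOf_eq x
  generalize s 0 = i
  generalize s 1 = j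
  generalize s 2 = k
  generalize Real.sqrt 3 = e at *
  fin_cases i <;> fin_cases j <;> fin_cases k <;>
    (simp [signedVert, det3, o1, o2, o3, o4, o5, o6]
     clear o1 o2 o3 o4 o5 o6
     grind)

end IsOcta

end TwistedOcta

open TwistedOcta
namespace TwistedOcta

/-! ### Permutations of the columns and orientation signs -/

section Columns

/-- A property of triples of vertices that is invariant under permutations holds for all triples
with different columns if it does so for the vertices of the faces in the standard order. -/
lemma forall_of_forall_face {P : Vert → Vert → Vert → Prop} (h₁ : ∀ a b w, P a b w → P b a w)
    (h₂ : ∀ a b w, P a b w → P a w b)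
    (h : ∀ i j k : Fin 2, P (i, 0) (j, 1) (k, 2)) {a b w : Vert} (hab : a.2 ≠ b.2)
    (haw : a.2 ≠ w.2) (hbw : b.2 ≠ w.2) : P a b w := by
  obtain ⟨i, x⟩ := a
  obtain ⟨j, y⟩ := b
  obtain ⟨k, z⟩ := w
  fin_cases x <;> fin_cases y <;> fin_cases z <;> first
    | exact absurd rfl hab
    | exact absurd rfl haw
    | exact absurd rfl hbw
    | exact h _ _ _
    | exact h₁ _ _ _ (h _ _ _)
    | exact h₂ _ _ _ (h _ _ _)
    | exact h₁ _ _ _ (h₂ _ _ _ (h _ _ _))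
    | exact h₂ _ _ _ (h₁ _ _ _ (h _ _ _))
    | exact h₂ _ _ _ (h₁ _ _ _ (h₂ _ _ _ (h _ _ _)))

lemma det3_swap_left (x y w : Mink) : det3 y x w = -det3 x y w := by simp only [det3]; ring

lemma det3_swap_right (x y w : Mink) : det3 x w y = -det3 x y w := by simp only [det3]; ring

lemma det3_signedVert_eq (p : Vert → Mink) (a b w : Vert) :
    det3 (signedVert p a) (signedVert p b) (signedVert p w) =
      (if a.1 = 0 then -1 else 1) * (if b.1 = 0 then -1 else 1) * (if w.1 = 0 then -1 else 1) *
        det3 (p a) (p b) (p w) := by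
  simp only [signedVert, det3, Pi.smul_apply, smul_eq_mul]
  ring

lemma abs_det3_signedVert (p : Vert → Mink) (a b w : Vert) :
    |det3 (signedVert p a) (signedVert p b) (signedVert p w)| = |det3 (p a) (p b) (p w)| := by
  have h : ∀ i : Fin 2, |(if i = 0 then (-1 : ℝ) else 1)| = 1 := by
    intro i; split_ifs <;> simp
  rw [det3_signedVert_eq, abs_mul, abs_mul, abs_mul, h, h, h]
  ring

/-- The signs in `signedVert` differ for the two vertices of a column, so positivity for all faces
means that these vertices lie on opposite sides of the plane through the edge and the center. -/
lemma det3_mul_det3_neg {p : Vert → Mink}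
    (hp : ∀ s : Fin 3 → Fin 2,
      0 < det3 (signedVert p (s 0, 0)) (signedVert p (s 1, 1)) (signedVert p (s 2, 2)))
    {a b : Vert} {k : Fin 3} (hab : a.2 ≠ b.2) (ha : a.2 ≠ k) (hb : b.2 ≠ k) :
    det3 (p a) (p b) (p (0, k)) * det3 (p a) (p b) (p (1, k)) < 0 := by
  have hp' : ∀ i j l : Fin 2,
      0 < det3 (signedVert p (i, 0)) (signedVert p (j, 1)) (signedVert p (l, 2)) :=
    fun i j l => hp ![i, j, l]
  -- The claim is strengthened to all three columns at once, to make it invariant under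
  -- permutations.
  have key := forall_of_forall_face (P := fun a b w =>
    det3 (p (0, a.2)) (p b) (p w) * det3 (p (1, a.2)) (p b) (p w) < 0 ∧
    det3 (p a) (p (0, b.2)) (p w) * det3 (p a) (p (1, b.2)) (p w) < 0 ∧
    det3 (p a) (p b) (p (0, w.2)) * det3 (p a) (p b) (p (1, w.2)) < 0) ?_ ?_ ?_
    (w := (0, k)) hab ha hb
  · exact key.2.2
  · rintro a b w ⟨h1, h2, h3⟩
    refine ⟨?_, ?_, ?_⟩
    · rw [det3_swap_left (p a), det3_swap_left (p a)]; linarith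
    · rw [det3_swap_left _ (p b), det3_swap_left _ (p b)]; linarith
    · rw [det3_swap_left (p a), det3_swap_left (p a)]; linarith
  · rintro a b w ⟨h1, h2, h3⟩
    refine ⟨?_, ?_, ?_⟩
    · rw [det3_swap_right _ (p b), det3_swap_right _ (p b)]; linarith
    · rw [det3_swap_right _ (p b), det3_swap_right _ (p b)]; linarith
    · rw [det3_swap_right _ _ (p w), det3_swap_right _ _ (p w)]; linarith
  · intro i j l
    have e : ∀ i j l, 0 < (if i = 0 then (-1 : ℝ) else 1) * (if j = 0 then -1 else 1) *
        (if l = 0 then -1 else 1) * det3 (p (i, 0)) (p (j, 1)) (p (l, 2)) := by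
      intro i j l
      have := hp' i j l
      rwa [det3_signedVert_eq] at this
    have s0 : ∀ i : Fin 2, (if i = 0 then (-1 : ℝ) else 1) ^ 2 = 1 := by
      intro i; split_ifs <;> norm_num
    refine ⟨?_, ?_, ?_⟩
    · have := mul_pos (e 0 j l) (e 1 j l)
      have hj := s0 j
      have hl := s0 l
      simp only [if_true, one_ne_zero, if_false] at this ⊢
      generalize (if j = 0 then (-1 : ℝ) else 1) = x at *
      generalize (if l = 0 then (-1 : ℝ) else 1) = y at *
      have e : x ^ 2 * y ^ 2 * -(det3 (p (0, 0)) (p (j, 1)) (p (l, 2)) *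
        det3 (p (1, 0)) (p (j, 1)) (p (l, 2))) > 0 := by linarith
      rw [hj, hl] at e
      linarith
    · have := mul_pos (e i 0 l) (e i 1 l)
      have hj := s0 i
      have hl := s0 l
      simp only [if_true, one_ne_zero, if_false] at this ⊢
      generalize (if i = 0 then (-1 : ℝ) else 1) = x at *
      generalize (if l = 0 then (-1 : ℝ) else 1) = y at *
      have e : x ^ 2 * y ^ 2 * -(det3 (p (i, 0)) (p (0, 1)) (p (l, 2)) *
        det3 (p (i, 0)) (p (1, 1)) (p (l, 2))) > 0 := by linarith
      rw [hj, hl] at e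
      linarith
    · have := mul_pos (e i j 0) (e i j 1)
      have hj := s0 i
      have hl := s0 j
      simp only [if_true, one_ne_zero, if_false] at this ⊢
      generalize (if i = 0 then (-1 : ℝ) else 1) = x at *
      generalize (if j = 0 then (-1 : ℝ) else 1) = y at *
      have e : x ^ 2 * y ^ 2 * -(det3 (p (i, 0)) (p (j, 1)) (p (0, 2)) *
        det3 (p (i, 0)) (p (j, 1)) (p (1, 2))) > 0 := by linarith
      rw [hj, hl] at e
      linarith

lemma edgeType_zero_same : ∀ a b w : Vert, edgeType a b = 0 → w.1 = a.1 →
    b.1 = a.1 ∧ edgeType a w = 0 ∧ edgeType b w = 0 := by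
  decide

lemma edgeType_zero_ne : ∀ a b w : Vert, a.2 ≠ b.2 → a.2 ≠ w.2 → b.2 ≠ w.2 → edgeType a b = 0 →
    w.1 ≠ a.1 → edgeType a w = 1 ∧ edgeType b w = 2 ∨ edgeType a w = 2 ∧ edgeType b w = 1 := by
  decide

lemma edgeType_one : ∀ a b w : Vert, a.2 ≠ b.2 → a.2 ≠ w.2 → b.2 ≠ w.2 → edgeType a b = 1 →
    b.1 ≠ a.1 ∧ (edgeType a w = 0 ∧ edgeType b w = 2 ∨ edgeType a w = 2 ∧ edgeType b w = 0) := by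
  decide

lemma edgeType_two : ∀ a b w : Vert, a.2 ≠ b.2 → a.2 ≠ w.2 → b.2 ≠ w.2 → edgeType a b = 2 →
    b.1 ≠ a.1 ∧ (edgeType a w = 0 ∧ edgeType b w = 1 ∨ edgeType a w = 1 ∧ edgeType b w = 0) := by
  decide

end Columns

/-! ### Dihedral angles of symmetric octahedra and cone angles of their doubles -/

namespace IsOcta

variable {p : Vert → Mink} {u c φ : ℝ}

lemma heightSq_eq (hp : IsOcta p u c φ) : heightSq u c φ = p (0, 0) 3 ^ 2 := by
  rw [heightSq]; linear_combination -(1 / 2) * hp.height - 1 / 4 * hp.sin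

lemma time_sq (hp : IsOcta p u c φ) : p (0, 0) 0 ^ 2 = 1 + u + p (0, 0) 3 ^ 2 := by
  have := hp.mem.1
  rw [mink] at this
  linear_combination hp.radius - this

lemma ratioSq_eq (hp : IsOcta p u c φ) : ratioSq u c φ = p (0, 0) 0 ^ 2 / p (0, 0) 3 ^ 2 := by
  rw [ratioSq, hp.heightSq_eq, hp.time_sq]

lemma abs_det3 (hp : IsOcta p u c φ) (hu : 0 < u) (hs : 0 < 1 + 2 * Real.sin φ) {a b w : Vert}
    (hab : a.2 ≠ b.2) (haw : a.2 ≠ w.2) (hbw : b.2 ≠ w.2) :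
    |det3 (p a) (p b) (p w)| = if a.1 = b.1 ∧ b.1 = w.1 then
      3 * Real.sqrt 3 / 2 * (-p (0, 0) 3) * u else
        Real.sqrt 3 * (-p (0, 0) 3) * (u / 2 + u * Real.sin φ) := by
  have hn := hp.neg
  have := sqrt_three_bounds.1
  refine forall_of_forall_face (P := fun a b w => |det3 (p a) (p b) (p w)| =
    if a.1 = b.1 ∧ b.1 = w.1 then 3 * Real.sqrt 3 / 2 * (-p (0, 0) 3) * u else
      Real.sqrt 3 * (-p (0, 0) 3) * (u / 2 + u * Real.sin φ)) ?_ ?_ ?_ hab haw hbw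
  · intro a b w h
    rw [det3_swap_left, abs_neg, h]
    congr 1
    apply propext
    constructor <;> (rintro ⟨h, h'⟩; simp [h, h'])
  · intro a b w h
    rw [det3_swap_right, abs_neg, h]
    congr 1
    apply propext
    constructor <;> (rintro ⟨h, h'⟩; simp [h, h'])
  · intro i j k
    have := hp.det3_signedVert ![i, j, k]
    rw [← abs_det3_signedVert]
    change det3 (signedVert p (i, 0)) (signedVert p (j, 1)) (signedVert p (k, 2)) =
      if i = j ∧ j = k then _ else _ at this
    change |det3 (signedVert p (i, 0)) (signedVert p (j, 1)) (signedVert p (k, 2))| =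
      if i = j ∧ j = k then _ else _
    have h3 : (0 : ℝ) < -p (0, 0) 3 := by linarith
    have h4 : 0 < u / 2 + u * Real.sin φ := by nlinarith
    by_cases h : i = j ∧ j = k
    · rw [if_pos h] at this ⊢
      rw [this]
      exact abs_of_pos (by positivity)
    · rw [if_neg h] at this ⊢
      rw [this]
      exact abs_of_pos (by positivity)

/-- All vertices have the same time coordinate by symmetry. The determinants take only two values,
one for the bases and one for the lateral faces, and the latter is positive exactly because 1 + 2
sin φ > 0. -/
lemma isStarOcta (hp : IsOcta p u c φ) (hu : 0 < u) (hs : 0 < 1 + 2 * Real.sin φ) :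
    IsStarOcta p (p (0, 0) 0) := by
  have hmem : ∀ v, mink (p v) (p v) = -1 ∧ p v 0 = p (0, 0) 0 := by
    obtain ⟨hs, ⟨hm, -⟩, -, hr, hh, hcos, -⟩ := hp
    have h0 := hs.eq_octaOf
    generalize p (0, 0) = x at *
    subst h0
    clear hs
    have hs3 := sqrt_three_bounds.2.2
    obtain ⟨o1, o2, o3, o4, o5, o6⟩ := octaOf_eq x
    rintro ⟨l, k⟩
    generalize Real.sqrt 3 = e at *
    simp only [mink] at hm
    fin_cases l <;> fin_cases k <;>
      (simp [mink, o1, o2, o3, o4, o5, o6]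
       clear o1 o2 o3 o4 o5 o6
       try grind)
  refine ⟨fun v => ⟨(hmem v).1, ?_⟩, fun v => (hmem v).2, fun s => ?_⟩
  · rw [(hmem v).2]; exact hp.mem.2
  · have hn : 0 < -p (0, 0) 3 := by linarith [hp.neg]
    have := sqrt_three_bounds.1
    rw [hp.det3_signedVert]
    split_ifs
    · positivity
    · have : 0 < u / 2 + u * Real.sin φ := by nlinarith
      positivity

lemma edgeCot_eq (hp : IsOcta p u c φ) (hu : 0 < u) (hs : 0 < 1 + 2 * Real.sin φ) {a b w : Vert}
    (hab : a.2 ≠ b.2) (haw : a.2 ≠ w.2) (hbw : b.2 ≠ w.2) :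
    edgeCot p a b w = p (0, 0) 0 * (gram u c φ (edgeType a w) + gram u c φ (edgeType b w) - 1 -
      gram u c φ (edgeType a b)) / |det3 (p a) (p b) (p w)| *
        Real.sqrt ((gram u c φ (edgeType a b) - 1) / (gram u c φ (edgeType a b) + 1)) := by
  have h := hp.neg_mink_eq hab
  rw [edgeCot, (hp.isStarOcta hu hs).time, h, ← hp.neg_mink_eq haw, ← hp.neg_mink_eq hbw, ← h]
  ring_nf

lemma edgeCot_base (hp : IsOcta p u c φ) (hu : 0 < u) (hs : 0 < 1 + 2 * Real.sin φ) {a b w : Vert}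
    (hab : a.2 ≠ b.2) (haw : a.2 ≠ w.2) (hbw : b.2 ≠ w.2) (h : edgeType a b = 0)
    (hw : w.1 = a.1) : edgeCot p a b w = Real.sqrt (cotSqBase u c φ) := by
  obtain ⟨h1, h2, h3⟩ := edgeType_zero_same a b w h hw
  have hn : 0 < -p (0, 0) 3 := by linarith [hp.neg]
  have hT := hp.mem.2
  obtain ⟨he, -, he2⟩ := sqrt_three_bounds
  have hR := hp.ratioSq_eq
  rw [hp.edgeCot_eq hu hs hab haw hbw, hp.abs_det3 hu hs hab haw hbw, h, h2, h3,
    if_pos ⟨h1.symm, h1.trans hw.symm⟩, cotSqBase, hR]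
  simp only [gram, Matrix.cons_val_zero]
  generalize p (0, 0) 0 = T at *
  obtain ⟨z, hz⟩ : ∃ z, z = -p (0, 0) 3 := ⟨_, rfl⟩
  rw [show p (0, 0) 3 ^ 2 = z ^ 2 by rw [hz]; ring]
  rw [← hz] at hn ⊢
  clear hR hz hp
  symm
  refine (Real.sqrt_eq_iff_mul_self_eq (by positivity) ?_).2 ?_
  · have : 0 < 1 + 3 * u / 2 + (1 + 3 * u / 2) - 1 - (1 + 3 * u / 2) := by linarith
    positivity
  · rw [mul_mul_mul_comm, Real.mul_self_sqrt (div_nonneg (by linarith) (by linarith))]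
    field_simp
    linear_combination (u ^ 3 * (36 + 27 * u)) * he2

lemma edgeCot_side (hp : IsOcta p u c φ) (hu : 0 < u) (hc : 0 < c)
    (hs : 0 < 1 + 2 * Real.sin φ) {a b w : Vert}
    (hab : a.2 ≠ b.2) (haw : a.2 ≠ w.2) (hbw : b.2 ≠ w.2) (h : edgeType a b = 0)
    (hw : w.1 ≠ a.1) : edgeCot p a b w = Real.sqrt (cotSqSide u c φ) := by
  have h23 := edgeType_zero_ne a b w hab haw hbw h hw
  have hn : 0 < -p (0, 0) 3 := by linarith [hp.neg]
  have hT := hp.mem.2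
  obtain ⟨he, -, he2⟩ := sqrt_three_bounds
  have hR := hp.ratioSq_eq
  have hsum : gram u c φ (edgeType a w) + gram u c φ (edgeType b w) - 1 - gram u c φ 0 =
      (u + 4 * c) / 2 := by
    rcases h23 with ⟨h2, h3⟩ | ⟨h2, h3⟩ <;>
      (rw [h2, h3]
       simp only [gram, Matrix.cons_val]
       ring)
  rw [hp.edgeCot_eq hu hs hab haw hbw, hp.abs_det3 hu hs hab haw hbw, h, hsum,
    if_neg (fun h => hw (h.1.trans h.2).symm), cotSqSide, hR]
  simp only [gram, Matrix.cons_val_zero]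
  generalize p (0, 0) 0 = T at *
  obtain ⟨z, hz⟩ : ∃ z, z = -p (0, 0) 3 := ⟨_, rfl⟩
  rw [show p (0, 0) 3 ^ 2 = z ^ 2 by rw [hz]; ring]
  rw [← hz] at hn ⊢
  obtain ⟨k, hk⟩ : ∃ k, k = 1 + 2 * Real.sin φ := ⟨_, rfl⟩
  rw [show u / 2 + u * Real.sin φ = u / 2 * k by rw [hk]; ring]
  rw [← hk] at hs ⊢
  clear hR hz hp hk hsum
  symm
  refine (Real.sqrt_eq_iff_mul_self_eq (by positivity) (by positivity)).2 ?_
  rw [mul_mul_mul_comm, Real.mul_self_sqrt (div_nonneg (by linarith) (by linarith))]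
  field_simp
  linear_combination (4 * u + 3 * u ^ 2) * he2

/-- The cotangent at a lateral edge, where `e = √3` or `e = -√3`. -/
lemma cot_lateral {T z e C X N R : ℝ} (hT : 0 < T) (hz : 0 < z) (hu : 0 < u)
    (hs : 0 < 1 + 2 * Real.sin φ) (he : 0 ≤ e + 2 * Real.cos φ) (hX : 0 < X)
    (hR : R = T ^ 2 / z ^ 2)
    (hN : N = X * u / 2 * (e + 2 * Real.cos φ))
    (hC : C = 1 + u + c - e / 2 * (u * Real.cos φ)) (hC1 : 1 ≤ C) :
    T * N / (X * z * (u / 2 + u * Real.sin φ)) * Real.sqrt ((C - 1) / (C + 1)) =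
      Real.sqrt (R * ((e + 2 * Real.cos φ) ^ 2 / (1 + 2 * Real.sin φ) ^ 2 *
    ((2 * u + 2 * c - e * u * Real.cos φ) / (4 + (2 * u + 2 * c - e * u * Real.cos φ))))) := by
  have e1 : (2 * u + 2 * c - e * u * Real.cos φ) / (4 + (2 * u + 2 * c - e * u * Real.cos φ)) =
      (C - 1) / (C + 1) := by
    rw [div_eq_div_iff (by linarith) (by linarith), hC]; ring
  have e2 : u / 2 + u * Real.sin φ = u / 2 * (1 + 2 * Real.sin φ) := by ring
  rw [e1, e2, hR, hN]
  generalize 1 + 2 * Real.sin φ = k at *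
  generalize e + 2 * Real.cos φ = m at *
  have h0 : 0 ≤ (C - 1) / (C + 1) := div_nonneg (by linarith) (by linarith)
  symm
  refine (Real.sqrt_eq_iff_mul_self_eq (by positivity) (by positivity)).2 ?_
  rw [mul_mul_mul_comm, Real.mul_self_sqrt h0]
  generalize (C - 1) / (C + 1) = D at *
  field_simp

/-- Both faces at a lateral edge have one base edge and one lateral edge of the other kind as
remaining sides. The cotangent is thus independent of w, and the plane through the center bisects
the dihedral angle. -/
lemma edgeCot_two (hp : IsOcta p u c φ) (hu : 0 < u)
    (hs : 0 < 1 + 2 * Real.sin φ) (hcos : 0 < Real.cos φ) {a b w : Vert}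
    (hab : a.2 ≠ b.2) (haw : a.2 ≠ w.2) (hbw : b.2 ≠ w.2) (h : edgeType a b = 2) :
    edgeCot p a b w = Real.sqrt (cotSqLat (Real.sqrt 3) u c φ) := by
  obtain ⟨hb, h23⟩ := edgeType_two a b w hab haw hbw h
  have hn : 0 < -p (0, 0) 3 := by linarith [hp.neg]
  obtain ⟨he, -, he2⟩ := sqrt_three_bounds
  have hC1 : 1 ≤ gram u c φ 2 := by
    rw [← h, ← hp.neg_mink_eq hab]
    exact one_le_neg_mink ((hp.isStarOcta hu hs).mem a) ((hp.isStarOcta hu hs).mem b)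
  have hsum : gram u c φ (edgeType a w) + gram u c φ (edgeType b w) - 1 - gram u c φ 2 =
      Real.sqrt 3 * u / 2 * (Real.sqrt 3 + 2 * Real.cos φ) := by
    rcases h23 with ⟨h2, h3⟩ | ⟨h2, h3⟩ <;>
      (rw [h2, h3]
       simp only [gram, Matrix.cons_val]
       linear_combination -(u / 2) * he2)
  rw [hp.edgeCot_eq hu hs hab haw hbw, hp.abs_det3 hu hs hab haw hbw, h,
    if_neg (fun h => hb h.1.symm), cotSqLat]
  exact cot_lateral hp.mem.2 hn hu hs (by positivity) he
    (by rw [hp.ratioSq_eq, neg_sq]) hsum (by simp [gram]) hC1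

/-- Here the relevant factor is 2 cos φ - √3 > 0 and the cotangent is negative: the dihedral angle
exceeds π and the octahedron is not convex along these edges. -/
lemma edgeCot_one (hp : IsOcta p u c φ) (hu : 0 < u)
    (hs : 0 < 1 + 2 * Real.sin φ) (hcos : Real.sqrt 3 < 2 * Real.cos φ) {a b w : Vert}
    (hab : a.2 ≠ b.2) (haw : a.2 ≠ w.2) (hbw : b.2 ≠ w.2) (h : edgeType a b = 1) :
    edgeCot p a b w = -Real.sqrt (cotSqLat (-Real.sqrt 3) u c φ) := by
  obtain ⟨hb, h23⟩ := edgeType_one a b w hab haw hbw h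
  have hn : 0 < -p (0, 0) 3 := by linarith [hp.neg]
  obtain ⟨he, -, he2⟩ := sqrt_three_bounds
  have hC1 : 1 ≤ gram u c φ 1 := by
    rw [← h, ← hp.neg_mink_eq hab]
    exact one_le_neg_mink ((hp.isStarOcta hu hs).mem a) ((hp.isStarOcta hu hs).mem b)
  have hsum : gram u c φ (edgeType a w) + gram u c φ (edgeType b w) - 1 - gram u c φ 1 =
      -(Real.sqrt 3 * u / 2 * (-Real.sqrt 3 + 2 * Real.cos φ)) := by
    rcases h23 with ⟨h2, h3⟩ | ⟨h2, h3⟩ <;>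
      (rw [h2, h3]
       simp only [gram, Matrix.cons_val]
       linear_combination -(u / 2) * he2)
  rw [hp.edgeCot_eq hu hs hab haw hbw, hp.abs_det3 hu hs hab haw hbw, h, hsum,
    if_neg (fun h => hb h.1.symm), cotSqLat, mul_neg, neg_div, neg_mul]
  congr 1
  exact cot_lateral hp.mem.2 hn hu hs (by linarith) he
    (by rw [hp.ratioSq_eq, neg_sq]) rfl (by simp [gram]; ring) hC1

/-- Which of the two vertices of the third column lies on the positive side is not fixed, hence the
final case distinction; the sum of the two `arccot` values is symmetric. -/
lemma hasDihedralAngle (hp : IsOcta p u c φ) (hu : 0 < u) (hc : 0 < c)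
    (hs : 0 < 1 + 2 * Real.sin φ) (hcos : Real.sqrt 3 < 2 * Real.cos φ) {a b : Vert}
    (hab : Adj a b) {x y : ℝ} (hx : 0 < x) (hy : 0 < y) :
    HasDihedralAngle (solid p) (x • p a + y • p b) (octaAngle u c φ (edgeType a b)) := by
  have hab' : a.2 ≠ b.2 := hab
  obtain ⟨k, hak, hbk⟩ : ∃ k : Fin 3, a.2 ≠ k ∧ b.2 ≠ k := by
    generalize a.2 = i at *
    generalize b.2 = j at *
    revert i j
    decide
  have hstar := hp.isStarOcta hu hs
  have hdet := det3_mul_det3_neg hstar.orient hab' hak hbk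
  have he := sqrt_three_bounds.1
  have hsum : octaAngle u c φ (edgeType a b) =
      arccot (edgeCot p a b (0, k)) + arccot (edgeCot p a b (1, k)) := by
    have key : edgeType a b = 0 ∨ edgeType a b = 1 ∨ edgeType a b = 2 := by
      generalize edgeType a b = i
      revert i
      decide
    rcases key with h | h | h
    · have h01 : a.1 = 0 ∨ a.1 = 1 := by
        generalize a.1 = i
        revert i
        decide
      rcases h01 with h0 | h0
      · rw [hp.edgeCot_base hu hs hab' hak hbk h h0.symm,
          hp.edgeCot_side (w := (1, k)) hu hc hs hab' hak hbk h (by simp [h0]), h]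
        simp only [octaAngle, angleMap, arccot, Matrix.cons_val]
        ring
      · rw [hp.edgeCot_base (w := (1, k)) hu hs hab' hak hbk h h0.symm,
          hp.edgeCot_side (w := (0, k)) hu hc hs hab' hak hbk h (by simp [h0]), h]
        simp only [octaAngle, angleMap, arccot, Matrix.cons_val]
        ring
    · rw [hp.edgeCot_one hu hs hcos hab' hak hbk h, hp.edgeCot_one hu hs hcos hab' hak hbk h, h]
      simp only [octaAngle, angleMap, arccot, Matrix.cons_val, Real.arctan_neg]
      ring
    · rw [hp.edgeCot_two hu hs (by linarith) hab' hak hbk h,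
        hp.edgeCot_two hu hs (by linarith) hab' hak hbk h, h]
      simp only [octaAngle, angleMap, arccot, Matrix.cons_val]
      ring
  rw [hsum]
  rcases mul_neg_iff.1 hdet with ⟨h1, h2⟩ | ⟨h1, h2⟩
  · exact hstar.hasDihedralAngle (w := (0, k)) (w' := (1, k)) hab' hak hbk rfl h1 h2 hx hy
  · rw [add_comm (arccot _)]
    exact hstar.hasDihedralAngle (w := (1, k)) (w' := (0, k)) hab' hak hbk rfl h2 h1 hx hy

lemma isPolyhedron (hp : IsOcta p u c φ) (hu : 0 < u) (hs : 0 < 1 + 2 * Real.sin φ) :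
    IsPolyhedron p :=
  (hp.isStarOcta hu hs).isPolyhedron

variable {p' : Vert → Mink} {φ' : ℝ}

/-- Only cos φ = cos φ' is needed for the gluing, which covers both φ' = φ and φ' = -φ. -/
lemma isConeManifold (hp : IsOcta p u c φ) (hp' : IsOcta p' u c φ') (hu : 0 < u)
    (hs : 0 < 1 + 2 * Real.sin φ) (hs' : 0 < 1 + 2 * Real.sin φ')
    (h : Real.cos φ = Real.cos φ') : IsConeManifold p p' where
  left := hp.isPolyhedron hu hs
  right := hp'.isPolyhedron hu hs'
  edge_length a b hab := by
    rw [hdist, hdist, hp.neg_mink_eq hab, hp'.neg_mink_eq hab, gram, gram, h]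

lemma hasConeAngle (hp : IsOcta p u c φ) (hp' : IsOcta p' u c φ') (hu : 0 < u) (hc : 0 < c)
    (hcos : Real.sqrt 3 < 2 * Real.cos φ) (h : Real.cos φ = Real.cos φ')
    (hs : 0 < 1 + 2 * Real.sin φ) (hs' : 0 < 1 + 2 * Real.sin φ') {a b : Vert} (hab : Adj a b)
    {x : Glued p p'} (hx : x ∈ segment p p' a b) :
    HasConeAngle p p' x
      (octaAngle u c φ (edgeType a b) + octaAngle u c φ' (edgeType a b)) := by
  obtain ⟨y, s, t, hs0, ht0, hy, rfl⟩ := hx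
  have hab' : a.2 ≠ b.2 := hab
  -- Some face containing the edge; it certifies that the points of the edge lie on the surface and
  -- are identified by the gluing.
  obtain ⟨σ, hσa, hσb⟩ : ∃ σ : Fin 3 → Fin 2, σ a.2 = a.1 ∧ σ b.2 = b.1 :=
    ⟨Function.update (fun _ => b.1) a.2 a.1, by simp, by simp [Ne.symm hab']⟩
  let f : Vert → ℝ := Pi.single a s + Pi.single b t
  have hf0 : ∀ v, 0 ≤ f v := by
    intro v
    have h1 : 0 ≤ (Pi.single a s : Vert → ℝ) v := by
      rw [Pi.single_apply]; split_ifs <;> linarith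
    have h2 : 0 ≤ (Pi.single b t : Vert → ℝ) v := by
      rw [Pi.single_apply]; split_ifs <;> linarith
    exact add_nonneg h1 h2
  have hfσ : ∀ v, v ∉ face σ → f v = 0 := by
    intro v hv
    have h1 : v ≠ a := by rintro rfl; exact hv (mem_face.2 hσa)
    have h2 : v ≠ b := by rintro rfl; exact hv (mem_face.2 hσb)
    simp [f, h1, h2]
  have hfsum : ∀ r : Vert → Mink, ∑ v, f v • r v = s • r a + t • r b := by
    intro r
    simp [f, add_smul, Finset.sum_add_distrib, Pi.single_apply, ite_smul]
  have hst := hp.isStarOcta hu hs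
  have hst' := hp'.isStarOcta hu hs'
  have hgram : mink (p a) (p b) = mink (p' a) (p' b) := by
    have h1 := hp.neg_mink_eq hab
    have h2 := hp'.neg_mink_eq hab
    rw [gram, ← h, ← gram, ← h1] at h2
    linarith
  have hyH : (y : Mink) ∈ Hyp := by
    have := hst.solid_eq.subset y.2
    exact this.1
  -- The same combination of the corresponding vertices is again on the hyperboloid because the two
  -- edges have the same Gram matrix.
  have hmem' : s • p' a + t • p' b ∈ hull p' (face σ) := by
    refine ⟨⟨?_, ?_⟩, f, hf0, hfσ, (hfsum p').symm⟩
    · have h1 := hyH.1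
      rw [hy] at h1
      rw [mink_comb_left, mink_comb_right, mink_comb_right] at h1 ⊢
      rw [(hst.mem a).1, (hst.mem b).1, mink_comm (p b), hgram] at h1
      rw [(hst'.mem a).1, (hst'.mem b).1, mink_comm (p' b)]
      exact h1
    · have h1 := (hst'.mem a).2
      have h2 := (hst'.mem b).2
      simp only [Pi.add_apply, Pi.smul_apply, smul_eq_mul]
      positivity
  let y' : solid p' := ⟨s • p' a + t • p' b, Or.inl (Set.mem_iUnion.2 ⟨σ, hmem'⟩)⟩
  refine ⟨y, y', _, _, rfl, Quot.sound (GlueRel.glue _ _ ⟨σ, f, hf0, hfσ, ?_, ?_⟩), ?_, ?_, rfl⟩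
  · rw [hfsum, hy]
  · rw [hfsum]
  · rw [hy]
    exact hp.hasDihedralAngle hu hc hs hcos hab hs0 ht0
  · exact hp'.hasDihedralAngle hu hc hs' (h ▸ hcos) hab hs0 ht0

lemma sameConeAngles {r r' : Vert → Mink} {u₂ c₂ ψ ψ' : ℝ}
    (hp : IsOcta p u c φ) (hp' : IsOcta p' u c φ') (hu : 0 < u) (hc : 0 < c)
    (hcos : Real.sqrt 3 < 2 * Real.cos φ) (h : Real.cos φ = Real.cos φ')
    (hs : 0 < 1 + 2 * Real.sin φ) (hs' : 0 < 1 + 2 * Real.sin φ')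
    (hr : IsOcta r u₂ c₂ ψ) (hr' : IsOcta r' u₂ c₂ ψ') (hu₂ : 0 < u₂) (hc₂ : 0 < c₂)
    (hcos₂ : Real.sqrt 3 < 2 * Real.cos ψ) (h₂ : Real.cos ψ = Real.cos ψ')
    (hs₂ : 0 < 1 + 2 * Real.sin ψ) (hs₂' : 0 < 1 + 2 * Real.sin ψ')
    (hE : angleMap (u, c, φ) + angleMap (u, c, φ') =
      angleMap (u₂, c₂, ψ) + angleMap (u₂, c₂, ψ')) : SameConeAngles p p' r r' := by
  intro a b hab
  have hsum : ∀ i, octaAngle u c φ i + octaAngle u c φ' i =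
      octaAngle u₂ c₂ ψ i + octaAngle u₂ c₂ ψ' i := by
    have h1 := congrArg Prod.fst hE
    have h2 := congrArg (fun x => x.2.1) hE
    have h3 := congrArg (fun x => x.2.2) hE
    simp only [Prod.fst_add, Prod.snd_add] at h1 h2 h3
    intro i
    fin_cases i <;> simp only [octaAngle, Fin.zero_eta, Fin.mk_one, Fin.reduceFinMk,
      Matrix.cons_val] <;> linarith
  refine ⟨_, fun x hx => hp.hasConeAngle hp' hu hc hcos h hs hs' hab hx, fun x hx => ?_⟩
  rw [hsum]
  exact hr.hasConeAngle hr' hu₂ hc₂ hcos₂ h₂ hs₂ hs₂' hab hx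

end IsOcta

end TwistedOcta

open TwistedOcta
namespace TwistedOcta

/-! ### Symmetric deformations -/

lemma octaOf_apply_zero (x : Mink) : octaOf x (0, 0) = x := rfl

lemma isSymmetric_octaOf (x : Mink) : IsSymmetric (octaOf x) := by
  obtain ⟨o1, o2, o3, o4, o5, o6⟩ := octaOf_eq x
  have hs3 := sqrt_three_bounds.2.2
  constructor
  · intro l k
    rw [rot_eq]
    generalize Real.sqrt 3 = e at *
    fin_cases l <;> fin_cases k <;> ext i <;> fin_cases i <;>
      simp [o1, o2, o3, o4, o5, o6] <;> grind
  · intro l k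
    have h1 : (-1 : Fin 3) = 2 := rfl
    have h2 : (-2 : Fin 3) = 1 := rfl
    rw [halfTurn]
    fin_cases l <;> fin_cases k <;> ext i <;> fin_cases i <;>
      simp [h1, h2, o1, o2, o3, o4, o5, o6] <;> ring

lemma mink_octaOf (x y : Mink) (v : Vert) : mink (octaOf x v) (octaOf y v) = mink x y := by
  obtain ⟨o1, o2, o3, o4, o5, o6⟩ := octaOf_eq x
  obtain ⟨r1, r2, r3, r4, r5, r6⟩ := octaOf_eq y
  have hs3 := sqrt_three_bounds.2.2
  generalize Real.sqrt 3 = e at *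
  obtain ⟨l, k⟩ := v
  simp only [mink]
  fin_cases l <;> fin_cases k <;>
    (simp [o1, o2, o3, o4, o5, o6, r1, r2, r3, r4, r5, r6]
     try grind)

lemma octaOf_comb (c d : ℝ) (x y : Mink) (v : Vert) :
    octaOf (c • x + d • y) v = c • octaOf x v + d • octaOf y v := by
  obtain ⟨o1, o2, o3, o4, o5, o6⟩ := octaOf_eq x
  obtain ⟨r1, r2, r3, r4, r5, r6⟩ := octaOf_eq y
  obtain ⟨s1, s2, s3, s4, s5, s6⟩ := octaOf_eq (c • x + d • y)
  obtain ⟨l, k⟩ := v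
  fin_cases l <;> fin_cases k <;> ext i <;> fin_cases i <;>
    simp [o1, o2, o3, o4, o5, o6, r1, r2, r3, r4, r5, r6, s1, s2, s3, s4, s5, s6] <;> ring

lemma twisted_eq_octaOf (a b : ℝ) : twisted a b =
    octaOf ((Real.sqrt (1 - (a ^ 2 / 3 + b ^ 2 / 4)))⁻¹ • ![1, a / Real.sqrt 3, 0, -(b / 2)]) := by
  have hs := sqrt_three_bounds
  have key : ∀ x : ℝ, (a / Real.sqrt 3 * Real.cos x) ^ 2 + (a / Real.sqrt 3 * Real.sin x) ^ 2 =
      a ^ 2 / 3 := by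
    intro x
    have : (a / Real.sqrt 3 * Real.cos x) ^ 2 + (a / Real.sqrt 3 * Real.sin x) ^ 2 =
      a ^ 2 / Real.sqrt 3 ^ 2 * (Real.sin x ^ 2 + Real.cos x ^ 2) := by ring
    rw [this, hs.2.2, Real.sin_sq_add_cos_sq, mul_one]
  have c1 : Real.cos (2 * Real.pi / 3) = -(1 / 2) := by
    rw [show 2 * Real.pi / 3 = Real.pi - Real.pi / 3 by ring, Real.cos_pi_sub,
      Real.cos_pi_div_three]
  have s1 : Real.sin (2 * Real.pi / 3) = Real.sqrt 3 / 2 := by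
    rw [show 2 * Real.pi / 3 = Real.pi - Real.pi / 3 by ring, Real.sin_pi_sub,
      Real.sin_pi_div_three]
  have c2 : Real.cos (2 * Real.pi / 3 * 2) = -(1 / 2) := by
    rw [show 2 * Real.pi / 3 * 2 = Real.pi / 3 + Real.pi by ring, Real.cos_add_pi,
      Real.cos_pi_div_three]
  have s2 : Real.sin (2 * Real.pi / 3 * 2) = -(Real.sqrt 3 / 2) := by
    rw [show 2 * Real.pi / 3 * 2 = Real.pi / 3 + Real.pi by ring, Real.sin_add_pi,
      Real.sin_pi_div_three]
  funext ⟨l, k⟩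
  rw [twisted, ofKlein, key]
  have hb : a ^ 2 / 3 + (b * (((l : Fin 2) : ℕ) : ℝ) - b / 2) ^ 2 = a ^ 2 / 3 + b ^ 2 / 4 := by
    fin_cases l <;> simp <;> ring
  rw [hb]
  generalize Real.sqrt (1 - (a ^ 2 / 3 + b ^ 2 / 4)) = T at *
  generalize a / Real.sqrt 3 = ρ at *
  clear key hb
  obtain ⟨y, hy⟩ : ∃ y, y = T⁻¹ • ![1, ρ, 0, -(b / 2)] := ⟨_, rfl⟩
  obtain ⟨o1, o2, o3, o4, o5, o6⟩ := octaOf_eq y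
  rw [← hy]
  have h0 : y 0 = T⁻¹ := by simp [hy]
  have h1 : y 1 = T⁻¹ * ρ := by simp [hy]
  have h2 : y 2 = 0 := by simp [hy]
  have h3 : y 3 = -(T⁻¹ * (b / 2)) := by simp [hy]
  fin_cases l <;> fin_cases k <;> ext i <;> fin_cases i <;>
    simp [-mul_eq_mul_left_iff, o1, o2, o3, o4, o5, o6, h0, h1, h2, h3, c1, c2, s1, s2, Real.cos_add_pi_div_two,
      Real.sin_add_pi_div_two] <;> ring

/-- Tangent vectors of hyperbolic space are spacelike, by Cauchy–Schwarz. It disposes of the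
degenerate case in which `hexp` divides by a zero length. -/
lemma eq_zero_of_mink_self_nonpos {p w : Mink} (hp : p ∈ Hyp) (hw : mink p w = 0)
    (h : mink w w ≤ 0) : w = 0 := by
  obtain ⟨h1, h0⟩ := hp
  simp only [mink] at h1 hw h
  have hcs : (p 1 * w 1 + p 2 * w 2 + p 3 * w 3) ^ 2 ≤
      (p 1 ^ 2 + p 2 ^ 2 + p 3 ^ 2) * (w 1 ^ 2 + w 2 ^ 2 + w 3 ^ 2) := by
    nlinarith [sq_nonneg (p 1 * w 2 - p 2 * w 1), sq_nonneg (p 1 * w 3 - p 3 * w 1),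
      sq_nonneg (p 2 * w 3 - p 3 * w 2)]
  have e1 : p 1 * w 1 + p 2 * w 2 + p 3 * w 3 = p 0 * w 0 := by linarith
  have e2 : p 1 ^ 2 + p 2 ^ 2 + p 3 ^ 2 = p 0 ^ 2 - 1 := by linarith
  rw [e1, e2] at hcs
  have hs : w 1 ^ 2 + w 2 ^ 2 + w 3 ^ 2 ≤ 0 := by
    have : p 0 ^ 2 * (w 1 ^ 2 + w 2 ^ 2 + w 3 ^ 2) ≤ p 0 ^ 2 * w 0 ^ 2 :=
      mul_le_mul_of_nonneg_left (by linarith) (sq_nonneg _)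
    nlinarith
  have h1 : w 1 = 0 := by nlinarith [sq_nonneg (w 1), sq_nonneg (w 2), sq_nonneg (w 3)]
  have h2 : w 2 = 0 := by nlinarith [sq_nonneg (w 1), sq_nonneg (w 2), sq_nonneg (w 3)]
  have h3 : w 3 = 0 := by nlinarith [sq_nonneg (w 1), sq_nonneg (w 2), sq_nonneg (w 3)]
  rw [h1, h2, h3] at e1
  have h0' : w 0 = 0 := by
    have : p 0 * w 0 = 0 := by linarith
    exact (mul_eq_zero.1 this).resolve_left h0.ne'
  ext i
  fin_cases i <;> assumption

/-- Since cosh x and sinh x / x are even, the absolute value of t arising from the square root can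
be dropped. The result is differentiable in t across 0. -/
lemma hexp_smul (p w : Mink) (t : ℝ) : hexp p (t • w) =
    Real.cosh (t * Real.sqrt (mink w w)) • p +
      (Real.sinh (t * Real.sqrt (mink w w)) / Real.sqrt (mink w w)) • w := by
  have h : mink (t • w) (t • w) = t ^ 2 * mink w w := by
    simp only [mink, Pi.smul_apply, smul_eq_mul]; ring
  rw [hexp, h, Real.sqrt_mul (sq_nonneg t), Real.sqrt_sq_eq_abs, smul_smul]
  generalize Real.sqrt (mink w w) = s
  rcases le_total 0 t with ht | ht
  · rw [abs_of_nonneg ht]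
    rcases ht.eq_or_lt with rfl | ht
    · simp
    · congr 2
      field_simp
  · rw [abs_of_nonpos ht]
    rcases ht.eq_or_lt with rfl | ht
    · simp
    · rw [neg_mul, Real.cosh_neg, Real.sinh_neg]
      congr 2
      have := ht.ne
      field_simp

lemma hasDerivAt_hexp_smul {p w : Mink} (hp : p ∈ Hyp) (hw : mink p w = 0) (i : Fin 4) :
    HasDerivAt (fun t : ℝ => hexp p (t • w) i) (w i) 0 := by
  simp only [hexp_smul, Pi.add_apply, Pi.smul_apply, smul_eq_mul]
  rcases le_or_gt (mink w w) 0 with h | h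
  · rw [eq_zero_of_mink_self_nonpos hp hw h]
    simp [mink, hasDerivAt_const]
  · have hs := (Real.sqrt_pos.2 h).ne'
    generalize Real.sqrt (mink w w) = s at *
    have h1 : HasDerivAt (fun t : ℝ => t * s) s 0 := by
      simpa using (hasDerivAt_id (0 : ℝ)).mul_const s
    have h2 := (h1.cosh.mul_const (p i)).add ((h1.sinh.div_const s).mul_const (w i))
    refine h2.congr_deriv ?_
    simp [hs]

/-- The first-order condition satisfied by infinitesimal isometric deformations. -/
lemma IsInfIsometric.mink_add_eq_zero {p q : Vert → Mink} (h : IsInfIsometric p q)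
    (hp : ∀ v, p v ∈ Hyp) {u v : Vert} (huv : Adj u v) (hlt : 1 < -mink (p u) (p v)) :
    mink (p u) (q v) + mink (q u) (p v) = 0 := by
  have hd := h.2 u v huv
  have hm : HasDerivAt (fun t : ℝ => -mink (hexp (p u) (t • q u)) (hexp (p v) (t • q v)))
      (-(mink (p u) (q v) + mink (q u) (p v))) 0 := by
    have hu := hasDerivAt_hexp_smul (hp u) (h.1 u)
    have hv := hasDerivAt_hexp_smul (hp v) (h.1 v)
    have e : ∀ w i, hexp (p w) ((0 : ℝ) • q w) i = p w i := by
      intro w i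
      rw [hexp_smul]; simp
    have := (((((hu 0).mul (hv 0)).neg.add ((hu 1).mul (hv 1))).add ((hu 2).mul (hv 2))).add
      ((hu 3).mul (hv 3))).neg
    refine this.congr_deriv ?_
    simp only [e, mink]
    ring
  have hev : ∀ᶠ t in nhds (0 : ℝ),
      1 < -mink (hexp (p u) (t • q u)) (hexp (p v) (t • q v)) := by
    refine hm.continuousAt.eventually (lt_mem_nhds ?_)
    simp only [hexp_smul]
    simpa using hlt
  -- Composing the distance with cosh avoids differentiating `Real.arcosh`; the strict inequality
  -- guarantees that cosh inverts it for all small t.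
  have hc := hd.cosh
  have heq : (fun t : ℝ => Real.cosh (hdist (hexp (p u) (t • q u)) (hexp (p v) (t • q v)))) =ᶠ[nhds 0]
      fun t => -mink (hexp (p u) (t • q u)) (hexp (p v) (t • q v)) := by
    filter_upwards [hev] with t ht
    rw [hdist, Real.cosh_arcosh ht.le]
  have := (hc.congr_of_eventuallyEq heq.symm).unique hm
  rw [mul_zero] at this
  linarith

end TwistedOcta

/-! ### The explicit symmetric deformation -/

open TwistedOcta
namespace TwistedOcta
open Filter Topology

/-- The first vertex of a symmetric twisted octahedron with circumradius `r` and height `2 z`. -/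
noncomputable def baseVertex (r z : ℝ) : Mink := ![Real.sqrt (1 + r ^ 2 + z ^ 2), r, 0, -z]

/-- The value at the first vertex of a symmetric infinitesimal isometric deformation. -/
noncomputable def baseVector (r z : ℝ) : Mink :=
  ![-(r / (4 * Real.sqrt (1 + r ^ 2 + z ^ 2))), 0, 1, r / (4 * z)]

/-- The squared length of `baseVector r z`. -/
noncomputable def speedSq (r z : ℝ) : ℝ :=
  1 + r ^ 2 / (16 * z ^ 2) - r ^ 2 / (16 * (1 + r ^ 2 + z ^ 2))

section Deformation

variable {r z : ℝ}

lemma sq_sqrt_time (r z : ℝ) :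
    0 < Real.sqrt (1 + r ^ 2 + z ^ 2) ∧ Real.sqrt (1 + r ^ 2 + z ^ 2) ^ 2 = 1 + r ^ 2 + z ^ 2 :=
  ⟨Real.sqrt_pos.2 (by positivity), Real.sq_sqrt (by positivity)⟩

lemma speedSq_pos (hz : 0 < z) : 0 < speedSq r z := by
  have : r ^ 2 / (16 * (1 + r ^ 2 + z ^ 2)) ≤ 1 := by
    rw [div_le_one (by positivity)]
    nlinarith [sq_nonneg r, sq_nonneg z]
  have : 0 < r ^ 2 / (16 * z ^ 2) ∨ r = 0 := by
    rcases eq_or_ne r 0 with h | h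
    · exact Or.inr h
    · left; positivity
  rcases this with h | rfl
  · rw [speedSq]; linarith
  · simp [speedSq]

lemma baseVertex_mem (r z : ℝ) : baseVertex r z ∈ Hyp := by
  obtain ⟨h0, h1⟩ := sq_sqrt_time r z
  constructor
  · simp only [mink, baseVertex, Matrix.cons_val]
    linear_combination -h1
  · simpa [baseVertex] using h0

lemma mink_baseVector_self (hz : 0 < z) : mink (baseVector r z) (baseVector r z) = speedSq r z := by
  obtain ⟨h0, h1⟩ := sq_sqrt_time r z
  simp only [mink, baseVector, speedSq, Matrix.cons_val]
  generalize Real.sqrt (1 + r ^ 2 + z ^ 2) = T at *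
  rw [← h1]
  field_simp
  ring

lemma mink_baseVertex_baseVector (hz : 0 < z) : mink (baseVertex r z) (baseVector r z) = 0 := by
  obtain ⟨h0, h1⟩ := sq_sqrt_time r z
  simp only [mink, baseVector, baseVertex, Matrix.cons_val]
  field_simp
  ring

/-- The bases of the hyperbolic octahedra in terms of those of the Euclidean ones. -/
lemma twisted_eq_octaOf_baseVertex (r z : ℝ) :
    twisted (Real.sqrt 3 * r / Real.sqrt (1 + r ^ 2 + z ^ 2))
      (2 * z / Real.sqrt (1 + r ^ 2 + z ^ 2)) = octaOf (baseVertex r z) := by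
  obtain ⟨h0, h1⟩ := sq_sqrt_time r z
  obtain ⟨e0, -, e3⟩ := sqrt_three_bounds
  rw [twisted_eq_octaOf, baseVertex]
  generalize hT : Real.sqrt (1 + r ^ 2 + z ^ 2) = T at *
  have hx : 1 - ((Real.sqrt 3 * r / T) ^ 2 / 3 + (2 * z / T) ^ 2 / 4) = (T⁻¹) ^ 2 := by
    rw [div_pow, mul_pow, e3]
    field_simp
    linear_combination 4 * h1
  rw [hx, Real.sqrt_sq (by positivity), inv_inv]
  congr 1
  ext i
  fin_cases i
  · simp
  · simp; field_simp
  · simp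
  · simp; field_simp

/-- Symmetric infinitesimal isometric deformations are determined up to a factor. -/
lemma IsInfIsometric.eq_octaOf {q : Vert → Mink} (hr : 0 < r) (hz : 0 < z)
    (h : IsInfIsometric (octaOf (baseVertex r z)) q) (hq : IsSymmetric q) :
    q = octaOf (q (0, 0) 2 • baseVector r z) := by
  have hmem : ∀ v, octaOf (baseVertex r z) v ∈ Hyp := by
    intro v
    refine ⟨by rw [mink_octaOf]; exact (baseVertex_mem r z).1, ?_⟩
    have h0 := (baseVertex_mem r z).2
    obtain ⟨o1, o2, o3, o4, o5, o6⟩ := octaOf_eq (baseVertex r z)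
    obtain ⟨l, k⟩ := v
    fin_cases l <;> fin_cases k <;> simp [o1, o2, o3, o4, o5, o6, h0]
  have hq0 := hq.eq_octaOf
  generalize q (0, 0) = w at *
  subst hq0
  congr 1
  obtain ⟨h0, h1⟩ := sq_sqrt_time r z
  obtain ⟨e0, -, e3⟩ := sqrt_three_bounds
  have ht := h.1 (0, 0)
  rw [mink_octaOf] at ht
  obtain ⟨o1, o2, o3, o4, o5, o6⟩ := octaOf_eq (baseVertex r z)
  obtain ⟨w1, w2, w3, w4, w5, w6⟩ := octaOf_eq w
  -- Tangency and the edges AB and AB' give three linear equations for the four coordinates of w;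
  -- the remaining freedom is the factor w 2.
  have hA := h.mink_add_eq_zero hmem (u := (0, 0)) (v := (0, 1)) (by simp [Adj])
    (by
      rw [o1, o2]
      simp only [mink, baseVertex, Matrix.cons_val]
      nlinarith)
  have hB := h.mink_add_eq_zero hmem (u := (0, 0)) (v := (1, 1)) (by simp [Adj])
    (by
      rw [o1, o5]
      simp only [mink, baseVertex, Matrix.cons_val]
      nlinarith)
  rw [o1, o2, w1, w2] at hA
  rw [o1, o5, w1, w5] at hB
  simp only [mink, baseVertex, Matrix.cons_val] at ht hA hB
  rw [baseVector]
  clear h hmem hq o1 o2 o3 o4 o5 o6 w1 w2 w3 w4 w5 w6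
  generalize Real.sqrt (1 + r ^ 2 + z ^ 2) = T at *
  generalize Real.sqrt 3 = e at *
  have k1 : w 1 = 0 := by
    have : r * w 1 = 0 := by linear_combination -(1 / 3) * hA + (2 / 3) * ht
    exact (mul_eq_zero.1 this).resolve_left hr.ne'
  rw [k1] at ht hA hB
  have k3 : w 3 = r * w 2 / (4 * z) := by
    rw [eq_div_iff (by positivity)]
    linear_combination hB - 2 * ht
  have k0 : w 0 = -(r * w 2 / (4 * T)) := by
    rw [k3] at ht
    field_simp
    field_simp at ht
    linear_combination -ht
  ext i
  fin_cases i
  · simp [k0]; ring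
  · simp [k1]
  · simp
  · simp [k3]; ring

lemma deform_octaOf (x w : Mink) (t : ℝ) : deform (octaOf x) (octaOf w) t =
    octaOf (Real.cosh (t * Real.sqrt (mink w w)) • x +
      (Real.sinh (t * Real.sqrt (mink w w)) / Real.sqrt (mink w w)) • w) := by
  funext v
  rw [deform, hexp_smul, mink_octaOf, octaOf_comb]

lemma mink_comb_self {x w : Mink} (hx : mink x x = -1) (hxw : mink x w = 0) (c d : ℝ) :
    mink (c • x + d • w) (c • x + d • w) = -c ^ 2 + d ^ 2 * mink w w := by
  rw [mink_comb_left, mink_comb_right, mink_comb_right, hx, hxw, mink_comm w, hxw]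
  ring

/-- The parameters of the deformed octahedra. -/
noncomputable def deformParam (y : ℝ × ℝ × ℝ) : ℝ × ℝ × ℝ :=
  ((1 - y.2.2 ^ 2 * speedSq y.1 y.2.1)⁻¹ * (y.1 ^ 2 + y.2.2 ^ 2),
    (1 - y.2.2 ^ 2 * speedSq y.1 y.2.1)⁻¹ *
      (2 * y.2.1 ^ 2 + y.2.2 ^ 2 * y.1 ^ 2 / (8 * y.2.1 ^ 2)),
    -2 * Real.arctan (y.2.2 / y.1))

lemma cos_two_mul_arctan (x : ℝ) : Real.cos (2 * Real.arctan x) = (1 - x ^ 2) / (1 + x ^ 2) := by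
  rw [Real.cos_two_mul, Real.cos_sq_arctan]
  field_simp
  ring

lemma sin_two_mul_arctan (x : ℝ) : Real.sin (2 * Real.arctan x) = 2 * x / (1 + x ^ 2) := by
  have h : Real.sin (Real.arctan x) = x * Real.cos (Real.arctan x) := by
    rw [Real.sin_arctan, Real.cos_arctan]; ring
  rw [Real.sin_two_mul, h]
  have := Real.cos_sq_arctan x
  linear_combination 2 * x * this

/-- The deformed octahedra in terms of the parameters. -/
lemma isOcta_deform (hr : 0 < r) (hz : 0 < z) {l t s μ : ℝ} (hl : l ≠ 0)
    (hs : s = Real.sqrt (l ^ 2 * speedSq r z)) (hμ : μ = l * Real.tanh (t * s) / s)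
    (hsmall : μ * r < 4 * z ^ 2) :
    IsOcta (deform (octaOf (baseVertex r z)) (octaOf (l • baseVector r z)) t)
      (deformParam (r, z, μ)).1 (deformParam (r, z, μ)).2.1 (deformParam (r, z, μ)).2.2 := by
  have hQ := speedSq_pos (r := r) hz
  have hw : mink (l • baseVector r z) (l • baseVector r z) = l ^ 2 * speedSq r z := by
    rw [← mink_baseVector_self hz]
    simp only [mink, Pi.smul_apply, smul_eq_mul]
    ring
  have hs0 : 0 < s := by rw [hs]; positivity
  have hs2 : s ^ 2 = l ^ 2 * speedSq r z := by rw [hs]; exact Real.sq_sqrt (by positivity)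
  rw [deform_octaOf, hw, ← hs]
  have hC := Real.cosh_pos (t * s)
  have hCS := Real.cosh_sq (t * s)
  have hSμ : Real.sinh (t * s) / s * l = Real.cosh (t * s) * μ := by
    rw [hμ, Real.tanh_eq_sinh_div_cosh]
    field_simp
  have hxw : mink (baseVertex r z) (l • baseVector r z) = 0 := by
    have := mink_baseVertex_baseVector (r := r) hz
    simp only [mink, Pi.smul_apply, smul_eq_mul] at this ⊢
    linear_combination l * this
  have hnorm := mink_comb_self (baseVertex_mem r z).1 hxw (Real.cosh (t * s))
    (Real.sinh (t * s) / s)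
  rw [hw, ← hs2, div_pow, div_mul_cancel₀ _ (by positivity)] at hnorm
  -- In terms of μ, the deformed vertex is cosh(ts) times `baseVertex` + μ `baseVector`. The
  -- normalization cosh² is therefore a function of μ² and the speed alone.
  have hN : Real.cosh (t * s) ^ 2 * (1 - μ ^ 2 * speedSq r z) = 1 := by
    have : Real.cosh (t * s) ^ 2 * (μ ^ 2 * speedSq r z) = Real.sinh (t * s) ^ 2 := by
      have h1 : Real.cosh (t * s) ^ 2 * (μ ^ 2 * speedSq r z) =
        (Real.sinh (t * s) / s * l) ^ 2 * speedSq r z := by rw [hSμ]; ring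
      rw [h1, mul_pow, mul_assoc, ← hs2, div_pow, div_mul_cancel₀ _ (by positivity)]
    linear_combination hCS - this
  have hN' : (1 - μ ^ 2 * speedSq r z)⁻¹ = Real.cosh (t * s) ^ 2 := inv_eq_of_mul_eq_one_left hN
  have hT0 := (baseVertex_mem r z).2
  obtain ⟨h0, h1⟩ := sq_sqrt_time r z
  simp only [smul_smul, hSμ] at hnorm ⊢
  have hcos : Real.cos (-2 * Real.arctan (μ / r)) = (r ^ 2 - μ ^ 2) / (r ^ 2 + μ ^ 2) := by
    rw [neg_mul, Real.cos_neg, cos_two_mul_arctan]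
    field_simp
  have hsin : Real.sin (-2 * Real.arctan (μ / r)) = -(2 * μ * r) / (r ^ 2 + μ ^ 2) := by
    rw [neg_mul, Real.sin_neg, sin_two_mul_arctan]
    field_simp
  simp only [deformParam]
  rw [hN']
  generalize Real.cosh (t * s) = C at *
  have hpos : 0 < r ^ 2 + μ ^ 2 := by positivity
  have x1 : (C • baseVertex r z + (C * μ) • baseVector r z) 1 = C * r := by
    simp [baseVertex, baseVector]
  have x2 : (C • baseVertex r z + (C * μ) • baseVector r z) 2 = C * μ := by
    simp [baseVertex, baseVector]
  have x3 : (C • baseVertex r z + (C * μ) • baseVector r z) 3 =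
      -(C * (4 * z ^ 2 - μ * r) / (4 * z)) := by
    simp [baseVertex, baseVector]; field_simp; ring
  refine ⟨isSymmetric_octaOf _, ⟨?_, ?_⟩, ?_, ?_, ?_, ?_, ?_⟩
  all_goals rw [octaOf_apply_zero]
  · rw [hnorm]; linear_combination -hCS
  · have hx0 : (C • baseVertex r z + (C * μ) • baseVector r z) 0 =
        C * (4 * (1 + r ^ 2 + z ^ 2) - μ * r) / (4 * Real.sqrt (1 + r ^ 2 + z ^ 2)) := by
      simp [baseVertex, baseVector]
      generalize Real.sqrt (1 + r ^ 2 + z ^ 2) = T at *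
      rw [← h1]
      field_simp
      ring
    rw [hx0]
    have : 0 < 4 * (1 + r ^ 2 + z ^ 2) - μ * r := by nlinarith
    positivity
  · rw [x3]
    have : 0 < 4 * z ^ 2 - μ * r := by linarith
    have : 0 < C * (4 * z ^ 2 - μ * r) / (4 * z) := by positivity
    linarith
  · rw [x1, x2]; ring
  -- The odd terms -μr of 2 x₃² and +μr of x₁x₂ cancel, up to the common factor C². The coordinate
  -- r/(4z) of `baseVector` is thus what makes the height parameter even in μ.
  · rw [x1, x2, x3]; field_simp; ring
  · rw [x1, x2, hcos]; field_simp
  · rw [x1, x2, hsin]; field_simp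

end Deformation

end TwistedOcta

open TwistedOcta
namespace TwistedOcta
open Filter Topology

/-! ### Realizing all nearby parameters by deformed octahedra -/

section Realization

variable {r z : ℝ}

lemma deformParam_zero (r z : ℝ) : deformParam (r, z, 0) = (r ^ 2, 2 * z ^ 2, 0) := by
  simp [deformParam]

lemma deformParam_neg (r z μ : ℝ) : deformParam (r, z, -μ) =
    ((deformParam (r, z, μ)).1, (deformParam (r, z, μ)).2.1, -(deformParam (r, z, μ)).2.2) := by
  simp [deformParam, neg_div, Real.arctan_neg]

lemma contDiffAt_speedSq (r : ℝ) (hz : 0 < z) :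
    ContDiffAt ℝ 1 (fun y : ℝ × ℝ × ℝ => speedSq y.1 y.2.1) (r, z, (0 : ℝ)) := by
  have h2 : 16 * (r, z, (0 : ℝ)).2.1 ^ 2 ≠ 0 := by positivity
  have h3 : 16 * (1 + (r, z, (0 : ℝ)).1 ^ 2 + (r, z, (0 : ℝ)).2.1 ^ 2) ≠ 0 := by positivity
  have e2 : ContDiffAt ℝ 1 (fun y : ℝ × ℝ × ℝ => y.1 ^ 2 / (16 * y.2.1 ^ 2)) (r, z, (0 : ℝ)) :=
    ContDiffAt.div (by fun_prop) (by fun_prop) h2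
  have e3 : ContDiffAt ℝ 1 (fun y : ℝ × ℝ × ℝ => y.1 ^ 2 / (16 * (1 + y.1 ^ 2 + y.2.1 ^ 2)))
      (r, z, (0 : ℝ)) := ContDiffAt.div (by fun_prop) (by fun_prop) h3
  exact (contDiffAt_const.add e2).sub e3

lemma contDiffAt_deformParam (hr : 0 < r) (hz : 0 < z) :
    ContDiffAt ℝ 1 deformParam (r, z, (0 : ℝ)) := by
  have h1 : (r, z, (0 : ℝ)).1 ≠ 0 := hr.ne'
  have h2' : 8 * (r, z, (0 : ℝ)).2.1 ^ 2 ≠ 0 := by positivity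
  have hQ := contDiffAt_speedSq r hz
  have hN : ContDiffAt ℝ 1 (fun y : ℝ × ℝ × ℝ => (1 - y.2.2 ^ 2 * speedSq y.1 y.2.1)⁻¹)
      (r, z, (0 : ℝ)) := by
    refine ContDiffAt.inv ?_ (by simp)
    fun_prop
  unfold deformParam
  refine (hN.mul (by fun_prop)).prodMk ((hN.mul (ContDiffAt.add (by fun_prop)
    (ContDiffAt.div (by fun_prop) (by fun_prop) h2'))).prodMk
      (contDiffAt_const.mul (ContDiffAt.arctan (ContDiffAt.div (by fun_prop) (by fun_prop) h1))))

/-- On the plane μ = 0 the map is (r², 2z², 0), and its last component has μ-derivative -2/r. The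
derivative is block triangular and onto, so the map is open there. -/
lemma map_nhds_deformParam (hr : 0 < r) (hz : 0 < z) :
    map deformParam (𝓝 (r, z, (0 : ℝ))) = 𝓝 (r ^ 2, 2 * z ^ 2, (0 : ℝ)) := by
  have hstrict := (contDiffAt_deformParam hr hz).hasStrictFDerivAt one_ne_zero
  rw [← deformParam_zero]
  refine hstrict.map_nhds_eq_of_surj ?_
  set D := fderiv ℝ deformParam (r, z, (0 : ℝ)) with hD
  have line : ∀ v : ℝ × ℝ × ℝ,
      HasDerivAt (fun τ : ℝ => deformParam ((r, z, (0 : ℝ)) + τ • v)) (D v) 0 := by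
    intro v
    have h : HasDerivAt (fun τ : ℝ => (r, z, (0 : ℝ)) + τ • v) v 0 := by
      simpa using ((hasDerivAt_id (0 : ℝ)).smul_const v).const_add (r, z, (0 : ℝ))
    have h' : HasFDerivAt deformParam D ((r, z, (0 : ℝ)) + (0 : ℝ) • v) := by
      rw [zero_smul, add_zero]; exact hstrict.hasFDerivAt
    exact h'.comp_hasDerivAt (0 : ℝ) h
  have d1 : D (1, 0, 0) = (2 * r, 0, 0) := by
    have h := line (1, 0, 0)
    have e : (fun τ : ℝ => deformParam ((r, z, (0 : ℝ)) + τ • ((1 : ℝ), (0 : ℝ), (0 : ℝ)))) =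
        fun τ => ((r + τ) ^ 2, 2 * z ^ 2, 0) := by
      funext τ
      rw [← deformParam_zero]; simp
    rw [e] at h
    have h1 : HasDerivAt (fun τ : ℝ => (r + τ) ^ 2) (2 * r) 0 := by
      refine (((hasDerivAt_id (0 : ℝ)).const_add r).pow 2).congr_deriv ?_
      simp
    exact h.unique (h1.prodMk ((hasDerivAt_const _ _).prodMk (hasDerivAt_const _ _)))
  have d2 : D (0, 1, 0) = (0, 4 * z, 0) := by
    have h := line (0, 1, 0)
    have e : (fun τ : ℝ => deformParam ((r, z, (0 : ℝ)) + τ • ((0 : ℝ), (1 : ℝ), (0 : ℝ)))) =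
        fun τ => (r ^ 2, 2 * (z + τ) ^ 2, 0) := by
      funext τ
      rw [← deformParam_zero]; simp
    rw [e] at h
    have h1 : HasDerivAt (fun τ : ℝ => 2 * (z + τ) ^ 2) (4 * z) 0 := by
      refine ((((hasDerivAt_id (0 : ℝ)).const_add z).pow 2).const_mul 2).congr_deriv ?_
      simp; ring
    exact h.unique ((hasDerivAt_const _ _).prodMk (h1.prodMk (hasDerivAt_const _ _)))
  -- Only the last component is needed: the other two entries of this column do not affect
  -- surjectivity.
  have d3 : (D (0, 0, 1)).2.2 = -2 / r := by
    have h : HasDerivAt (fun τ : ℝ =>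
        (deformParam ((r, z, (0 : ℝ)) + τ • ((0 : ℝ), (0 : ℝ), (1 : ℝ)))).2.2)
        (D (0, 0, 1)).2.2 0 :=
      ((ContinuousLinearMap.snd ℝ ℝ ℝ).comp
        (ContinuousLinearMap.snd ℝ ℝ (ℝ × ℝ))).hasFDerivAt.comp_hasDerivAt (0 : ℝ) (line (0, 0, 1))
    have h1 : HasDerivAt (fun τ : ℝ => -2 * Real.arctan (τ / r)) (-2 / r) 0 := by
      refine ((((hasDerivAt_id (0 : ℝ)).div_const r).arctan).const_mul (-2)).congr_deriv ?_
      simp; ring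
    refine h.unique (h1.congr_of_eventuallyEq (Eventually.of_forall fun τ => ?_))
    simp [deformParam]
  rw [LinearMap.range_eq_top]
  rintro ⟨α, β, γ⟩
  obtain ⟨⟨e1, e2, e3⟩, he⟩ : ∃ e, e = D (0, 0, 1) := ⟨_, rfl⟩
  rw [← he] at d3
  simp only at d3
  refine ⟨((α - (-(γ * r / 2)) * e1) / (2 * r), (β - (-(γ * r / 2)) * e2) / (4 * z),
    -(γ * r / 2)), ?_⟩
  have hsplit : ∀ x y w : ℝ, (x, y, w) = x • ((1 : ℝ), (0 : ℝ), (0 : ℝ)) +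
      y • ((0 : ℝ), (1 : ℝ), (0 : ℝ)) + w • ((0 : ℝ), (0 : ℝ), (1 : ℝ)) := by
    intro x y w; simp
  rw [hsplit]
  change D _ = _
  rw [map_add, map_add, map_smul, map_smul, map_smul, d1, d2, ← he]
  ext
  · simp; field_simp; ring
  · simp; field_simp; ring
  · simp [d3]; field_simp

/-- The function of t is odd and continuous, so by the intermediate value theorem it takes on [-ε,
ε] all values between those at ±ε, whatever the sign of l. -/
lemma exists_tanh_eq {l s ε μ : ℝ} (hs : 0 < s) (hε : 0 < ε)
    (h : |μ| ≤ |l| * Real.tanh (ε * s) / s) :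
    ∃ t, |t| ≤ ε ∧ μ = l * Real.tanh (t * s) / s := by
  have hcont : ContinuousOn (fun t => l * Real.tanh (t * s) / s) (Set.uIcc (-ε) ε) := by
    simp only [Real.tanh_eq_sinh_div_cosh]
    refine (((Continuous.div (by fun_prop) (by fun_prop)
      fun t => (Real.cosh_pos _).ne').const_mul l).div_const s).continuousOn
  have hneg : l * Real.tanh (-ε * s) / s = -(l * Real.tanh (ε * s) / s) := by
    rw [neg_mul, Real.tanh_neg]; ring
  have htanh : 0 ≤ Real.tanh (ε * s) := by
    rw [Real.tanh_eq_sinh_div_cosh]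
    exact div_nonneg (Real.sinh_nonneg_iff.2 (by positivity)) (Real.cosh_pos _).le
  have hmem : μ ∈ Set.uIcc (l * Real.tanh (-ε * s) / s) (l * Real.tanh (ε * s) / s) := by
    rw [hneg, Set.mem_uIcc]
    obtain ⟨h1, h2⟩ := abs_le.1 h
    rcases abs_cases l with ⟨hl, -⟩ | ⟨hl, -⟩ <;> rw [hl] at h1 h2
    · exact Or.inl ⟨h1, h2⟩
    · right
      rw [neg_mul, neg_div] at h1 h2
      exact ⟨by linarith, h2⟩
  obtain ⟨t, ht, rfl⟩ := intermediate_value_uIcc hcont hmem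
  refine ⟨t, ?_, rfl⟩
  rw [Set.uIcc_of_le (by linarith)] at ht
  exact abs_le.2 ht

lemma exists_mem_nhds_of_ordConnected {A : Set ℝ} (hA : A.OrdConnected) (hA' : A.Nontrivial) :
    ∃ a, A ∈ 𝓝 a := by
  obtain ⟨x, hx, y, hy, hxy⟩ := hA'.exists_lt
  obtain ⟨m, h1, h2⟩ := exists_between hxy
  exact ⟨m, mem_of_superset (Icc_mem_nhds h1 h2) (hA.out hx hy)⟩

lemma exists_radius_height {a b : ℝ} (h : (a, b) ∈ paramDomain) : ∃ r z, 0 < r ∧ 0 < z ∧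
    Real.sqrt 3 * r / Real.sqrt (1 + r ^ 2 + z ^ 2) = a ∧
    2 * z / Real.sqrt (1 + r ^ 2 + z ^ 2) = b := by
  obtain ⟨ha, hb, hab⟩ := h
  simp only at ha hb hab
  obtain ⟨e0, -, e3⟩ := sqrt_three_bounds
  have hd : 0 < 1 - a ^ 2 / 3 - b ^ 2 / 4 := by linarith
  obtain ⟨S, hS0, hS2⟩ : ∃ S, 0 < S ∧ S ^ 2 = 1 - a ^ 2 / 3 - b ^ 2 / 4 :=
    ⟨_, Real.sqrt_pos.2 hd, Real.sq_sqrt hd.le⟩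
  have hT : Real.sqrt (1 + (a / (Real.sqrt 3 * S)) ^ 2 + (b / (2 * S)) ^ 2) = S⁻¹ := by
    rw [← Real.sqrt_sq (inv_nonneg.2 hS0.le)]
    congr 1
    rw [div_pow, mul_pow, e3]
    field_simp
    linear_combination 12 * hS2
  refine ⟨a / (Real.sqrt 3 * S), b / (2 * S), by positivity, by positivity, ?_, ?_⟩
  · rw [hT]; field_simp
  · rw [hT]; field_simp

/-- From 4 cos² φ > 3 it follows that 4 sin² φ < 1, so one condition on the cosine also controls the
orientation of the lateral faces for φ and -φ. -/
lemma one_add_two_sin_pos {φ : ℝ} (h : Real.sqrt 3 < 2 * Real.cos φ) :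
    0 < 1 + 2 * Real.sin φ := by
  obtain ⟨e0, -, e3⟩ := sqrt_three_bounds
  have := Real.sin_sq_add_cos_sq φ
  have h2 : (2 * Real.sin φ) ^ 2 < 1 := by nlinarith
  have := abs_lt.1 ((sq_lt_one_iff_abs_lt_one _).1 h2)
  linarith

/-- All parameters near those of an undeformed octahedron belong to deformed octahedra. -/
lemma exists_nhds_realizable {A B : Set ℝ} (hAB : A ×ˢ B ⊆ paramDomain)
    {q : ℝ → ℝ → Vert → Mink}
    (hq_isom : ∀ a ∈ A, ∀ b ∈ B, IsInfIsometric (twisted a b) (q a b))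
    (hq_nontrivial : ∀ a ∈ A, ∀ b ∈ B, ¬ IsTrivial (twisted a b) (q a b))
    (hq_symm : ∀ a ∈ A, ∀ b ∈ B, IsSymmetric (q a b))
    (hq_cont : ∀ v, ContinuousOn (fun x : ℝ × ℝ => q x.1 x.2 v) (A ×ˢ B))
    {ε : ℝ} (hε : 0 < ε) {a₀ b₀ : ℝ} (ha₀ : A ∈ 𝓝 a₀) (hb₀ : B ∈ 𝓝 b₀) :
    ∃ u c : ℝ, 0 < u ∧ 0 < c ∧ ∃ V ∈ 𝓝 (u, c, (0 : ℝ)), ∀ x ∈ V,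
      ∃ a ∈ A, ∃ b ∈ B, ∃ t : ℝ, |t| ≤ ε ∧ (x.2.2 ≠ 0 → t ≠ 0) ∧ 0 < x.1 ∧ 0 < x.2.1 ∧
        Real.sqrt 3 < 2 * Real.cos x.2.2 ∧
        IsOcta (deform (twisted a b) (q a b) t) x.1 x.2.1 x.2.2 ∧
        IsOcta (deform (twisted a b) (q a b) (-t)) x.1 x.2.1 (-x.2.2) := by
  obtain ⟨r₀, z₀, hr₀, hz₀, hra, hzb⟩ :=
    exists_radius_height (hAB ⟨mem_of_mem_nhds ha₀, mem_of_mem_nhds hb₀⟩)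
  -- Coordinates y = (r, z, μ) replace (a, b, t): fa and fb recover a and b, l is the factor of q
  -- relative to `baseVector`, and S is the length of the deformation vector.
  let fa : ℝ × ℝ × ℝ → ℝ := fun y => Real.sqrt 3 * y.1 / Real.sqrt (1 + y.1 ^ 2 + y.2.1 ^ 2)
  let fb : ℝ × ℝ × ℝ → ℝ := fun y => 2 * y.2.1 / Real.sqrt (1 + y.1 ^ 2 + y.2.1 ^ 2)
  let l : ℝ × ℝ × ℝ → ℝ := fun y => q (fa y) (fb y) (0, 0) 2
  let S : ℝ × ℝ × ℝ → ℝ := fun y => Real.sqrt (l y ^ 2 * speedSq y.1 y.2.1)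
  have hq : ∀ y : ℝ × ℝ × ℝ, 0 < y.1 → 0 < y.2.1 → fa y ∈ A → fb y ∈ B →
      twisted (fa y) (fb y) = octaOf (baseVertex y.1 y.2.1) ∧
      q (fa y) (fb y) = octaOf (l y • baseVector y.1 y.2.1) ∧ l y ≠ 0 := by
    intro y h1 h2 h3 h4
    have ht : twisted (fa y) (fb y) = octaOf (baseVertex y.1 y.2.1) :=
      twisted_eq_octaOf_baseVertex _ _
    have hi := hq_isom _ h3 _ h4
    rw [ht] at hi
    have he : q (fa y) (fb y) = octaOf (l y • baseVector y.1 y.2.1) :=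
      hi.eq_octaOf h1 h2 (hq_symm _ h3 _ h4)
    -- If the factor vanished, q would be zero and hence the restriction of the zero Killing field.
    refine ⟨ht, he, fun h0 => hq_nontrivial _ h3 _ h4 ⟨0, by simp [mink], fun v => ?_⟩⟩
    rw [he, h0, zero_smul]
    have := octaOf_comb 0 0 0 0 v
    simpa using this
  have hT : ∀ y : ℝ × ℝ × ℝ, Real.sqrt (1 + y.1 ^ 2 + y.2.1 ^ 2) ≠ 0 :=
    fun y => (sq_sqrt_time y.1 y.2.1).1.ne'
  have hfa : Continuous fa := Continuous.div (by fun_prop) (by fun_prop) hT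
  have hfb : Continuous fb := Continuous.div (by fun_prop) (by fun_prop) hT
  have hfa₀ : fa (r₀, z₀, 0) = a₀ := hra
  have hfb₀ : fb (r₀, z₀, 0) = b₀ := hzb
  have hl : ContinuousAt l (r₀, z₀, 0) := by
    have h := (hq_cont (0, 0)).continuousAt (prod_mem_nhds ha₀ hb₀)
    rw [← hfa₀, ← hfb₀] at h
    have h2 : ContinuousAt (fun y => (fa y, fb y)) (r₀, z₀, 0) :=
      (hfa.prodMk hfb).continuousAt
    have h3 : ContinuousAt ((fun x : ℝ × ℝ => q x.1 x.2 (0, 0)) ∘ fun y => (fa y, fb y))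
      (r₀, z₀, 0) := ContinuousAt.comp h h2
    exact (continuous_apply 2).continuousAt.comp h3
  have hspeed : ContinuousAt (fun y : ℝ × ℝ × ℝ => speedSq y.1 y.2.1) (r₀, z₀, 0) :=
    (contDiffAt_speedSq r₀ hz₀).continuousAt
  have hS : ContinuousAt S (r₀, z₀, 0) := (Real.continuous_sqrt.continuousAt).comp
    ((hl.pow 2).mul hspeed)
  have hS₀ : ∀ y : ℝ × ℝ × ℝ, 0 < y.2.1 → l y ≠ 0 → 0 < S y := by
    intro y h1 h2
    have := speedSq_pos (r := y.1) h1
    exact Real.sqrt_pos.2 (by positivity)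
  have hl₀ : l (r₀, z₀, 0) ≠ 0 := (hq (r₀, z₀, 0) hr₀ hz₀ (by rw [hfa₀]; exact mem_of_mem_nhds ha₀)
    (by rw [hfb₀]; exact mem_of_mem_nhds hb₀)).2.2
  have ev1 : ∀ᶠ y : ℝ × ℝ × ℝ in 𝓝 (r₀, z₀, 0), 0 < y.1 :=
    continuous_fst.continuousAt.eventually (lt_mem_nhds hr₀)
  have ev2 : ∀ᶠ y : ℝ × ℝ × ℝ in 𝓝 (r₀, z₀, 0), 0 < y.2.1 :=
    (show Continuous fun y : ℝ × ℝ × ℝ => y.2.1 by fun_prop).continuousAt.eventually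
      (lt_mem_nhds hz₀)
  have ev3 : ∀ᶠ y : ℝ × ℝ × ℝ in 𝓝 (r₀, z₀, 0), fa y ∈ A :=
    hfa.continuousAt.eventually (by rw [hfa₀]; exact ha₀)
  have ev4 : ∀ᶠ y : ℝ × ℝ × ℝ in 𝓝 (r₀, z₀, 0), fb y ∈ B :=
    hfb.continuousAt.eventually (by rw [hfb₀]; exact hb₀)
  have ev5 : ∀ᶠ y : ℝ × ℝ × ℝ in 𝓝 (r₀, z₀, 0), |y.2.2| * y.1 < 4 * y.2.1 ^ 2 := by
    refine ContinuousAt.eventually_lt (by fun_prop) (by fun_prop) ?_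
    simp only [abs_zero, zero_mul]
    positivity
  -- Continuity of q enters here: near the base point one range of μ is reached by times |t| ≤ ε for
  -- all nearby a and b.
  have ev6 : ∀ᶠ y : ℝ × ℝ × ℝ in 𝓝 (r₀, z₀, 0), |y.2.2| < |l y| * Real.tanh (ε * S y) / S y := by
    have hpos := hS₀ (r₀, z₀, 0) hz₀ hl₀
    simp only [Real.tanh_eq_sinh_div_cosh]
    refine ContinuousAt.eventually_lt (by fun_prop) (ContinuousAt.div (hl.abs.mul
      (ContinuousAt.div ?_ ?_ (Real.cosh_pos _).ne')) hS hpos.ne') ?_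
    · exact Real.continuous_sinh.continuousAt.comp (continuousAt_const.mul hS)
    · exact Real.continuous_cosh.continuousAt.comp (continuousAt_const.mul hS)
    · rw [abs_zero]
      have h1 := Real.sinh_pos_iff.2 (mul_pos hε hpos)
      have h2 := Real.cosh_pos (ε * S (r₀, z₀, 0))
      have h3 := abs_pos.2 hl₀
      positivity
  have ev7 : ∀ᶠ y : ℝ × ℝ × ℝ in 𝓝 (r₀, z₀, 0), 0 < 1 - y.2.2 ^ 2 * speedSq y.1 y.2.1 := by
    have h1 : ContinuousAt (fun y : ℝ × ℝ × ℝ => y.2.2) (r₀, z₀, 0) := by fun_prop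
    refine (continuousAt_const.sub ((h1.pow 2).mul hspeed)).eventually (lt_mem_nhds ?_)
    simp
  have ev8 : ∀ᶠ y : ℝ × ℝ × ℝ in 𝓝 (r₀, z₀, 0),
      Real.sqrt 3 < 2 * Real.cos (deformParam y).2.2 := by
    have hcont : ContinuousAt (fun y => 2 * Real.cos (deformParam y).2.2) (r₀, z₀, (0 : ℝ)) :=
      continuousAt_const.mul (Real.continuous_cos.continuousAt.comp
        (contDiffAt_deformParam hr₀ hz₀).continuousAt.snd.snd)
    refine hcont.eventually (lt_mem_nhds ?_)
    simp only [deformParam_zero]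
    simpa using sqrt_three_bounds.2.1
  refine ⟨r₀ ^ 2, 2 * z₀ ^ 2, by positivity, by positivity, deformParam '' {y | 0 < y.1 ∧ 0 < y.2.1 ∧
    fa y ∈ A ∧ fb y ∈ B ∧ |y.2.2| * y.1 < 4 * y.2.1 ^ 2 ∧
    |y.2.2| < |l y| * Real.tanh (ε * S y) / S y ∧ 0 < 1 - y.2.2 ^ 2 * speedSq y.1 y.2.1 ∧
    Real.sqrt 3 < 2 * Real.cos (deformParam y).2.2}, ?_, ?_⟩
  · rw [← map_nhds_deformParam hr₀ hz₀]
    refine image_mem_map ?_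
    filter_upwards [ev1, ev2, ev3, ev4, ev5, ev6, ev7, ev8] with y h1 h2 h3 h4 h5 h6 h7 h8
    exact ⟨h1, h2, h3, h4, h5, h6, h7, h8⟩
  · rintro _ ⟨y, ⟨h1, h2, h3, h4, h5, h6, h7, h8⟩, rfl⟩
    obtain ⟨ht, hqy, hly⟩ := hq y h1 h2 h3 h4
    have hSy := hS₀ y h2 hly
    obtain ⟨t, hte, hμ⟩ := exists_tanh_eq (l := l y) hSy hε h6.le
    refine ⟨fa y, h3, fb y, h4, t, hte, ?_, ?_, ?_, h8, ?_, ?_⟩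
    · rintro hne rfl
      refine hne ?_
      rw [zero_mul, Real.tanh_zero, mul_zero, zero_div] at hμ
      simp [deformParam, hμ]
    · simp only [deformParam]; positivity
    · simp only [deformParam]; positivity
    · rw [ht, hqy]
      exact isOcta_deform h1 h2 hly rfl hμ
        ((mul_le_mul_of_nonneg_right (le_abs_self _) h1.le).trans_lt h5)
    · rw [ht, hqy]
      have := isOcta_deform (t := -t) (μ := -y.2.2) h1 h2 hly rfl
        (by rw [neg_mul, Real.tanh_neg, hμ]; ring)
        ((mul_le_mul_of_nonneg_right (neg_le_abs _) h1.le).trans_lt h5)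
      rw [deformParam_neg] at this
      exact this

end Realization

end TwistedOcta

/-! ### Assembling the two cone-manifolds -/

open TwistedOcta
theorem mainTheorem7 (A B : Set ℝ)
    (hA : A.OrdConnected) (hA' : A.Nontrivial) (hB : B.OrdConnected) (hB' : B.Nontrivial)
    (hAB : A ×ˢ B ⊆ paramDomain)
    (q : ℝ → ℝ → Vert → Mink)
    (hq_isom : ∀ a ∈ A, ∀ b ∈ B, IsInfIsometric (twisted a b) (q a b))
    (hq_nontrivial : ∀ a ∈ A, ∀ b ∈ B, ¬ IsTrivial (twisted a b) (q a b))
    (hq_symm : ∀ a ∈ A, ∀ b ∈ B, IsSymmetric (q a b))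
    (hq_cont : ∀ v, ContinuousOn (fun x : ℝ × ℝ => q x.1 x.2 v) (A ×ˢ B))
    (ε : ℝ) (hε : 0 < ε) :
    ∃ i j : Fin 3, i ≠ j ∧
    ∃ t₁ ∈ Set.Ioc 0 ε, ∃ t₂ ∈ Set.Ioc 0 ε, ∃ a₁ ∈ A, ∃ a₂ ∈ A, ∃ b₁ ∈ B, ∃ b₂ ∈ B,
      IsConeManifold (leftPiece q i t₁ a₁ b₁) (rightPiece q i t₁ a₁ b₁) ∧
      IsConeManifold (leftPiece q j t₂ a₂ b₂) (rightPiece q j t₂ a₂ b₂) ∧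
      SameConeAngles (leftPiece q i t₁ a₁ b₁) (rightPiece q i t₁ a₁ b₁)
        (leftPiece q j t₂ a₂ b₂) (rightPiece q j t₂ a₂ b₂) := by
  obtain ⟨a₀, ha₀⟩ := exists_mem_nhds_of_ordConnected hA hA'
  obtain ⟨b₀, hb₀⟩ := exists_mem_nhds_of_ordConnected hB hB'
  obtain ⟨u, c, hu, hc, V, hV, hreal⟩ :=
    exists_nhds_realizable hAB hq_isom hq_nontrivial hq_symm hq_cont hε ha₀ hb₀
  -- The point (u, c, φ) will give M², and (u₂, c₂, ψ) will give M¹ or M³; ψ ≠ 0 ensures a nonzero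
  -- time for the latter.
  obtain ⟨φ, hφ, hφV, ⟨u₂, c₂, ψ⟩, hxV, hψ, hE⟩ := exists_even_coincidence hu hc hV
  obtain ⟨a₁, ha₁, b₁, hb₁, t, ht, ht0, -, -, hcos, hp, hp'⟩ := hreal _ hφV
  obtain ⟨a₂, ha₂, b₂, hb₂, t', ht', ht0', hu₂, hc₂, hcos₂, hr, -⟩ := hreal _ hxV
  simp only at ht0 hcos hp hp' hψ ht0' hu₂ hc₂ hcos₂ hr
  have ht0 := ht0 hφ.ne'
  have ht0' := ht0' hψ
  -- Times must be positive, so |t'| is used and the sign of t' is absorbed into the index: 0 stands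
  -- for M¹, 2 for M³.
  obtain ⟨j, hj, hL, hR⟩ : ∃ j : Fin 3, 1 ≠ j ∧ signL j * |t'| = t' ∧ signR j * |t'| = t' := by
    rcases ht0'.lt_or_gt with h | h
    · exact ⟨2, by decide, by simp [signL, abs_of_neg h], by simp [signR, abs_of_neg h]⟩
    · exact ⟨0, by decide, by simp [signL, abs_of_pos h], by simp [signR, abs_of_pos h]⟩
  -- For M² a negative t merely exchanges the two pieces, that is, φ and -φ.
  obtain ⟨χ, hχ, hpL, hpR⟩ : ∃ χ, (χ = φ ∨ χ = -φ) ∧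
      IsOcta (leftPiece q 1 |t| a₁ b₁) u c χ ∧ IsOcta (rightPiece q 1 |t| a₁ b₁) u c (-χ) := by
    rcases ht0.lt_or_gt with h | h
    · refine ⟨-φ, Or.inr rfl, ?_, ?_⟩
      · simpa [leftPiece, signL, abs_of_neg h] using hp'
      · simpa [rightPiece, signR, abs_of_neg h] using hp
    · refine ⟨φ, Or.inl rfl, ?_, ?_⟩
      · simpa [leftPiece, signL, abs_of_pos h] using hp
      · simpa [rightPiece, signR, abs_of_pos h] using hp'
  have hcosχ : Real.sqrt 3 < 2 * Real.cos χ := by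
    rcases hχ with rfl | rfl
    · exact hcos
    · rwa [Real.cos_neg]
  have hEχ : angleMap (u, c, χ) + angleMap (u, c, -χ) =
      angleMap (u₂, c₂, ψ) + angleMap (u₂, c₂, ψ) := by
    rw [← two_smul ℝ (angleMap (u₂, c₂, ψ)), hE]
    rcases hχ with rfl | rfl
    · rfl
    · rw [neg_neg, add_comm]
  have hrL : IsOcta (leftPiece q j |t'| a₂ b₂) u₂ c₂ ψ := by rw [leftPiece, hL]; exact hr
  have hrR : IsOcta (rightPiece q j |t'| a₂ b₂) u₂ c₂ ψ := by rw [rightPiece, hR]; exact hr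
  have hs := one_add_two_sin_pos hcosχ
  have hs' := one_add_two_sin_pos (φ := -χ) (by rwa [Real.cos_neg])
  have hs₂ := one_add_two_sin_pos hcos₂
  exact ⟨1, j, hj, |t|, ⟨abs_pos.2 ht0, ht⟩, |t'|, ⟨abs_pos.2 ht0', ht'⟩, a₁, ha₁, a₂, ha₂, b₁, hb₁,
    b₂, hb₂, hpL.isConeManifold hpR hu hs hs' (Real.cos_neg χ).symm,
    hrL.isConeManifold hrR hu₂ hs₂ hs₂ rfl,
    hpL.sameConeAngles hpR hu hc hcosχ (Real.cos_neg χ).symm hs hs' hrL hrR hu₂ hc₂ hcos₂ rfl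
      hs₂ hs₂ hEχ⟩
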